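/- Setting. Let $h$ be a prime power, $n,m\ge 1$, $t=nm$, $\sigma(x)=x^h$, and consider the tower $\mathbb F_h\subseteq\mathbb F_{h^n}\subseteq\mathbb F_{h^t}$. For $a,b\in\mathbb F_{h^t}$ and a skew polynomial $f=\sum_{i<k}f_ix^i\in\mathbb F_{h^t}[x;\sigma]$ put $f(b)_a=\sum_{i<k} f_i\,\sigma^i(b)\prod_{j<i}\sigma^j(a)$. Let $n=n_1+\dots+n_\ell$ with all $n_i\ge1$ and $1\le k\le n$. An evaluation pair $(\boldsymbol a,\boldsymbol\beta)$ over $\mathbb F_{h^n}$ consists of nonzero $a_1,\dots,a_\ell\in\mathbb F_{h^n}$ in pairwise distinct $\sigma$-conjugacy classes of $\mathbb F_{h^t}$ (i.e. $a_j\ne\sigma(c)a_ic^{-1}$ for all $i\neq j$ and $c\in\mathbb F_{h^t}^*$) and, for each $i$, elements $\beta_{i,1},\dots,\beta_{i,n_i}\in\mathbb F_{h^n}$ that are linearly independent over $\mathbb F_h$. The linearized Reed–Solomon code is $\mathrm{LRS}[\boldsymbol a,\boldsymbol\beta;\boldsymbol n,k]=\{(f(\beta_{i,j})_{a_i})_{i,j}: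 \deg f<k\}\subseteq\mathbb F_{h^t}^n$. The sum-rank distance of $x,y\in \mathbb F_{h^t}^n$ is the sum over the $\ell$ blocks $i$ of $\dim_{\mathbb F_h}$ of the span of the entries $x_{i,j}-y_{i,j}$, and the rate of $\mathcal C\subseteq\mathbb F_{h^t}^n$ is $\frac1n\log_{h^t}|\mathcal C|$. A family $H_1,\dots,H_k$ of $\mathbb F_h$-subspaces of $\mathbb F_{h^t}\cong\mathbb F_{h^n}^m$ is an $(s,A,n)$ $\mathbb F_h$-subspace design if $\sum_i\dim_{\mathbb F_h}(H_i\cap W)\le A$ for every $\mathbb F_{h^n}$-subspace $W$ of $\mathbb F_{h^t}$ of $\mathbb F_{h^n}$-dimension $s$. For algorithms, $\mathbb F_{h^t}$ is given by the structure constants of a basis over its prime field $\mathbb F_p$, its elements by their coordinates, all numbers in binary; time is counted in bit operations (up to a polynomial), and polynomial means at most $c\,|{\rm input}|^c$ with an absolute constant $c$. Theorem. Let $\varepsilon\in(0,1)$, $s\ge1$, and let $m=\Theta(s/\varepsilon)$ be an integer with $4s/\varepsilon\le m\le\kappa s/\varepsilon$ (so $s\le m$), where $\kappa$ is any constant. Write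 $D=C s^2/\varepsilon^2$, where $C$ depends only on $\kappa$. There are two deterministic polynomial-time algorithms (depending on $\varepsilon,s,m$ only) such that for all $h$, $n$, all representations of $\mathbb F_{h^t}$ with $t=nm$, and all $1\le k\le n$ there is an $(s,D,n)$ $\mathbb F_h$-subspace design $H_1,\dots,H_k\subseteq\mathbb F_{h^t}$ with the following properties. The first algorithm computes $\mathbb F_h$-bases of $H_1,\dots,H_k$ from the field, $h$, $n$ and $k$. For every partition $n=n_1+\dots+n_\ell$ and every evaluation pair over $\mathbb F_{h^n}$, let $\mathcal C$ be the $\mathbb F_h$-linear subcode of $\mathrm{LRS}[\boldsymbol a,\boldsymbol\beta;\boldsymbol n,k]$ formed by the codewords of $f=\sum_{i<k} f_ix^i$ with $f_i\in H_{i+1}$ for all $i$. Then: 1. $\mathcal C$ has rate at least $(1-2\varepsilon)k/n$. 2. For every $y\in\mathbb F_{h^t}^n$, the second algorithm computes from $(\boldsymbol a,\boldsymbol\beta)$, $y$ and the data above an $\mathbb F_h$-basis of an $\mathbb F_h$-subspace $V\subseteq\mathcal C$ with $\dim_{\mathbb F_h}V\le D$ that contains every codeword of $\mathcal C$ at sum-rank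 distance at most $\frac{s}{s+1}(n-k)$ from $y$. In particular there are at most $h^{D}=h^{O(s^2/\varepsilon^2)}$ such codewords. -/

import Mathlib

open Module

/-! ### A programming language with a step count

Data are binary trees whose leaves are natural numbers written in binary.  Every
primitive operation is charged quadratically in the number of bits it reads and writes (the cost of
schoolbook arithmetic), so running times agree with Turing machine times up to a polynomial. -/

/-- Binary trees with natural numbers at the leaves. -/
inductive Data : Type
  | num (n : ℕ) : Data
  | pair (x y : Data) : Data

namespace Data

/-- Bit length of a tree. -/
def size : Data → ℕ
  | num n => Nat.size n + 1
  | pair x y => size x + size y + 1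

/-- Lists as right combs ending in `num 0`. -/
def ofList : List Data → Data
  | [] => num 0
  | x :: l => pair x (ofList l)

/-- Lists of lists. -/
def ofLists (l : List (List Data)) : Data := ofList (l.map ofList)

/-- Apply a binary operation on numbers (anything else is sent to `num 0`). -/
def arith (f : ℕ → ℕ → ℕ) : Data → Data
  | pair (num a) (num b) => num (f a b)
  | _ => num 0

end Data

/-- Primitive operations. -/
inductive PrimOp : Type
  | skip | const (d : Data) | fst | snd | isNum | le | add | sub | mul | div | mod

/-- The meaning of the primitive operations. -/
def PrimOp.apply : PrimOp → Data → Data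
  | skip, x => x
  | const d, _ => d
  | fst, Data.pair x _ => x
  | fst, Data.num _ => Data.num 0
  | snd, Data.pair _ y => y
  | snd, Data.num _ => Data.num 0
  | isNum, Data.num _ => Data.num 1
  | isNum, Data.pair _ _ => Data.num 0
  | le, x => Data.arith (fun a b => if a ≤ b then 1 else 0) x
  | add, x => Data.arith (fun a b => a + b) x
  | sub, x => Data.arith (fun a b => a - b) x
  | mul, x => Data.arith (fun a b => a * b) x
  | div, x => Data.arith (fun a b => a / b) x
  | mod, x => Data.arith (fun a b => a % b) x

/-- Programs.  A test counts as true if its value is not `num 0`. -/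
inductive Prog : Type
  | prim (o : PrimOp) : Prog
  | pair (f g : Prog) : Prog
  | comp (g f : Prog) : Prog
  | branch (test f g : Prog) : Prog
  | loop (test body : Prog) : Prog

/-- `Run P x y t`: on input `x` the program `P` halts with output `y` after time `t`. -/
inductive Run : Prog → Data → Data → ℕ → Prop
  | prim (o : PrimOp) (x : Data) :
      Run (Prog.prim o) x (o.apply x) ((x.size + (o.apply x).size) ^ 2)
  | pair {f g : Prog} {x y z : Data} {t u : ℕ} :
      Run f x y t → Run g x z u → Run (Prog.pair f g) x (Data.pair y z) (t + u + 1)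
  | comp {f g : Prog} {x y z : Data} {t u : ℕ} :
      Run f x y t → Run g y z u → Run (Prog.comp g f) x z (t + u + 1)
  | branchTrue {c f g : Prog} {x b y : Data} {t u : ℕ} :
      Run c x b t → b ≠ Data.num 0 → Run f x y u → Run (Prog.branch c f g) x y (t + u + 1)
  | branchFalse {c f g : Prog} {x y : Data} {t u : ℕ} :
      Run c x (Data.num 0) t → Run g x y u → Run (Prog.branch c f g) x y (t + u + 1)
  | loopDone {c f : Prog} {x : Data} {t : ℕ} :
      Run c x (Data.num 0) t → Run (Prog.loop c f) x x (t + 1)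
  | loopStep {c f : Prog} {x b y z : Data} {t u v : ℕ} :
      Run c x b t → b ≠ Data.num 0 → Run f x y u → Run (Prog.loop c f) y z v →
      Run (Prog.loop c f) x z (t + u + v + 1)

/-- `P` maps `x` to `y` within `c * |x| ^ c` steps, where `|x|` is the bit length of `x`. -/
def RunsInPolyTime (c : ℕ) (P : Prog) (x y : Data) : Prop :=
  ∃ t : ℕ, Run P x y t ∧ t ≤ c * x.size ^ c

/-! ### Linearized Reed--Solomon codes and the sum-rank metric

`K = F_h`, `E = F_{h^n}`, `L = F_{h^t}`, `t = n m`, and `σ x = x ^ h` with `h = Nat.card K`. -/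

section Codes

variable (K : Type*) {E L : Type*} [Field K] [Field E] [Field L] [Algebra K E] [Algebra E L]
  [Algebra K L]

/-- The generalized power function `N_i(a) = ∏_{j < i} σ^j(a)`. -/
noncomputable def genPow (i : ℕ) (a : L) : L := ∏ j ∈ Finset.range i, a ^ Nat.card K ^ j

/-- The generalized operator evaluation `f(b)_a = ∑_i f_i σ^i(b) N_i(a)` of the skew polynomial
`f = ∑_{i < k} f_i x^i`, given by its coefficients. -/
noncomputable def opEval {k : ℕ} (f : Fin k → L) (a b : L) : L :=
  ∑ i : Fin k, f i * b ^ Nat.card K ^ (i : ℕ) * genPow K i a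

/-- Words with blocks of lengths `ν 0, ν 1, …`. -/
abbrev BlockWord (L : Type*) {ℓ : ℕ} (ν : Fin ℓ → ℕ) : Type _ := (i : Fin ℓ) → Fin (ν i) → L

/-- `σ`-conjugacy in `L`: `b = σ(c) a c⁻¹` for some nonzero `c`. -/
def IsSigmaConj (a b : L) : Prop := ∃ c : L, c ≠ 0 ∧ b = c ^ Nat.card K * a * c⁻¹

/-- Evaluation pairs `(a, β)` with entries in `E`. -/
structure IsEvaluationPair (L : Type*) [Field L] [Algebra E L] {ℓ : ℕ} {ν : Fin ℓ → ℕ}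
    (a : Fin ℓ → E) (β : BlockWord E ν) : Prop where
  ne_zero : ∀ i, a i ≠ 0
  not_conj : ∀ i j, i ≠ j → ¬ IsSigmaConj K (algebraMap E L (a i)) (algebraMap E L (a j))
  linearIndependent : ∀ i, LinearIndependent K (β i)

/-- The evaluation map `f ↦ f(β)_a` on skew polynomials of degree `< k`. -/
noncomputable def lrsEval (L : Type*) [Field L] [Algebra E L] (k : ℕ) {ℓ : ℕ} {ν : Fin ℓ → ℕ}
    (a : Fin ℓ → E) (β : BlockWord E ν) : (Fin k → L) →ₗ[L] BlockWord L ν where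
  toFun f := fun i j => opEval K f (algebraMap E L (a i)) (algebraMap E L (β i j))
  map_add' f g := by
    funext i j
    simp [opEval, add_mul, Finset.sum_add_distrib]
  map_smul' r f := by
    funext i j
    simp [opEval, Finset.mul_sum, mul_assoc]

/-- The linearized Reed--Solomon code. -/
noncomputable def lrsCode (L : Type*) [Field L] [Algebra E L] (k : ℕ) {ℓ : ℕ} {ν : Fin ℓ → ℕ}
    (a : Fin ℓ → E) (β : BlockWord E ν) : Submodule L (BlockWord L ν) :=
  LinearMap.range (lrsEval K L k a β)

/-- The `K`-linear subcode of the linearized Reed--Solomon code obtained by restricting the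
`i`-th coefficient of the message polynomial to `H i`. -/
noncomputable def lrsSubcode {k : ℕ} (H : Fin k → Submodule K L) {ℓ : ℕ} {ν : Fin ℓ → ℕ}
    (a : Fin ℓ → E) (β : BlockWord E ν) : Submodule K (BlockWord L ν) :=
  (Submodule.pi Set.univ H).map ((lrsEval K L k a β).restrictScalars K)

/-- The sum-rank weight over `K`: the rank of the matrix over `K` whose columns are the coordinate
vectors of the entries of a block is the dimension of the `K`-span of these entries. -/
noncomputable def sumRankWeight {ℓ : ℕ} {ν : Fin ℓ → ℕ} (x : BlockWord L ν) : ℕ :=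
  ∑ i, finrank K (Submodule.span K (Set.range (x i)))

/-- The sum-rank distance over `K`. -/
noncomputable def sumRankDist {ℓ : ℕ} {ν : Fin ℓ → ℕ} (x y : BlockWord L ν) : ℕ :=
  sumRankWeight K (x - y)

/-- The rate `log_{|L|} |C| / n` of a code `C` of length `n` over the alphabet `L`. -/
noncomputable def codeRate {ℓ : ℕ} {ν : Fin ℓ → ℕ} (C : Submodule K (BlockWord L ν)) : ℝ :=
  Real.logb (Nat.card L) (Nat.card C) / ((∑ i, ν i : ℕ) : ℝ)

/-- The family `H` of `K`-subspaces of the `E`-vector space `V` is an `(s, A, [E : K])`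
`K`-subspace design. -/
def IsSubspaceDesign (E : Type*) [Field E] {V : Type*} [AddCommGroup V] [Module K V] [Module E V]
    [Algebra K E] [IsScalarTower K E V] {ι : Type*} [Fintype ι]
    (s : ℕ) (A : ℝ) (H : ι → Submodule K V) : Prop :=
  ∀ W : Submodule E V, finrank E W = s →
    ((∑ i, finrank K ↥(H i ⊓ W.restrictScalars K) : ℕ) : ℝ) ≤ A

/-- `l` lists the elements of a `K`-basis of `U`. -/
def IsBasisList {V : Type*} [AddCommGroup V] [Module K V] (l : List V) (U : Submodule K V) : Prop :=
  LinearIndependent K l.get ∧ Submodule.span K (Set.range l.get) = U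

end Codes

/-! ### Encoding of the field and of words

The field `L` is given by explicit data: a basis `b` over the prime field, with the
structure constants of the multiplication. -/

section Encoding

variable {p N : ℕ} {L : Type*} [Field L] [Algebra (ZMod p) L]

/-- An element of `L`, as the list of its coordinates. -/
noncomputable def encElem (b : Basis (Fin N) (ZMod p) L) (x : L) : Data :=
  Data.ofList (List.ofFn fun i => Data.num (b.repr x i).val)

/-- A word, as the list of its blocks. -/
noncomputable def encWord (b : Basis (Fin N) (ZMod p) L) {ℓ : ℕ} {ν : Fin ℓ → ℕ}
    (w : BlockWord L ν) : Data :=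
  Data.ofLists (List.ofFn fun i => List.ofFn fun j => encElem b (w i j))

/-- The table of the products `b i * b j`. -/
noncomputable def encTable (b : Basis (Fin N) (ZMod p) L) : Data :=
  Data.ofLists (List.ofFn fun i => List.ofFn fun j => encElem b (b i * b j))

/-- The parameters: the field `L`, the size `h` of the small field, the length `n` and the
dimension `k`. -/
noncomputable def encParams (b : Basis (Fin N) (ZMod p) L) (h n k : ℕ) : Data :=
  Data.ofList [Data.num p, encTable b, Data.num h, Data.num n, Data.num k]

/-- The input of the decoder: the parameters, the evaluation pair and the received word. -/
noncomputable def encReceived (b : Basis (Fin N) (ZMod p) L) (h n k : ℕ)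
    {E : Type*} [Field E] [Algebra E L] {ℓ : ℕ} {ν : Fin ℓ → ℕ}
    (a : Fin ℓ → E) (β : BlockWord E ν) (y : BlockWord L ν) : Data :=
  Data.ofList [encParams b h n k,
    Data.ofList (List.ofFn fun i => encElem b (algebraMap E L (a i))),
    encWord b (fun i j => algebraMap E L (β i j) : BlockWord L ν),
    encWord b y]

end Encoding

/-!
Write `K ⊆ E ⊆ L` for the tower, with `[E : K] = n`, `[L : E] = m`, and `h = |K|`.

**The design.** An element `x` of `L` is identified with the polynomial over `E` whose `m`
coefficients are its trace coordinates `Tr (e j * x)`. Requiring that this polynomial vanish at `2 s`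
consecutive powers of an element `γ` of `E`, with a separate block of powers for each index `i`, gives
`E`-subspaces of `L`. For an `E`-space `W` of dimension `s`, the folded Wronskian of a basis of `W` is
a nonzero polynomial of small degree which vanishes, with multiplicity, wherever these spaces meet
`W`; so their intersections with `W` have total `E`-dimension at most `s (m - 1) / (s + 1) < m`
(`folded_design`). The passage from `E` to `K` would cost a factor `n`. It is avoided by imposing in
addition `s` linearized equations `∑ j, γ ^ ((l + 1) (j + 1)) * x j ^ h ^ j = 0` on the coordinates
`x j`. In an `E`-space of dimension `d ≤ s` they leave only a `K`-space of dimension at most `d m`: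
modulo lower Frobenius powers they form a Vandermonde system, hence some `E`-space of functions of
dimension at most `d m` contains the coordinates and is stable under Frobenius, and by Galois descent
the space of solutions is no larger than that (`finrank_le_of_linearized_equations`).
Altogether at most `3 s n` of the `n m` dimensions of `L` over `K` are given up and the intersections
have total dimension at most `m ^ 2`.

The argument needs the powers `γ ^ j`, `j < n m`, to be distinct. A search through few elements of
`E` fails to find such a `γ` only if `2 ^ n ≤ (n m) ^ 2`. Then `n ^ 2 ≤ 64 m`
(`sq_le_of_two_pow_le`), and the spaces `H i = L` are already a design. The two cases are combined in
`design_bounds`. The bound on the codimension gives the rate (`codeRate_ge`).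

**Decoding.** Linear algebra produces skew polynomials `A₀, A 0, …, A (s - 1)`, not all zero, with
`A₀(β i j) + ∑ u, A u (y i j ^ h ^ (n u)) = 0`, evaluated at `a i`, for all `i`, `j` (`interpV_spec`). Raising to
the power `h ^ (n u)` fixes `E`, so substituting `f(β i j)` for `y i j` turns the left side into the
evaluation of one skew polynomial (`sum_solveCoef`). If `f` is close to `y` in the sum-rank metric,
then that polynomial has too many roots (`skew_root_count`) and is therefore zero
(`solveCoef_eq_zero`). Its coefficients give a triangular system for the coefficients of `f`; each
coefficient of `f` is determined by the preceding ones up to the kernel of a fixed `E`-linear map,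
whose `E`-dimension is at most `s`. Since the coefficients lie in the spaces of the design, the
dimensions add up to at most `64 m ^ 2`. Replacing `A₀` by `c * A₀` with an unknown `c ∈ K` makes the
affine solution set a linear space at the cost of one dimension (`finrank_solutionSpace_le`), and
`1 + 64 m ^ 2 ≤ 65 κ ^ 2 s ^ 2 / ε ^ 2`.

**Running time.** `PT f` says that `f` is computed by a program in polynomial time. The predicate is
closed under composition, recursion on lists with outputs of bounded size, and the usual arithmetic,
so it is inferred from the way in which a function is written down, and `PT.exists_prog` extracts the
program. The parameters `m` and `s` are built into that program as a constant, but there is a single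
function `f` for all of them, which is why the exponent is absolute. All linear algebra is done over
the prime field and without inverses: `kerBy` intersects kernels by eliminating one equation after
another with `w ↦ a w - b v`, and `greedy` keeps the vectors of a list that are not in the `K`-span of
the earlier ones.
-/

/-! ### Polynomial-time functions -/

/-- Types whose elements are encoded as data. -/
class Enc (α : Type) where
  /-- The encoding. -/
  enc : α → Data

open Enc

instance : Enc ℕ := ⟨Data.num⟩
instance {α β : Type} [Enc α] [Enc β] : Enc (α × β) := ⟨fun x => Data.pair (enc x.1) (enc x.2)⟩
instance {α : Type} [Enc α] : Enc (List α) := ⟨fun l => Data.ofList (l.map enc)⟩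

section
variable {α β γ δ : Type} [Enc α] [Enc β] [Enc γ] [Enc δ]

theorem enc_nil : enc ([] : List α) = Data.num 0 := rfl

/-- The bit length of the encoding. -/
def sz (x : α) : ℕ := (enc x).size

theorem Data.one_le_size (d : Data) : 1 ≤ d.size := by
  cases d <;> simp [Data.size]

theorem one_le_sz (x : α) : 1 ≤ sz x := Data.one_le_size _
theorem sz_prod (x : α) (y : β) : sz (x, y) = sz x + sz y + 1 := rfl
theorem sz_fst_le (x : α × β) : sz x.1 ≤ sz x := by
  rw [← Prod.mk.eta (p := x), sz_prod]; simp; omega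
theorem sz_snd_le (x : α × β) : sz x.2 ≤ sz x := by
  rw [← Prod.mk.eta (p := x), sz_prod]; simp; omega
theorem sz_nil : sz ([] : List α) = 1 := by simp [sz, enc_nil, Data.size]
theorem sz_cons (x : α) (l : List α) : sz (x :: l) = sz x + sz l + 1 := rfl
theorem sz_nat (n : ℕ) : sz n = Nat.size n + 1 := rfl

/-- A run takes at least as long as it takes to read its input and to write its output. -/
theorem Run.size_le {P : Prog} {x y : Data} {t : ℕ} (h : Run P x y t) :
    x.size ≤ t ∧ y.size ≤ t := by
  induction h with
  | prim o x =>
    have := Nat.le_self_pow (n := 2) (by omega) (x.size + (o.apply x).size)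
    omega
  | pair _ _ h1 h2 => simp only [Data.size]; omega
  | comp _ _ h1 h2 => omega
  | branchTrue _ _ _ h1 h2 => omega
  | branchFalse _ _ h1 h2 => omega
  | loopDone _ h => omega
  | loopStep _ _ _ _ h1 h2 h3 => omega

/-- Functions bounded by a polynomial in the size of their argument. -/
def PB (B : α → ℕ) : Prop := ∃ c : ℕ, ∀ x, B x ≤ (sz x + 2) ^ c

theorem PB.mono {B B' : α → ℕ} (h : PB B') (hB : ∀ x, B x ≤ B' x) : PB B :=
  h.imp fun _ hc x => (hB x).trans (hc x)

theorem PB.const (n : ℕ) : PB (fun _ : α => n) :=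
  ⟨n, fun x => (Nat.lt_two_pow_self (n := n)).le.trans (Nat.pow_le_pow_left (by omega) _)⟩

theorem PB.size_self : PB (fun x : α => sz x) := ⟨1, fun x => by simp⟩

theorem PB.mul {B B' : α → ℕ} (h : PB B) (h' : PB B') : PB (fun x => B x * B' x) := by
  obtain ⟨c, hc⟩ := h
  obtain ⟨d, hd⟩ := h'
  exact ⟨c + d, fun x => by rw [pow_add]; exact Nat.mul_le_mul (hc x) (hd x)⟩

theorem PB.add {B B' : α → ℕ} (h : PB B) (h' : PB B') : PB (fun x => B x + B' x) := by
  obtain ⟨c, hc⟩ := h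
  obtain ⟨d, hd⟩ := h'
  refine ⟨c + d + 1, fun x => ?_⟩
  have a1 : (sz x + 2) ^ c ≤ (sz x + 2) ^ (c + d) := Nat.pow_le_pow_right (by omega) (by omega)
  have a2 : (sz x + 2) ^ d ≤ (sz x + 2) ^ (c + d) := Nat.pow_le_pow_right (by omega) (by omega)
  have := hc x
  have := hd x
  rw [pow_succ]
  nlinarith [Nat.zero_le (sz x), Nat.zero_le ((sz x + 2) ^ (c + d))]

theorem PB.pow {B : α → ℕ} (h : PB B) (n : ℕ) : PB (fun x => B x ^ n) := by
  obtain ⟨c, hc⟩ := h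
  exact ⟨c * n, fun x => by rw [pow_mul]; exact Nat.pow_le_pow_left (hc x) n⟩

/-- Polynomial-time computable functions: some program computes `f` on encodings, in time bounded
by a polynomial in the size of the input.  The closure properties below are tagged `fun_prop`, so
that a function built from polynomial-time functions is recognized automatically. -/
@[fun_prop]
def PT (f : α → β) : Prop :=
  ∃ P : Prog, ∃ B : α → ℕ, PB B ∧ ∀ x, ∃ t, Run P (enc x) (enc (f x)) t ∧ t ≤ B x

theorem PT.pb {f : α → β} (h : PT f) : PB (fun x => sz (f x)) := by
  obtain ⟨P, B, hB, h⟩ := h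
  refine hB.mono fun x => ?_
  obtain ⟨t, ht, hle⟩ := h x
  exact ht.size_le.2.trans hle

theorem PB.comp {B : β → ℕ} (hB : PB B) {f : α → β} (h : PT f) : PB (fun x => B (f x)) := by
  obtain ⟨c, hc⟩ := hB
  exact ((h.pb.add (PB.const 2)).pow c).mono fun x => hc (f x)

@[fun_prop]
theorem PT.comp {g : β → γ} {f : α → β} (hg : PT g) (hf : PT f) : PT (fun x => g (f x)) := by
  obtain ⟨P, B, hB, h⟩ := id hf
  obtain ⟨Q, C, hC, h'⟩ := hg
  refine ⟨Prog.comp Q P, _, (hB.add (hC.comp hf)).add (PB.const 1), fun x => ?_⟩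
  obtain ⟨t, ht, hle⟩ := h x
  obtain ⟨u, hu, hle'⟩ := h' (f x)
  exact ⟨_, Run.comp ht hu, by omega⟩

@[fun_prop]
theorem PT.prodMk {f : α → β} {g : α → γ} (hf : PT f) (hg : PT g) : PT (fun x => (f x, g x)) := by
  obtain ⟨P, B, hB, h⟩ := hf
  obtain ⟨Q, C, hC, h'⟩ := hg
  refine ⟨Prog.pair P Q, _, (hB.add hC).add (PB.const 1), fun x => ?_⟩
  obtain ⟨t, ht, hle⟩ := h x
  obtain ⟨u, hu, hle'⟩ := h' x
  exact ⟨_, Run.pair ht hu, by omega⟩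

/-- A primitive operation computes `f` in polynomial time if `f` does not enlarge its argument too
much. -/
theorem PT.of_prim (o : PrimOp) {f : α → β} {B : α → ℕ} (hB : PB B)
    (h : ∀ x, o.apply (enc x) = enc (f x)) (h' : ∀ x, sz (f x) ≤ B x) : PT f := by
  refine ⟨Prog.prim o, _, ((PB.size_self (α := α)).add hB).pow 2, fun x => ?_⟩
  have := Run.prim o (enc x)
  rw [h] at this
  exact ⟨_, this, Nat.pow_le_pow_left (Nat.add_le_add_left (h' x) _) 2⟩

@[fun_prop]
theorem PT.id' : PT (fun x : α => x) :=
  PT.of_prim PrimOp.skip PB.size_self (fun _ => rfl) fun _ => le_rfl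

@[fun_prop]
theorem PT.const (y : β) : PT (fun _ : α => y) :=
  PT.of_prim (PrimOp.const (enc y)) (PB.const (sz y)) (fun _ => rfl) fun _ => le_rfl

theorem PT.fst' : PT (fun x : α × β => x.1) :=
  PT.of_prim PrimOp.fst PB.size_self (fun _ => rfl) sz_fst_le

theorem PT.snd' : PT (fun x : α × β => x.2) :=
  PT.of_prim PrimOp.snd PB.size_self (fun _ => rfl) sz_snd_le

@[fun_prop]
theorem PT.fst {f : α → β × γ} (h : PT f) : PT (fun x => (f x).1) := PT.fst'.comp h

@[fun_prop]
theorem PT.snd {f : α → β × γ} (h : PT f) : PT (fun x => (f x).2) := PT.snd'.comp h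

/-! ### Arithmetic -/

/-- Binary operations on numbers given by primitive operations. -/
theorem PT.arith (o : PrimOp) (op : ℕ → ℕ → ℕ) (ho : ∀ d, o.apply d = Data.arith op d)
    (hs : ∀ a b, Nat.size (op a b) ≤ Nat.size a + Nat.size b + 1) {f g : α → ℕ} (hf : PT f)
    (hg : PT g) : PT (fun x => op (f x) (g x)) := by
  have : PT (fun z : ℕ × ℕ => op z.1 z.2) :=
    PT.of_prim o PB.size_self (fun x => by rw [ho]; rfl) fun x => by
      have := hs x.1 x.2
      rw [← Prod.mk.eta (p := x), sz_prod, sz_nat, sz_nat, sz_nat]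
      simp only; omega
  exact this.comp (hf.prodMk hg)

@[fun_prop]
theorem PT.add {f g : α → ℕ} (hf : PT f) (hg : PT g) : PT (fun x => f x + g x) :=
  PT.arith PrimOp.add (fun a b => a + b) (fun _ => rfl) (fun a b => Nat.size_le.2 <| by
    have h1 := Nat.lt_size_self a
    have h2 := Nat.lt_size_self b
    have h3 : 2 ^ a.size ≤ 2 ^ (a.size + b.size) := Nat.pow_le_pow_right (by omega) (by omega)
    have h4 : 2 ^ b.size ≤ 2 ^ (a.size + b.size) := Nat.pow_le_pow_right (by omega) (by omega)
    rw [pow_succ]; omega) hf hg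

@[fun_prop]
theorem PT.mul {f g : α → ℕ} (hf : PT f) (hg : PT g) : PT (fun x => f x * g x) :=
  PT.arith PrimOp.mul (fun a b => a * b) (fun _ => rfl) (fun a b => Nat.size_le.2 <| by
    have h1 := Nat.lt_size_self a
    have h2 := Nat.lt_size_self b
    rw [pow_succ, pow_add]
    have := Nat.mul_lt_mul'' h1 h2
    omega) hf hg

theorem Nat.size_le_of_le_left {a b c : ℕ} (h : c ≤ a) : Nat.size c ≤ Nat.size a + Nat.size b + 1 :=
  (Nat.size_le_size h).trans (by omega)

@[fun_prop]
theorem PT.sub {f g : α → ℕ} (hf : PT f) (hg : PT g) : PT (fun x => f x - g x) :=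
  PT.arith PrimOp.sub (fun a b => a - b) (fun _ => rfl)
    (fun _ _ => Nat.size_le_of_le_left (Nat.sub_le _ _)) hf hg

@[fun_prop]
theorem PT.div {f g : α → ℕ} (hf : PT f) (hg : PT g) : PT (fun x => f x / g x) :=
  PT.arith PrimOp.div (fun a b => a / b) (fun _ => rfl)
    (fun _ _ => Nat.size_le_of_le_left (Nat.div_le_self _ _)) hf hg

@[fun_prop]
theorem PT.mod {f g : α → ℕ} (hf : PT f) (hg : PT g) : PT (fun x => f x % g x) :=
  PT.arith PrimOp.mod (fun a b => a % b) (fun _ => rfl)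
    (fun _ _ => Nat.size_le_of_le_left (Nat.mod_le _ _)) hf hg

/-- Comparison of numbers, with value `1` for truth. -/
def leN (a b : ℕ) : ℕ := if a ≤ b then 1 else 0

@[fun_prop]
theorem pt_leN {f g : α → ℕ} (hf : PT f) (hg : PT g) : PT (fun x => leN (f x) (g x)) :=
  PT.arith PrimOp.le leN (fun _ => rfl) (fun a b => by
    unfold leN
    split_ifs <;> simp) hf hg

/-- Case distinction on a number being zero. -/
def ifz (c : ℕ) (x y : α) : α := if c = 0 then x else y

@[fun_prop]
theorem pt_ifz {c : α → ℕ} {f g : α → β} (hc : PT c) (hf : PT f) (hg : PT g) :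
    PT (fun x => ifz (c x) (f x) (g x)) := by
  obtain ⟨R, D, hD, hR⟩ := hc
  obtain ⟨P, B, hB, h⟩ := hf
  obtain ⟨Q, C, hC, h'⟩ := hg
  refine ⟨Prog.branch R Q P, _, ((hD.add hB).add hC).add (PB.const 1), fun x => ?_⟩
  obtain ⟨r, hr, hle⟩ := hR x
  obtain ⟨t, ht, hlt⟩ := h x
  obtain ⟨u, hu, hlu⟩ := h' x
  simp only [ifz]
  split_ifs with h0
  · rw [h0] at hr
    exact ⟨_, Run.branchFalse hr ht, by omega⟩
  · refine ⟨_, Run.branchTrue hr ?_ hu, by omega⟩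
    intro e
    exact h0 (Data.num.inj e)

/-! ### Lists and iteration -/

@[fun_prop]
theorem PT.cons {f : α → β} {g : α → List β} (hf : PT f) (hg : PT g) :
    PT (fun x => f x :: g x) := hf.prodMk hg

theorem PT.tail' : PT (fun l : List α => l.tail) :=
  PT.of_prim PrimOp.snd PB.size_self (fun l => by cases l <;> rfl) fun l => by
    cases l
    · exact le_rfl
    · rw [sz_cons]; simp; omega

@[fun_prop]
theorem PT.tail {f : α → List β} (h : PT f) : PT (fun x => (f x).tail) := PT.tail'.comp h

/-- The test for the empty list: `0` for the empty list and `1` otherwise. -/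
def isCons (l : List α) : ℕ := if l.isEmpty then 0 else 1

theorem pt_isCons' : PT (fun l : List α => isCons l) := by
  refine ⟨Prog.branch (Prog.prim PrimOp.skip) (Prog.prim (PrimOp.const (Data.num 1)))
    (Prog.prim (PrimOp.const (Data.num 0))), _,
    ((((PB.size_self (α := List α)).add (PB.const 2)).pow 2).mul (PB.const 20)), fun l => ?_⟩
  cases l with
  | nil =>
    refine ⟨_, Run.branchFalse (Run.prim PrimOp.skip _) (Run.prim _ _), ?_⟩
    simp [PrimOp.apply, enc_nil, Data.size, sz_nil]
  | cons a l =>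
    refine ⟨_, Run.branchTrue (Run.prim PrimOp.skip _) (by rintro ⟨⟩) (Run.prim _ _), ?_⟩
    simp only [PrimOp.apply, Data.size, Nat.size_one]
    change (sz (a :: l) + sz (a :: l)) ^ 2 + (sz (a :: l) + (1 + 1)) ^ 2 + 1 ≤
      (sz (a :: l) + 2) ^ 2 * 20
    generalize sz (a :: l) = z
    nlinarith [Nat.zero_le z, Nat.zero_le (z ^ 2)]

@[fun_prop]
theorem pt_isCons {f : α → List β} (h : PT f) : PT (fun x => isCons (f x)) := pt_isCons'.comp h

@[fun_prop]
theorem PT.headD {f : α → List β} {d : α → β} (h : PT f) (hd : PT d) :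
    PT (fun x => (f x).headD (d x)) := by
  obtain ⟨P, B, hB, hP⟩ := id h
  obtain ⟨Q, C, hC, hQ⟩ := id hd
  refine ⟨Prog.branch P (Prog.comp (Prog.prim PrimOp.fst) P) Q, _,
    ((((hB.mul (PB.const 2)).add hC).add (PB.const 2)).add
      (((h.pb.mul (PB.const 2))).pow 2)), fun x => ?_⟩
  obtain ⟨t, ht, hlt⟩ := hP x
  obtain ⟨u, hu, hlu⟩ := hQ x
  cases hl : f x with
  | nil =>
    rw [hl] at ht
    simp only [hl, List.headD_nil]
    exact ⟨_, Run.branchFalse ht hu, by omega⟩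
  | cons a l =>
    rw [hl] at ht
    simp only [hl, List.headD_cons]
    refine ⟨_, Run.branchTrue ht (by rintro ⟨⟩) (Run.comp ht (Run.prim PrimOp.fst _)), ?_⟩
    have : ((enc (a :: l)).size + (PrimOp.fst.apply (enc (a :: l))).size) ^ 2 ≤
        (sz (a :: l) * 2) ^ 2 := by
      refine Nat.pow_le_pow_left ?_ 2
      have : (PrimOp.fst.apply (enc (a :: l))).size = sz a := rfl
      rw [this]
      have h2 : (enc (a :: l)).size = sz (a :: l) := rfl
      rw [h2, sz_cons]
      omega
    omega

/-- The loop rule: if the states of the loop are of polynomial size and there are polynomially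
many of them, then the loop takes polynomial time. -/
theorem PT.iter {step : α → α} {test : α → ℕ} {init : γ → α} (hs : PT step) (ht : PT test)
    (hi : PT init) {T B : γ → ℕ} (hT : PB T) (hB : PB B)
    (h1 : ∀ x, ∀ i < T x, test (step^[i] (init x)) ≠ 0)
    (h2 : ∀ x, test (step^[T x] (init x)) = 0)
    (h3 : ∀ x, ∀ i ≤ T x, sz (step^[i] (init x)) ≤ B x) :
    PT (fun x => step^[T x] (init x)) := by
  obtain ⟨P, A, ⟨c, hA⟩, hP⟩ := hs
  obtain ⟨Q, D, ⟨d, hD⟩, hQ⟩ := ht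
  obtain ⟨R, E, hE, hR⟩ := hi
  -- a bound for the time of one round
  let τ : γ → ℕ := fun x => (B x + 2) ^ c + (B x + 2) ^ d + 1
  have hτ : PB τ := (((hB.add (PB.const 2)).pow c).add ((hB.add (PB.const 2)).pow d)).add
    (PB.const 1)
  refine ⟨Prog.comp (Prog.loop Q P) R, _,
    (hE.add ((hT.add (PB.const 1)).mul hτ)).add (PB.const 1), fun x => ?_⟩
  obtain ⟨r, hr, hlr⟩ := hR x
  have key : ∀ j, j ≤ T x → ∃ t, Run (Prog.loop Q P) (enc (step^[T x - j] (init x)))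
      (enc (step^[T x] (init x))) t ∧ t ≤ (j + 1) * τ x := by
    intro j
    induction j with
    | zero =>
      intro _
      obtain ⟨u, hu, hlu⟩ := hQ (step^[T x] (init x))
      rw [h2] at hu
      refine ⟨_, Run.loopDone hu, ?_⟩
      have := (hlu.trans (hD _)).trans (Nat.pow_le_pow_left
        (Nat.add_le_add_right (h3 x (T x) le_rfl) 2) d)
      simp only [τ]
      omega
    | succ j ih =>
      intro hj
      obtain ⟨v, hv, hlv⟩ := ih (by omega)
      obtain ⟨u, hu, hlu⟩ := hQ (step^[T x - (j + 1)] (init x))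
      obtain ⟨w, hw, hlw⟩ := hP (step^[T x - (j + 1)] (init x))
      have e : step (step^[T x - (j + 1)] (init x)) = step^[T x - j] (init x) := by
        rw [← Function.iterate_succ_apply' step]
        congr 2
        omega
      rw [e] at hw
      refine ⟨_, Run.loopStep hu (fun e => h1 x (T x - (j + 1)) (by omega) (Data.num.inj e)) hw hv,
        ?_⟩
      have hb := Nat.add_le_add_right (h3 x (T x - (j + 1)) (by omega)) 2
      have a1 := (hlu.trans (hD _)).trans (Nat.pow_le_pow_left hb d)
      have a2 := (hlw.trans (hA _)).trans (Nat.pow_le_pow_left hb c)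
      rw [add_mul (j + 1) 1, one_mul]
      simp only [τ] at hlv ⊢
      omega
  obtain ⟨t, ht, hlt⟩ := key (T x) le_rfl
  rw [Nat.sub_self] at ht
  exact ⟨_, Run.comp hr ht, by omega⟩

theorem length_le_sz (l : List α) : l.length ≤ sz l := by
  induction l with
  | nil => simp
  | cons a l ih => rw [sz_cons, List.length_cons]; omega

theorem sz_le_of_mem {l : List α} {a : α} (h : a ∈ l) : sz a ≤ sz l := by
  induction l with
  | nil => simp at h
  | cons b l ih =>
    rw [sz_cons]
    rcases List.mem_cons.1 h with rfl | h
    · omega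
    · have := ih h; omega

theorem sz_drop_le (l : List α) (i : ℕ) : sz (l.drop i) ≤ sz l := by
  induction i generalizing l with
  | zero => simp
  | succ i ih =>
    cases l with
    | nil => simp
    | cons a l => rw [List.drop_succ_cons, sz_cons]; have := ih l; omega

/-- Loops over lists, with a polynomial bound on the size of the accumulator. -/
theorem PT.foldl [Inhabited β] {f : γ → α → β → α} {l : γ → List β} {b : γ → α}
    (hf : PT (fun z : γ × α × β => f z.1 z.2.1 z.2.2)) (hl : PT l) (hb : PT b) {B : γ → ℕ}
    (hB : PB B) (h : ∀ x i, sz (((l x).take i).foldl (f x) (b x)) ≤ B x) :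
    PT (fun x => (l x).foldl (f x) (b x)) := by
  let step : γ × α × List β → γ × α × List β :=
    fun z => (z.1, f z.1 z.2.1 (z.2.2.headD default), z.2.2.tail)
  have e : ∀ x i, i ≤ (l x).length → step^[i] (x, b x, l x) =
      (x, ((l x).take i).foldl (f x) (b x), (l x).drop i) := by
    intro x i
    induction i with
    | zero => intro _; simp
    | succ i ih =>
      intro hi
      rw [Function.iterate_succ_apply', ih (by omega)]
      simp only [step, List.tail_drop]
      have h0 : i < (l x).length := by omega
      rw [List.take_succ_eq_append_getElem h0, List.foldl_append, List.drop_eq_getElem_cons h0]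
      simp [List.getElem?_eq_getElem h0]
  have hstep : PT step := by
    have h1 : PT (fun z : γ × α × List β => (z.1, z.2.1, z.2.2.headD default)) := by fun_prop
    have h2 := hf.comp h1
    exact PT.prodMk (by fun_prop) (PT.prodMk h2 (by fun_prop))
  have := PT.iter (step := step) (test := fun z => isCons z.2.2)
    (init := fun x => (x, b x, l x)) hstep (by fun_prop) (by fun_prop)
    (T := fun x => (l x).length) (B := fun x => sz x + B x + sz (l x) + 2)
    (hl.pb.mono fun x => length_le_sz _) (((PB.size_self.add hB).add hl.pb).add (PB.const 2))
    (fun x i hi => by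
      rw [e x i hi.le]
      simp only [isCons, List.isEmpty_iff, List.drop_eq_nil_iff]
      rw [if_neg (by omega)]; simp)
    (fun x => by rw [e x _ le_rfl]; simp [isCons])
    (fun x i hi => by
      rw [e x i hi, sz_prod, sz_prod]
      have := h x i
      have := sz_drop_le (l x) i
      omega)
  have h4 := (PT.fst (PT.snd this))
  refine (show (fun x => (l x).foldl (f x) (b x)) = _ from ?_) ▸ h4
  funext x
  rw [e x _ le_rfl]
  simp

end

open Enc

/-! ### Polynomial-time operations on lists -/

section
variable {α β γ : Type} [Enc α] [Enc β] [Enc γ]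

theorem sz_append (l l' : List α) : sz (l ++ l') + 1 = sz l + sz l' := by
  induction l with
  | nil => rw [List.nil_append, sz_nil]; omega
  | cons a l ih => rw [List.cons_append, sz_cons, sz_cons]; omega

theorem sz_reverse (l : List α) : sz l.reverse = sz l := by
  induction l with
  | nil => rfl
  | cons a l ih =>
    rw [List.reverse_cons, sz_cons]
    have := sz_append l.reverse [a]
    rw [sz_cons, sz_nil] at this
    omega

theorem sz_take_le (l : List α) (i : ℕ) : sz (l.take i) ≤ sz l := by
  have := sz_append (l.take i) (l.drop i)
  rw [List.take_append_drop] at this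
  have := one_le_sz (l.drop i)
  omega

theorem sz_map_le {β : Type} {f : β → α} {l : List β} {A : ℕ} (h : ∀ a ∈ l, sz (f a) ≤ A) :
    sz (l.map f) ≤ l.length * (A + 1) + 1 := by
  induction l with
  | nil => simp [sz_nil]
  | cons a l ih =>
    rw [List.map_cons, sz_cons, List.length_cons, add_mul]
    have := h a (by simp)
    have := ih fun b hb => h b (by simp [hb])
    omega

@[fun_prop]
theorem PT.reverse [Inhabited α] {l : γ → List α} (hl : PT l) : PT (fun x => (l x).reverse) := by
  have e : ∀ l acc : List α, l.foldl (fun acc a => a :: acc) acc = l.reverse ++ acc := by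
    intro l
    induction l with
    | nil => simp
    | cons a l ih => intro acc; rw [List.foldl_cons, ih]; simp
  have := PT.foldl (f := fun (_ : γ) (acc : List α) (a : α) => a :: acc) (l := l)
    (b := fun _ => []) (by fun_prop) hl (by fun_prop) hl.pb fun x i => by
      rw [e, List.append_nil, sz_reverse]
      exact sz_take_le _ _
  simpa only [e, List.append_nil] using this

@[fun_prop]
theorem PT.append [Inhabited α] {l l' : γ → List α} (hl : PT l) (hl' : PT l') :
    PT (fun x => l x ++ l' x) := by
  have e : ∀ l acc : List α, l.foldl (fun acc a => a :: acc) acc = l.reverse ++ acc := by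
    intro l
    induction l with
    | nil => simp
    | cons a l ih => intro acc; rw [List.foldl_cons, ih]; simp
  have := PT.foldl (f := fun (_ : γ) (acc : List α) (a : α) => a :: acc)
    (l := fun x => (l x).reverse) (b := l') (by fun_prop) (by fun_prop) hl' (hl.pb.add hl'.pb)
    fun x i => by
      rw [e]
      have := sz_append ((l x).reverse.take i).reverse (l' x)
      have := sz_take_le (l x).reverse i
      rw [sz_reverse] at *
      omega
  simpa only [e, List.reverse_reverse] using this

@[fun_prop]
theorem PT.map [Inhabited α] [Inhabited β] {l : γ → List α} {f : γ → α → β}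
    (hf : PT (fun z : γ × α => f z.1 z.2)) (hl : PT l) : PT (fun x => (l x).map (f x)) := by
  have e : ∀ x (l : List α) (acc : List β),
      l.foldl (fun acc a => f x a :: acc) acc = (l.map (f x)).reverse ++ acc := by
    intro x l
    induction l with
    | nil => simp
    | cons a l ih => intro acc; rw [List.foldl_cons, ih]; simp
  have h1 : PT (fun z : γ × List β × α => f z.1 z.2.2) :=
    hf.comp (f := fun z : γ × List β × α => (z.1, z.2.2)) (by fun_prop)
  obtain ⟨c, hc⟩ := hf.pb
  have := PT.foldl (f := fun x (acc : List β) (a : α) => f x a :: acc)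
    (l := l) (b := fun _ => []) (h1.cons (by fun_prop)) hl (by fun_prop)
    (B := fun x => sz (l x) * ((sz x + sz (l x) + 3) ^ c + 1) + 1)
    ((hl.pb.mul ((((PB.size_self.add hl.pb).add (PB.const 3)).pow c).add (PB.const 1))).add
      (PB.const 1)) fun x i => by
      rw [e, List.append_nil, sz_reverse]
      refine (sz_map_le (A := (sz x + sz (l x) + 3) ^ c) fun a ha => ?_).trans ?_
      · refine (hc (x, a)).trans (Nat.pow_le_pow_left ?_ c)
        rw [sz_prod]
        have := sz_le_of_mem (List.mem_of_mem_take ha)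
        omega
      · refine Nat.add_le_add_right (Nat.mul_le_mul_right _ ?_) 1
        exact (List.length_take_le' i (l x)).trans (length_le_sz _)
  simpa only [e, List.append_nil, List.reverse_reverse] using this.reverse

/-! ### Bounds on the shape of nested lists -/

/-- `bd S x` says that all lists in `x` have length at most `S` and that all numbers in `x` have
size at most `S`.  Such bounds are preserved by the loops below, and they bound the size of `x`
by a polynomial in `S`. -/
class Bnd (α : Type) [Enc α] where
  /-- The bound. -/
  bd : ℕ → α → Prop
  mono {S S' : ℕ} {x : α} : S ≤ S' → bd S x → bd S' x
  self (x : α) : bd (sz x) x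
  sz_le : ∃ d : ℕ, ∀ (S : ℕ) (x : α), bd S x → sz x ≤ (S + 2) ^ d

open Bnd

instance : Bnd ℕ where
  bd S a := sz a ≤ S
  mono h h' := h'.trans h
  self _ := le_rfl
  sz_le := ⟨1, fun S x h => by rw [pow_one]; omega⟩

instance [Bnd α] [Bnd β] : Bnd (α × β) where
  bd S a := bd S a.1 ∧ bd S a.2
  mono h h' := ⟨mono h h'.1, mono h h'.2⟩
  self x := ⟨mono (sz_fst_le x) (self x.1), mono (sz_snd_le x) (self x.2)⟩
  sz_le := by
    obtain ⟨d, hd⟩ := Bnd.sz_le (α := α)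
    obtain ⟨e, he⟩ := Bnd.sz_le (α := β)
    refine ⟨d + e + 2, fun S x h => ?_⟩
    have h1 := hd S x.1 h.1
    have h2 := he S x.2 h.2
    rw [← Prod.mk.eta (p := x), sz_prod]
    have a1 : 1 ≤ (S + 2) ^ d := Nat.one_le_pow _ _ (by omega)
    have a2 : 1 ≤ (S + 2) ^ e := Nat.one_le_pow _ _ (by omega)
    rw [pow_add, pow_add]
    generalize (S + 2) ^ d = u at *
    generalize (S + 2) ^ e = v at *
    have : u + v ≤ u * v + 1 := by
      obtain ⟨u, rfl⟩ := Nat.exists_eq_add_of_le a1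
      obtain ⟨v, rfl⟩ := Nat.exists_eq_add_of_le a2
      ring_nf; omega
    have : 1 ≤ u * v := Nat.mul_pos a1 a2
    have : u * v * 4 ≤ u * v * (S + 2) ^ 2 := Nat.mul_le_mul_left _ (by nlinarith [Nat.zero_le S])
    omega

instance [Bnd α] : Bnd (List α) where
  bd S l := l.length ≤ S ∧ ∀ a ∈ l, bd S a
  mono h h' := ⟨h'.1.trans h, fun a ha => mono h (h'.2 a ha)⟩
  self l := ⟨length_le_sz l, fun a ha => mono (sz_le_of_mem ha) (self a)⟩
  sz_le := by
    obtain ⟨d, hd⟩ := Bnd.sz_le (α := α)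
    refine ⟨d + 2, fun S l h => ?_⟩
    have h1 := sz_map_le (f := id) (l := l) (A := (S + 2) ^ d) fun a ha => hd S a (h.2 a ha)
    rw [List.map_id] at h1
    have h2 := Nat.mul_le_mul_right ((S + 2) ^ d + 1) h.1
    have a1 : 1 ≤ (S + 2) ^ d := Nat.one_le_pow _ _ (by omega)
    rw [pow_add]
    generalize (S + 2) ^ d = u at *
    nlinarith

theorem bd_list [Bnd α] {S : ℕ} {l : List α} : bd S l ↔ l.length ≤ S ∧ ∀ a ∈ l, bd S a := Iff.rfl
theorem bd_of_sz_le [Bnd α] {S : ℕ} {x : α} (h : sz x ≤ S) : bd S x := mono h (self x)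

/-- Loops over lists with an accumulator whose shape is bounded. -/
theorem PT.foldl_bd [Inhabited β] [Bnd α] {f : γ → α → β → α} {l : γ → List β} {b : γ → α}
    (hf : PT (fun z : γ × α × β => f z.1 z.2.1 z.2.2)) (hl : PT l) (hb : PT b) {S : γ → ℕ}
    (hS : PB S) (h : ∀ x, bd (S x) (b x))
    (h' : ∀ x acc, ∀ a ∈ l x, bd (S x) acc → bd (S x) (f x acc a)) :
    PT (fun x => (l x).foldl (f x) (b x)) := by
  obtain ⟨d, hd⟩ := Bnd.sz_le (α := α)
  refine PT.foldl hf hl hb ((hS.add (PB.const 2)).pow d) fun x i => hd _ _ ?_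
  have : ∀ l' : List β, (∀ a ∈ l', a ∈ l x) → ∀ acc, bd (S x) acc →
      bd (S x) (l'.foldl (f x) acc) := by
    intro l'
    induction l' with
    | nil => intro _ acc h; exact h
    | cons a l' ih =>
      intro hm acc hacc
      rw [List.foldl_cons]
      exact ih (fun b hb => hm b (by simp [hb])) _ (h' x acc a (hm a (by simp)) hacc)
  exact this _ (fun a ha => List.mem_of_mem_take ha) _ (h x)

/-! ### More operations on lists and numbers -/

@[fun_prop]
theorem PT.length [Inhabited α] {l : γ → List α} (hl : PT l) : PT (fun x => (l x).length) := by
  have e : ∀ (l : List α) n, l.foldl (fun (acc : ℕ) _ => acc + 1) n = n + l.length := by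
    intro l
    induction l with
    | nil => simp
    | cons a l ih => intro n; rw [List.foldl_cons, ih, List.length_cons]; omega
  have := PT.foldl (f := fun (_ : γ) (acc : ℕ) (_ : α) => acc + 1) (l := l)
    (b := fun _ => 0) (by fun_prop) hl (by fun_prop) (hl.pb.add (PB.const 1)) fun x i => by
      rw [e, Nat.zero_add, sz_nat]
      have h1 : (List.take i (l x)).length.size ≤ (List.take i (l x)).length :=
        Nat.size_le.2 Nat.lt_two_pow_self
      have h2 := List.length_take_le' i (l x)
      have h3 := length_le_sz (l x)
      omega
  simpa only [e, Nat.zero_add] using this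

theorem sz_nat_le (n : ℕ) : sz n ≤ n + 1 :=
  Nat.add_le_add_right (Nat.size_le.2 Nat.lt_two_pow_self) 1

@[fun_prop]
theorem PT.range_min [Inhabited α] {l : γ → List α} {j : γ → ℕ} (hl : PT l) (hj : PT j) :
    PT (fun x => List.range (min (j x) (l x).length)) := by
  have e : ∀ (k : ℕ) (l : List α), l.foldl (fun (acc : ℕ × List ℕ) _ =>
      (acc.1 + 1, ifz (leN (acc.1 + 1) k) acc.2 (acc.2 ++ [acc.1]))) (0, []) =
        (l.length, List.range (min k l.length)) := by
    intro k l
    induction l using List.reverseRecOn with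
    | nil => simp
    | append_singleton l a ih =>
      rw [List.foldl_append, ih]
      simp only [List.foldl_cons, List.foldl_nil, ifz, leN, List.length_append,
        List.length_singleton]
      by_cases h : l.length + 1 ≤ k
      · rw [min_eq_right h, min_eq_right (by omega), List.range_succ]; simp [h]
      · rw [min_eq_left (by omega), min_eq_left (by omega)]; simp [h]
  have := PT.foldl (f := fun x (acc : ℕ × List ℕ) (_ : α) =>
      (acc.1 + 1, ifz (leN (acc.1 + 1) (j x)) acc.2 (acc.2 ++ [acc.1]))) (l := l)
    (b := fun _ => (0, [])) (by fun_prop) hl (by fun_prop)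
    (B := fun x => (sz (l x) + 1) + (sz (l x) * (sz (l x) + 1 + 1) + 1) + 1)
    ((((hl.pb.add (PB.const 1)).add ((hl.pb.mul ((hl.pb.add (PB.const 1)).add (PB.const 1))).add
      (PB.const 1))).add (PB.const 1))) fun x i => by
      rw [e, sz_prod]
      have h2 := List.length_take_le' i (l x)
      have h3 := length_le_sz (l x)
      have h4 := sz_nat_le (List.take i (l x)).length
      have h5 := sz_map_le (f := id) (l := List.range (min (j x) (List.take i (l x)).length))
        (A := sz (l x) + 1) fun a ha => by
          have := sz_nat_le a
          have := List.mem_range.1 ha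
          simp only [id]
          omega
      rw [List.map_id, List.length_range] at h5
      have h7 := one_le_sz (l x)
      have h6 := Nat.mul_le_mul_right (sz (l x) + 1 + 1)
        (show min (j x) (List.take i (l x)).length ≤ sz (l x) by omega)
      omega
  have h := PT.snd this
  simpa only [e] using h

@[fun_prop]
theorem PT.drop [Inhabited α] {l : γ → List α} {j : γ → ℕ} (hl : PT l) (hj : PT j) :
    PT (fun x => (l x).drop (j x)) := by
  have e : ∀ (k : ℕ) (l : List α), (List.range k).foldl (fun acc _ => acc.tail) l = l.drop k := by
    intro k l
    induction k with
    | zero => simp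
    | succ k ih => rw [List.range_succ, List.foldl_append, ih]; simp
  have := PT.foldl (f := fun _ (acc : List α) (_ : ℕ) => acc.tail)
    (l := fun x => List.range (min (j x) (l x).length))
    (b := l) (by fun_prop) (by fun_prop) hl hl.pb fun x i => by
      rw [List.take_range, e]
      exact sz_drop_le _ _
  simp only [e] at this
  refine (funext fun x => ?_ : (fun x => (l x).drop (j x)) = _) ▸ this
  rcases le_total (j x) (l x).length with h | h
  · rw [min_eq_left h]
  · rw [min_eq_right h, List.drop_eq_nil_of_le h, List.drop_length]

@[fun_prop]
theorem PT.zip [Inhabited α] [Inhabited β] {l : γ → List α} {l' : γ → List β} (hl : PT l)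
    (hl' : PT l') : PT (fun x => (l x).zip (l' x)) := by
  have e : ∀ (l : List α) (r : List β) (acc : List (α × β)),
      (l.foldl (fun (z : List β × List (α × β)) a => ifz (isCons z.1) z
        (z.1.tail, (a, z.1.headD default) :: z.2)) (r, acc)) =
        (r.drop l.length, (l.zip r).reverse ++ acc) := by
    intro l
    induction l with
    | nil => simp
    | cons a l ih =>
      intro r acc
      cases r with
      | nil => simpa [isCons, ifz] using ih [] acc
      | cons b r =>
        rw [List.foldl_cons]
        have := ih r ((a, b) :: acc)
        simpa [isCons, ifz] using this
  have hz : ∀ (l : List α) (r : List β), sz (l.zip r) ≤ sz l + sz r := by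
    intro l
    induction l with
    | nil => intro r; simp [sz_nil]
    | cons a l ih =>
      intro r
      cases r with
      | nil => rw [List.zip_nil_right, sz_nil, sz_nil]; omega
      | cons b r => rw [List.zip_cons_cons, sz_cons, sz_cons, sz_cons, sz_prod]
                    have := ih r; omega
  have := PT.foldl (f := fun _ (z : List β × List (α × β)) (a : α) => ifz (isCons z.1) z
        (z.1.tail, (a, z.1.headD default) :: z.2)) (l := l)
    (b := fun x => (l' x, [])) (by fun_prop) hl (by fun_prop)
    (((hl.pb.add hl'.pb).add hl'.pb).add (PB.const 1)) fun x i => by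
      rw [e, sz_prod, List.append_nil, sz_reverse]
      have h1 := sz_drop_le (l' x) ((l x).take i).length
      have h2 := hz ((l x).take i) (l' x)
      have h3 := sz_take_le (l x) i
      omega
  simp only [e, List.append_nil] at this
  simpa using (PT.snd this).reverse

@[fun_prop]
theorem PT.take [Inhabited α] {l : γ → List α} {j : γ → ℕ} (hl : PT l) (hj : PT j) :
    PT (fun x => (l x).take (j x)) := by
  have : PT (fun x => ((List.range (min (j x) (l x).length)).zip (l x)).map fun z => z.2) := by
    fun_prop
  refine (funext fun x => ?_ : (fun x => (l x).take (j x)) = _) ▸ this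
  change _ = List.map Prod.snd _
  refine List.ext_getElem ?_ fun i h1 h2 => ?_
  · simp
  · simp

@[fun_prop]
theorem PT.flatten [Inhabited α] {l : γ → List (List α)} (hl : PT l) :
    PT (fun x => (l x).flatten) := by
  have e : ∀ (l : List (List α)) (acc : List α),
      l.foldl (fun acc a => acc ++ a) acc = acc ++ l.flatten := by
    intro l
    induction l with
    | nil => simp
    | cons a l ih => intro acc; rw [List.foldl_cons, ih]; simp
  have hz : ∀ l : List (List α), sz l.flatten ≤ sz l := by
    intro l
    induction l with
    | nil => simp [sz_nil]
    | cons a l ih =>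
      rw [List.flatten_cons, sz_cons]
      have := sz_append a l.flatten
      omega
  have := PT.foldl (f := fun _ (acc : List α) (a : List α) => acc ++ a) (l := l)
    (b := fun _ => []) (by fun_prop) hl (by fun_prop) hl.pb fun x i => by
      rw [e, List.nil_append]
      exact (hz _).trans (sz_take_le _ _)
  simpa only [e, List.nil_append] using this

@[fun_prop]
theorem PT.flatMap [Inhabited α] [Inhabited β] {l : γ → List α} {f : γ → α → List β}
    (hf : PT (fun z : γ × α => f z.1 z.2)) (hl : PT l) : PT (fun x => (l x).flatMap (f x)) := by
  have : PT (fun x => ((l x).map (f x)).flatten) := by fun_prop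
  simpa only [List.flatMap_def] using this

theorem sz_pow_le (a n : ℕ) : sz (a ^ n) ≤ n * sz a + 2 := by
  rw [sz_nat, Nat.add_le_add_iff_right (n := 1), Nat.size_le]
  have h : a < 2 ^ sz a :=
    (Nat.lt_size_self a).trans_le (Nat.pow_le_pow_right (by omega) (by rw [sz_nat]; omega))
  calc a ^ n ≤ (2 ^ sz a) ^ n := Nat.pow_le_pow_left h.le n
    _ < 2 ^ (n * sz a + 1) := by
      rw [← pow_mul, mul_comm]; exact Nat.pow_lt_pow_right (by omega) (by omega)

@[fun_prop]
theorem PT.pow_min [Inhabited α] {l : γ → List α} {a j : γ → ℕ} (ha : PT a) (hj : PT j)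
    (hl : PT l) : PT (fun x => a x ^ min (j x) (l x).length) := by
  have e : ∀ (a k : ℕ), (List.range k).foldl (fun acc _ => acc * a) 1 = a ^ k := by
    intro a k
    induction k with
    | zero => simp
    | succ k ih => rw [List.range_succ, List.foldl_append, ih]; simp [pow_succ]
  have := PT.foldl (f := fun x (acc : ℕ) (_ : ℕ) => acc * a x)
    (l := fun x => List.range (min (j x) (l x).length))
    (b := fun _ => 1) (by fun_prop) (by fun_prop) (by fun_prop)
    ((hl.pb.mul ha.pb).add (PB.const 2)) fun x i => by
      rw [List.take_range, e]
      refine (sz_pow_le _ _).trans (Nat.add_le_add_right (Nat.mul_le_mul_right _ ?_) 2)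
      have := length_le_sz (l x)
      omega
  simpa only [e] using this

/-- The binary digits of a number, the most significant one first. -/
def bits (e : ℕ) : List ℕ := (Nat.digits 2 e).reverse

@[fun_prop]
theorem pt_bits {e : γ → ℕ} (he : PT e) : PT (fun x => bits (e x)) := by
  let step : ℕ × List ℕ → ℕ × List ℕ := fun z => (z.1 / 2, z.1 % 2 :: z.2)
  have hd : ∀ n i, i < (Nat.digits 2 n).length ↔ n / 2 ^ i ≠ 0 := by
    intro n i
    rw [← not_le, Nat.digits_length_le_iff (by omega), Ne, Nat.div_eq_zero_iff]
    simp
  have h : ∀ i n acc, i ≤ (Nat.digits 2 n).length →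
      step^[i] (n, acc) = (n / 2 ^ i, ((Nat.digits 2 n).take i).reverse ++ acc) := by
    intro i
    induction i with
    | zero => intro n acc _; simp
    | succ i ih =>
      intro n acc hi
      have hn : 0 < n := by
        rcases Nat.eq_zero_or_pos n with rfl | h
        · simp at hi
        · exact h
      have hdig := Nat.digits_of_two_le_of_pos (b := 2) le_rfl hn
      rw [hdig, List.length_cons] at hi
      rw [Function.iterate_succ_apply]
      simp only [step] at ih ⊢
      rw [ih (n / 2) _ (by omega), Nat.div_div_eq_div_mul, hdig, pow_succ']
      simp
  have := PT.iter (step := step) (test := fun z => z.1) (init := fun x => (e x, []))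
    (by simp only [step]; fun_prop) (by fun_prop) (by fun_prop)
    (T := fun x => (Nat.digits 2 (e x)).length)
    (B := fun x => sz (e x) + (sz (e x) * (2 + 1) + 1) + 1)
    (he.pb.mono fun x => by
      rw [Nat.digits_length_le_iff (by omega)]
      exact (Nat.lt_size_self _).trans_le (Nat.pow_le_pow_right (by omega) (by rw [sz_nat]; omega)))
    ((he.pb.add ((he.pb.mul (PB.const 3)).add (PB.const 1))).add (PB.const 1))
    (fun x i hi => by rw [h _ _ _ hi.le]; exact (hd _ _).1 hi)
    (fun x => by
      rw [h _ _ _ le_rfl]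
      by_contra h0
      exact lt_irrefl _ ((hd _ _).2 h0))
    (fun x i hi => by
      rw [h _ _ _ hi, sz_prod, List.append_nil, sz_reverse]
      have h1 : sz (e x / 2 ^ i) ≤ sz (e x) :=
        Nat.add_le_add_right (Nat.size_le_size (Nat.div_le_self _ _)) 1
      have h2 := sz_map_le (f := id) (l := (Nat.digits 2 (e x)).take i) (A := 2) fun a ha => by
        have h0 : a < 2 := Nat.digits_lt_base (by omega) (List.mem_of_mem_take ha)
        have := sz_nat_le a
        simp only [id]; omega
      rw [List.map_id] at h2
      have h3 : (List.take i (Nat.digits 2 (e x))).length ≤ sz (e x) := by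
        refine (List.length_take_le' _ _).trans ?_
        rw [Nat.digits_length_le_iff (by omega)]
        exact (Nat.lt_size_self _).trans_le
          (Nat.pow_le_pow_right (by omega) (by rw [sz_nat]; omega))
      have h4 := Nat.mul_le_mul_right (2 + 1) h3
      omega)
  have h' := PT.snd this
  refine (funext fun x => ?_ : (fun x => bits (e x)) = _) ▸ h'
  rw [h _ _ _ le_rfl]
  simp [bits]

end

open Enc
open Bnd

/-! ### Vectors over a prime field -/

section
variable {γ : Type} [Enc γ]

theorem foldl_inv {α β : Type*} (P : α → Prop) {f : α → β → α} {l : List β} {b : α} (hb : P b)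
    (h : ∀ acc, ∀ a ∈ l, P acc → P (f acc a)) : P (l.foldl f b) := by
  induction l generalizing b with
  | nil => exact hb
  | cons a l ih =>
    rw [List.foldl_cons]
    exact ih (h b a (by simp) hb) fun acc c hc => h acc c (by simp [hc])

/-- The residue of `a` modulo `p`; the second reduction only matters for `p = 0`, where it makes
the value bounded. -/
def md (p a : ℕ) : ℕ := a % p % (p + 1)

@[fun_prop]
theorem pt_md {p a : γ → ℕ} (hp : PT p) (ha : PT a) : PT (fun x => md (p x) (a x)) := by
  unfold md; fun_prop

theorem sz_md_le (p a : ℕ) : sz (md p a) ≤ sz p :=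
  Nat.add_le_add_right (Nat.size_le_size (Nat.le_of_lt_succ (Nat.mod_lt _ (by omega)))) 1

/-- The linear combination `a x + c y`. -/
def lin (p a : ℕ) (x : List ℕ) (c : ℕ) (y : List ℕ) : List ℕ :=
  (x.zip y).map fun z => md p (a * z.1 + c * z.2)

@[fun_prop]
theorem pt_lin {p a c : γ → ℕ} {x y : γ → List ℕ} (hp : PT p) (ha : PT a) (hx : PT x) (hc : PT c)
    (hy : PT y) : PT (fun z => lin (p z) (a z) (x z) (c z) (y z)) := by
  unfold lin; fun_prop

theorem bd_lin {S p a c : ℕ} {x y : List ℕ} (hp : sz p ≤ S) (hx : bd S x) :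
    bd S (lin p a x c y) := by
  refine ⟨?_, fun u hu => ?_⟩
  · have := hx.1
    simp only [lin, List.length_map, List.length_zip]
    omega
  · obtain ⟨z, _, rfl⟩ := List.mem_map.1 hu
    exact (sz_md_le _ _).trans hp

/-- Linear combinations of vectors of vectors. -/
def linV (p a : ℕ) (v : List (List ℕ)) (c : ℕ) (w : List (List ℕ)) : List (List ℕ) :=
  (v.zip w).map fun z => lin p a z.1 c z.2

@[fun_prop]
theorem pt_linV {p a c : γ → ℕ} {x y : γ → List (List ℕ)} (hp : PT p) (ha : PT a) (hx : PT x)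
    (hc : PT c) (hy : PT y) : PT (fun z => linV (p z) (a z) (x z) (c z) (y z)) := by
  unfold linV; fun_prop

theorem bd_linV {S p a c : ℕ} {x y : List (List ℕ)} (hp : sz p ≤ S) (hx : bd S x) :
    bd S (linV p a x c y) := by
  refine ⟨?_, fun u hu => ?_⟩
  · have := hx.1
    simp only [linV, List.length_map, List.length_zip]
    omega
  · obtain ⟨z, hz, rfl⟩ := List.mem_map.1 hu
    exact bd_lin hp (hx.2 _ (List.of_mem_zip hz).1)

/-- The test for zero vectors: the value is `0` exactly for those. -/
def nonzero (x : List ℕ) : ℕ := x.foldl (fun acc a => ifz a acc 1) 0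

@[fun_prop]
theorem pt_nonzero {x : γ → List ℕ} (hx : PT x) : PT (fun z => nonzero (x z)) := by
  unfold nonzero
  refine PT.foldl_bd (by fun_prop) hx (by fun_prop) (PB.const 2)
    (fun _ => (sz_nat_le 0).trans (by omega)) ?_
  intro z acc a _ h
  unfold ifz
  split_ifs
  · exact h
  · exact sz_nat_le _

/-- The dot product. -/
def dot (p : ℕ) (x y : List ℕ) : ℕ := (x.zip y).foldl (fun acc z => md p (acc + z.1 * z.2)) 0

@[fun_prop]
theorem pt_dot {p : γ → ℕ} {x y : γ → List ℕ} (hp : PT p) (hx : PT x) (hy : PT y) :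
    PT (fun z => dot (p z) (x z) (y z)) := by
  unfold dot
  refine PT.foldl_bd (by fun_prop) (by fun_prop) (by fun_prop) hp.pb
    (fun _ => Nat.add_le_add_right (Nat.size_le_size (Nat.zero_le _)) 1) ?_
  intro z acc a _ h
  exact sz_md_le _ _

theorem sz_dot_le (p : ℕ) (x y : List ℕ) : sz (dot p x y) ≤ sz p :=
  foldl_inv (fun a => sz a ≤ sz p) (Nat.add_le_add_right (Nat.size_le_size (Nat.zero_le _)) 1)
    fun _ _ _ _ => sz_md_le _ _

/-! ### Linear algebra -/

/-- A step of the elimination of the first coordinate.  The items `(w, v)` of the input are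
vectors `v` with a list `w` of values of linear forms at `v`.  The state contains the pivot (its
first value, the remaining values and the vector; the first value is `0` as long as no pivot has
been found) and the list of items produced so far.  An item with first value `c` is replaced by its
multiple by the first value `a` of the pivot minus `c` times the pivot; this needs no inverses. -/
def cutStep (p : ℕ)
    (st : (ℕ × List ℕ × List (List ℕ)) × List (List ℕ × List (List ℕ)))
    (it : List ℕ × List (List ℕ)) :
    (ℕ × List ℕ × List (List ℕ)) × List (List ℕ × List (List ℕ)) :=
  ifz st.1.1
    (ifz (it.1.headD 0) (st.1, (it.1.tail, it.2) :: st.2)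
      ((it.1.headD 0, it.1.tail, it.2), st.2))
    (st.1, (lin p st.1.1 it.1.tail (p - it.1.headD 0) st.1.2.1,
      linV p st.1.1 it.2 (p - it.1.headD 0) st.1.2.2) :: st.2)

@[fun_prop]
theorem pt_cutStep {p : γ → ℕ}
    {st : γ → (ℕ × List ℕ × List (List ℕ)) × List (List ℕ × List (List ℕ))}
    {it : γ → List ℕ × List (List ℕ)} (hp : PT p) (hst : PT st) (hit : PT it) :
    PT (fun z => cutStep (p z) (st z) (it z)) := by
  unfold cutStep; fun_prop

/-- The kernel of the first linear form on the span of the given vectors, with the values of the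
remaining linear forms. -/
def cutHead (p : ℕ) (l : List (List ℕ × List (List ℕ))) : List (List ℕ × List (List ℕ)) :=
  (l.foldl (cutStep p) ((0, [], []), [])).2

theorem bd_tail {S : ℕ} {x : List ℕ} (h : bd S x) : bd S x.tail :=
  ⟨by have := h.1; simp; omega, fun a ha => h.2 a (List.mem_of_mem_tail ha)⟩

theorem bd_cutFold {S p : ℕ} (hp : sz p ≤ S) {l : List (List ℕ × List (List ℕ))}
    (hl : ∀ it ∈ l, bd S it) (st : (ℕ × List ℕ × List (List ℕ)) × List (List ℕ × List (List ℕ)))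
    (h1 : bd S st.1) (h2 : ∀ it ∈ st.2, bd S it) :
    bd S (l.foldl (cutStep p) st).1 ∧ (∀ it ∈ (l.foldl (cutStep p) st).2, bd S it) ∧
      (l.foldl (cutStep p) st).2.length ≤ st.2.length + l.length := by
  induction l generalizing st with
  | nil => exact ⟨h1, h2, le_rfl⟩
  | cons it l ih =>
    have hit := hl it (by simp)
    have key : bd S (cutStep p st it).1 ∧ (∀ i ∈ (cutStep p st it).2, bd S i) ∧
        (cutStep p st it).2.length ≤ st.2.length + 1 := by
      unfold cutStep ifz
      split_ifs
      · refine ⟨h1, ?_, by simp⟩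
        simp only [List.mem_cons, forall_eq_or_imp]
        exact ⟨⟨bd_tail hit.1, hit.2⟩, h2⟩
      · refine ⟨⟨?_, bd_tail hit.1, hit.2⟩, h2, by simp⟩
        have h3 := hit.1.2
        cases h : it.1 with
        | nil => simp_all
        | cons a w => exact h3 a (by simp [h])
      · refine ⟨h1, ?_, by simp⟩
        simp only [List.mem_cons, forall_eq_or_imp]
        exact ⟨⟨bd_lin hp (bd_tail hit.1), bd_linV hp hit.2⟩, h2⟩
    rw [List.foldl_cons]
    obtain ⟨a1, a2, a3⟩ := ih (fun i hi => hl i (by simp [hi])) _ key.1 key.2.1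
    refine ⟨a1, a2, a3.trans ?_⟩
    have := key.2.2
    rw [List.length_cons]
    omega

theorem bd_cutInit (S : ℕ) (h : 1 ≤ S) : bd S ((0, [], []) : ℕ × List ℕ × List (List ℕ)) :=
  ⟨h, ⟨by simp, by simp⟩, ⟨by simp, by simp⟩⟩

theorem bd_cutHead {S p : ℕ} (hp : sz p ≤ S) {l : List (List ℕ × List (List ℕ))} (hl : bd S l) :
    bd S (cutHead p l) := by
  have := bd_cutFold hp hl.2 ((0, [], []), []) (bd_cutInit S ((one_le_sz p).trans hp)) (by simp)
  refine ⟨this.2.2.trans ?_, this.2.1⟩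
  simpa using hl.1

@[fun_prop]
theorem pt_cutHead {p : γ → ℕ} {l : γ → List (List ℕ × List (List ℕ))} (hp : PT p) (hl : PT l) :
    PT (fun z => cutHead (p z) (l z)) := by
  unfold cutHead
  obtain ⟨d, hd⟩ := Bnd.sz_le
    (α := (ℕ × List ℕ × List (List ℕ)) × List (List ℕ × List (List ℕ)))
  refine PT.snd (PT.foldl (by fun_prop) hl (by fun_prop)
    (((hp.pb.add hl.pb).add (PB.const 2)).pow d) fun x i => ?_)
  refine hd _ _ ?_
  have := bd_cutFold (S := sz (p x) + sz (l x)) (p := p x) (by omega) (l := (l x).take i)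
    (fun it hit => mono (by omega) ((self (l x)).2 it (List.mem_of_mem_take hit)))
    ((0, [], []), []) (bd_cutInit _ (by have := one_le_sz (p x); omega)) (by simp)
  refine ⟨this.1, this.2.2.trans ?_, this.2.1⟩
  have h1 := List.length_take_le' i (l x)
  have h2 := length_le_sz (l x)
  simp only [List.length_nil]
  omega

/-- The common kernel of all linear forms on the span of the given vectors. -/
def kerBy (p : ℕ) (l : List (List ℕ × List (List ℕ))) : List (List (List ℕ)) :=
  ((l.headD ([], [])).1.foldl (fun acc _ => cutHead p acc) l).map fun z => z.2

@[fun_prop]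
theorem pt_kerBy {p : γ → ℕ} {l : γ → List (List ℕ × List (List ℕ))} (hp : PT p) (hl : PT l) :
    PT (fun z => kerBy (p z) (l z)) := by
  unfold kerBy
  have : PT (fun x => ((l x).headD ([], [])).1.foldl (fun acc _ => cutHead (p x) acc) (l x)) := by
    refine PT.foldl_bd (by fun_prop) (by fun_prop) hl (hp.pb.add hl.pb)
      (fun x => bd_of_sz_le (by omega)) fun x acc a _ h => bd_cutHead (by omega) h
  fun_prop

theorem bd_kerBy {S p : ℕ} (hp : sz p ≤ S) {l : List (List ℕ × List (List ℕ))} (hl : bd S l) :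
    bd S (kerBy p l) := by
  have : bd S ((l.headD ([], [])).1.foldl (fun acc _ => cutHead p acc) l) :=
    foldl_inv (bd S) hl fun acc _ _ h => bd_cutHead hp h
  refine ⟨by simpa [kerBy] using this.1, fun v hv => ?_⟩
  obtain ⟨z, hz, rfl⟩ := List.mem_map.1 hv
  exact (this.2 z hz).2

/-! ### Field arithmetic -/

/-- The zero vector. -/
def zeroV (T : List (List (List ℕ))) : List ℕ := T.map fun _ => 0

@[fun_prop]
theorem pt_zeroV {T : γ → List (List (List ℕ))} (hT : PT T) : PT (fun z => zeroV (T z)) := by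
  unfold zeroV; fun_prop

theorem bd_zeroV {S : ℕ} {T : List (List (List ℕ))} (hT : sz T ≤ S) : bd S (zeroV T) := by
  refine ⟨by simpa [zeroV] using (length_le_sz T).trans hT, fun a ha => ?_⟩
  obtain ⟨z, _, rfl⟩ := List.mem_map.1 ha
  exact (one_le_sz T).trans hT

/-- The product of field elements, where `T` is the table of the products of the elements of the
basis. -/
def mulV (p : ℕ) (T : List (List (List ℕ))) (x y : List ℕ) : List ℕ :=
  (x.zip T).foldl (fun acc z =>
    (y.zip z.2).foldl (fun acc w => lin p 1 acc (z.1 * w.1) w.2) acc) (zeroV T)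

theorem bd_mulV {S p : ℕ} {T : List (List (List ℕ))} (hp : sz p ≤ S) (hT : sz T ≤ S)
    (x y : List ℕ) : bd S (mulV p T x y) :=
  foldl_inv (bd S) (bd_zeroV hT) fun _ _ _ h =>
    foldl_inv (bd S) h fun _ _ _ h => bd_lin hp h

@[fun_prop]
theorem pt_mulV {p : γ → ℕ} {T : γ → List (List (List ℕ))} {x y : γ → List ℕ} (hp : PT p)
    (hT : PT T) (hx : PT x) (hy : PT y) : PT (fun z => mulV (p z) (T z) (x z) (y z)) := by
  unfold mulV
  refine PT.foldl_bd ?_ (by fun_prop) (by fun_prop) (hp.pb.add hT.pb)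
    (fun z => bd_zeroV (by omega)) fun z acc a _ h =>
      foldl_inv (bd _) h fun _ _ _ h => bd_lin (by omega) h
  have hp' : PT (fun z : γ × List ℕ × ℕ × List (List ℕ) => p z.1) := by fun_prop
  have ha' : PT (fun z : γ × List ℕ × ℕ × List (List ℕ) => z.2.1) := by fun_prop
  refine PT.foldl_bd (by fun_prop) (by fun_prop) (by fun_prop) (hp'.pb.add ha'.pb)
    (fun z => bd_of_sz_le (by omega)) fun z acc a _ h => bd_lin (by omega) h

/-- The power `x ^ e`, for `e ≠ 0`. -/
def powV (p : ℕ) (T : List (List (List ℕ))) (x : List ℕ) (e : ℕ) : List ℕ :=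
  (bits e).tail.foldl (fun acc d =>
    ifz d (mulV p T acc acc) (mulV p T (mulV p T acc acc) x)) x

@[fun_prop]
theorem pt_powV {p e : γ → ℕ} {T : γ → List (List (List ℕ))} {x : γ → List ℕ} (hp : PT p)
    (hT : PT T) (hx : PT x) (he : PT e) : PT (fun z => powV (p z) (T z) (x z) (e z)) := by
  unfold powV
  refine PT.foldl_bd (by fun_prop) (by fun_prop) (by fun_prop) ((hp.pb.add hT.pb).add hx.pb)
    (fun z => bd_of_sz_le (by omega)) fun z acc a _ h => ?_
  unfold ifz
  split_ifs <;> exact bd_mulV (by omega) (by omega) _ _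

/-- The sum of a list of field elements. -/
def vsum (p : ℕ) (T : List (List (List ℕ))) (l : List (List ℕ)) : List ℕ :=
  l.foldl (fun acc x => lin p 1 acc 1 x) (zeroV T)

@[fun_prop]
theorem pt_vsum {p : γ → ℕ} {T : γ → List (List (List ℕ))} {l : γ → List (List ℕ)} (hp : PT p)
    (hT : PT T) (hl : PT l) : PT (fun z => vsum (p z) (T z) (l z)) := by
  unfold vsum
  exact PT.foldl_bd (by fun_prop) (by fun_prop) (by fun_prop) (hp.pb.add hT.pb)
    (fun z => bd_zeroV (by omega)) fun z acc a _ h => bd_lin (by omega) h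

/-- The sum of the products of the corresponding elements of two lists of field elements. -/
def dotL (p : ℕ) (T : List (List (List ℕ))) (l l' : List (List ℕ)) : List ℕ :=
  vsum p T ((l.zip l').map fun z => mulV p T z.1 z.2)

@[fun_prop]
theorem pt_dotL {p : γ → ℕ} {T : γ → List (List (List ℕ))} {l l' : γ → List (List ℕ)}
    (hp : PT p) (hT : PT T) (hl : PT l) (hl' : PT l') :
    PT (fun z => dotL (p z) (T z) (l z) (l' z)) := by
  unfold dotL; fun_prop

/-- The numbers below `j`, as long as `j` is at most the length of `T`.  The cut-off keeps loops
over this list polynomial in the length of the input also when `j` is a number of the input, which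
is written in binary. -/
def rg (T : List (List (List ℕ))) (j : ℕ) : List ℕ := List.range (min j T.length)

@[fun_prop]
theorem pt_rg {T : γ → List (List (List ℕ))} {j : γ → ℕ} (hT : PT T) (hj : PT j) :
    PT (fun z => rg (T z) (j z)) := by
  unfold rg; fun_prop

theorem rg_eq {T : List (List (List ℕ))} {j : ℕ} (h : j ≤ T.length) : rg T j = List.range j := by
  rw [rg, min_eq_left h]

/-- Equality of numbers, with value `1` for truth. -/
def eqN (a b : ℕ) : ℕ := leN a b * leN b a

@[fun_prop]
theorem pt_eqN {a b : γ → ℕ} (ha : PT a) (hb : PT b) : PT (fun z => eqN (a z) (b z)) := by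
  unfold eqN; fun_prop

theorem eqN_eq (a b : ℕ) : eqN a b = if a = b then 1 else 0 := by
  unfold eqN leN
  split_ifs <;> first | rfl | omega

/-- The basis of the field. -/
def stdL (T : List (List (List ℕ))) : List (List ℕ) :=
  (rg T T.length).map fun i => (rg T T.length).map fun j => eqN j i

@[fun_prop]
theorem pt_stdL {T : γ → List (List (List ℕ))} (hT : PT T) : PT (fun z => stdL (T z)) := by
  unfold stdL; fun_prop

/-- The vector of length `r` with `i`-th entry `x` and all other entries zero. -/
def emb (T : List (List (List ℕ))) (r i : ℕ) (x : List ℕ) : List (List ℕ) :=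
  (rg T r).map fun j => ifz (eqN j i) (zeroV T) x

@[fun_prop]
theorem pt_emb {T : γ → List (List (List ℕ))} {r i : γ → ℕ} {x : γ → List ℕ} (hT : PT T)
    (hr : PT r) (hi : PT i) (hx : PT x) : PT (fun z => emb (T z) (r z) (i z) (x z)) := by
  unfold emb; fun_prop

/-- The basis of the space of vectors of length `r`. -/
def stdV (T : List (List (List ℕ))) (r : ℕ) : List (List (List ℕ)) :=
  (rg T r).flatMap fun i => (stdL T).map fun x => emb T r i x

@[fun_prop]
theorem pt_stdV {T : γ → List (List (List ℕ))} {r : γ → ℕ} (hT : PT T) (hr : PT r) :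
    PT (fun z => stdV (T z) (r z)) := by
  unfold stdV; fun_prop

/-- A step of the selection of a basis over the subfield spanned by `F`.  The state contains a
basis of the annihilator, for the dot product over the prime field, of the span over the subfield of
the vectors treated so far, and the list of the selected vectors.  A vector lies in this span if and
only if it is orthogonal to the annihilator, so the membership test needs no equation to be
solved. -/
def greedyStep (p : ℕ) (T : List (List (List ℕ))) (F : List (List ℕ))
    (st : List (List (List ℕ)) × List (List (List ℕ))) (v : List (List ℕ)) :
    List (List (List ℕ)) × List (List (List ℕ)) :=
  (kerBy p (st.1.map fun φ =>
      (F.map fun f => dot p φ.flatten (v.map fun x => mulV p T f x).flatten, φ)),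
    ifz (nonzero (st.1.map fun φ => dot p φ.flatten v.flatten)) st.2 (st.2 ++ [v]))

@[fun_prop]
theorem pt_greedyStep {p : γ → ℕ} {T : γ → List (List (List ℕ))} {F : γ → List (List ℕ)}
    {st : γ → List (List (List ℕ)) × List (List (List ℕ))} {v : γ → List (List ℕ)}
    (hp : PT p) (hT : PT T) (hF : PT F) (hst : PT st) (hv : PT v) :
    PT (fun z => greedyStep (p z) (T z) (F z) (st z) (v z)) := by
  unfold greedyStep; fun_prop

/-- Selection of a basis from a list of vectors of length `r`, over the subfield spanned by `F`. -/
def greedy (p : ℕ) (T : List (List (List ℕ))) (F : List (List ℕ)) (r : ℕ)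
    (l : List (List (List ℕ))) : List (List (List ℕ)) :=
  (l.foldl (greedyStep p T F) (stdV T r, [])).2

@[fun_prop]
theorem pt_greedy {p r : γ → ℕ} {T : γ → List (List (List ℕ))} {F : γ → List (List ℕ)}
    {l : γ → List (List (List ℕ))} (hp : PT p) (hT : PT T) (hF : PT F) (hr : PT r) (hl : PT l) :
    PT (fun z => greedy (p z) (T z) (F z) (r z) (l z)) := by
  unfold greedy
  have hstd : PT (fun z => stdV (T z) (r z)) := by fun_prop
  obtain ⟨d, hd⟩ := Bnd.sz_le (α := List (List (List ℕ)))
  refine PT.snd (PT.foldl (by fun_prop) hl (by fun_prop)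
    ((((((hp.pb.add hF.pb).add hstd.pb).add (PB.const 2)).pow d).add hl.pb).add (PB.const 1))
    fun x i => ?_)
  have key : ∀ l' : List (List (List ℕ)),
      bd (sz (p x) + sz (F x) + sz (stdV (T x) (r x)))
        (l'.foldl (greedyStep (p x) (T x) (F x)) (stdV (T x) (r x), [])).1 ∧
      (l'.foldl (greedyStep (p x) (T x) (F x)) (stdV (T x) (r x), [])).2.Sublist l' := by
    intro l'
    induction l' using List.reverseRecOn with
    | nil => exact ⟨bd_of_sz_le (by simp), by simp⟩
    | append_singleton l' v ih =>
      rw [List.foldl_append, List.foldl_cons, List.foldl_nil]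
      generalize List.foldl _ _ l' = st at ih ⊢
      refine ⟨bd_kerBy (by omega) ⟨by simpa using ih.1.1, fun it hit => ?_⟩, ?_⟩
      · obtain ⟨φ, hφ, rfl⟩ := List.mem_map.1 hit
        refine ⟨⟨?_, fun a ha => ?_⟩, ih.1.2 φ hφ⟩
        · have := length_le_sz (F x)
          simp only [List.length_map]
          omega
        · obtain ⟨f, _, rfl⟩ := List.mem_map.1 ha
          exact (sz_dot_le _ _ _).trans (by omega)
      · simp only [greedyStep, ifz]
        split_ifs
        · exact ih.2.trans (List.sublist_append_left _ _)
        · exact ih.2.append (List.Sublist.refl _)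
  have hsub : ∀ l l' : List (List (List ℕ)), l.Sublist l' → sz l ≤ sz l' := by
    intro l l' h
    induction h with
    | slnil => exact le_rfl
    | cons a _ ih => rw [sz_cons]; omega
    | cons_cons a _ ih => rw [sz_cons, sz_cons]; omega
  have h1 := hd _ _ (key ((l x).take i)).1
  have h2 := (hsub _ _ (key ((l x).take i)).2).trans (sz_take_le _ _)
  have h3 := sz_prod (((l x).take i).foldl (greedyStep (p x) (T x) (F x)) (stdV (T x) (r x), [])).1
    (((l x).take i).foldl (greedyStep (p x) (T x) (F x)) (stdV (T x) (r x), [])).2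
  rw [Prod.mk.eta] at h3
  omega

end

open Enc
open Bnd

/-! ### The construction and the decoder as programs -/

section
variable {γ : Type} [Enc γ]

/-- A basis of the subfield of the elements `x` with `x ^ e = x`. -/
def fixV (p : ℕ) (T : List (List (List ℕ))) (e : ℕ) : List (List ℕ) :=
  (kerBy p ((stdL T).map fun x => (lin p 1 (powV p T x e) (p - 1) x, [x]))).map fun v => v.headD []

@[fun_prop]
theorem pt_fixV {p e : γ → ℕ} {T : γ → List (List (List ℕ))} (hp : PT p) (hT : PT T)
    (he : PT e) : PT (fun z => fixV (p z) (T z) (e z)) := by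
  unfold fixV; fun_prop

/-- Sums of subsets of `B`, at most `N ^ 2 + 1` of them, where `N` is the length of `T`; this is
more than the number of elements that `lowOrder` rejects. -/
def cands (p : ℕ) (T : List (List (List ℕ))) (B : List (List ℕ)) : List (List ℕ) :=
  B.foldl (fun acc e => (acc ++ acc.map fun x => lin p 1 x 1 e).take (T.length * T.length + 1))
    [zeroV T]

@[fun_prop]
theorem pt_cands {p : γ → ℕ} {T : γ → List (List (List ℕ))} {B : γ → List (List ℕ)} (hp : PT p)
    (hT : PT T) (hB : PT B) : PT (fun z => cands (p z) (T z) (B z)) := by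
  unfold cands
  refine PT.foldl_bd (by fun_prop) hB (by fun_prop)
    (S := fun z => sz (T z) * sz (T z) + 1 + sz (p z) + sz (T z))
    ((((hT.pb.mul hT.pb).add (PB.const 1)).add hp.pb).add hT.pb) (fun z => ?_)
    fun z acc e _ h => bd_list.2 ⟨?_, fun x hx => ?_⟩
  · refine ⟨by simp; omega, fun x hx => ?_⟩
    rw [List.mem_singleton.1 hx]
    exact bd_zeroV (by omega)
  · refine (List.length_take_le _ _).trans ?_
    have := Nat.mul_le_mul (length_le_sz (T z)) (length_le_sz (T z))
    omega
  · rcases List.mem_append.1 (List.mem_of_mem_take hx) with hx | hx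
    · exact h.2 x hx
    · obtain ⟨y, hy, rfl⟩ := List.mem_map.1 hx
      exact bd_lin (by omega) (h.2 y hy)

/-- The test for elements of small order: the value is `0` if `x ^ (e + 1) ≠ 1` for all `e` with
`e + 1 < M` and `x ≠ 0`.  The comparison is between `x ^ (e + 2)` and `x`, which rejects `x = 0` and
does without the coordinates of the unit element. -/
def lowOrder (p : ℕ) (T : List (List (List ℕ))) (M : ℕ) (x : List ℕ) : ℕ :=
  (rg T (M - 1)).foldl (fun acc e =>
    ifz (nonzero (lin p 1 (powV p T x (e + 2)) (p - 1) x)) 1 acc) 0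

@[fun_prop]
theorem pt_lowOrder {p M : γ → ℕ} {T : γ → List (List (List ℕ))} {x : γ → List ℕ} (hp : PT p)
    (hT : PT T) (hM : PT M) (hx : PT x) :
    PT (fun z => lowOrder (p z) (T z) (M z) (x z)) := by
  unfold lowOrder
  refine PT.foldl_bd (by fun_prop) (by fun_prop) (by fun_prop) (PB.const 2)
    (fun _ => (sz_nat_le 0).trans (by omega)) ?_
  intro z acc a _ h
  unfold ifz
  split_ifs
  · exact sz_nat_le _
  · exact h

/-- The parameters of the algorithms: the field given by `p` and the table `T`, and the numbers
`h`, `n`, `k`, `m` and `s`. -/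
structure Ctx where
  /-- The characteristic. -/
  p : ℕ
  /-- The table of products of the elements of the basis. -/
  T : List (List (List ℕ))
  /-- The size of the small field. -/
  h : ℕ
  /-- The degree of the middle field over the small field. -/
  n : ℕ
  /-- The dimension of the linearized Reed--Solomon code. -/
  k : ℕ
  /-- The degree of the large field over the middle field. -/
  m : ℕ
  /-- The dimension of the subspaces in the subspace design. -/
  s : ℕ

instance : Enc Ctx := ⟨fun c => enc (c.p, c.T, c.h, c.n, c.k, c.m, c.s)⟩

@[fun_prop]
theorem pt_ctx_p {c : γ → Ctx} (hc : PT c) : PT (fun z => (c z).p) :=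
  PT.fst (f := fun z => ((c z).p, (c z).T, (c z).h, (c z).n, (c z).k, (c z).m, (c z).s)) hc
@[fun_prop]
theorem pt_ctx_T {c : γ → Ctx} (hc : PT c) : PT (fun z => (c z).T) :=
  PT.fst (PT.snd (f := fun z => ((c z).p, (c z).T, (c z).h, (c z).n, (c z).k, (c z).m, (c z).s)) hc)
@[fun_prop]
theorem pt_ctx_h {c : γ → Ctx} (hc : PT c) : PT (fun z => (c z).h) :=
  PT.fst (PT.snd (PT.snd
    (f := fun z => ((c z).p, (c z).T, (c z).h, (c z).n, (c z).k, (c z).m, (c z).s)) hc))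
@[fun_prop]
theorem pt_ctx_n {c : γ → Ctx} (hc : PT c) : PT (fun z => (c z).n) :=
  PT.fst (PT.snd (PT.snd (PT.snd
    (f := fun z => ((c z).p, (c z).T, (c z).h, (c z).n, (c z).k, (c z).m, (c z).s)) hc)))
@[fun_prop]
theorem pt_ctx_k {c : γ → Ctx} (hc : PT c) : PT (fun z => (c z).k) :=
  PT.fst (PT.snd (PT.snd (PT.snd (PT.snd
    (f := fun z => ((c z).p, (c z).T, (c z).h, (c z).n, (c z).k, (c z).m, (c z).s)) hc))))
@[fun_prop]
theorem pt_ctx_m {c : γ → Ctx} (hc : PT c) : PT (fun z => (c z).m) :=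
  PT.fst (PT.snd (PT.snd (PT.snd (PT.snd (PT.snd
    (f := fun z => ((c z).p, (c z).T, (c z).h, (c z).n, (c z).k, (c z).m, (c z).s)) hc)))))
@[fun_prop]
theorem pt_ctx_s {c : γ → Ctx} (hc : PT c) : PT (fun z => (c z).s) :=
  PT.snd (PT.snd (PT.snd (PT.snd (PT.snd (PT.snd
    (f := fun z => ((c z).p, (c z).T, (c z).h, (c z).n, (c z).k, (c z).m, (c z).s)) hc)))))

/-- The power `x ^ (h ^ j)`, for `j ≤ N`, where `N` is the length of the table.  The cut-off keeps the
exponent, which is written in binary, of polynomial length. -/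
def frob (c : Ctx) (j : ℕ) (x : List ℕ) : List ℕ := powV c.p c.T x (c.h ^ min j c.T.length)

@[fun_prop]
theorem pt_frob {c : γ → Ctx} {j : γ → ℕ} {x : γ → List ℕ} (hc : PT c) (hj : PT j) (hx : PT x) :
    PT (fun z => frob (c z) (j z) (x z)) := by
  unfold frob; fun_prop

/-- The trace to the middle field. -/
def traceV (c : Ctx) (x : List ℕ) : List ℕ :=
  vsum c.p c.T ((rg c.T c.m).map fun u => frob c (c.n * u) x)

@[fun_prop]
theorem pt_traceV {c : γ → Ctx} {x : γ → List ℕ} (hc : PT c) (hx : PT x) :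
    PT (fun z => traceV (c z) (x z)) := by
  unfold traceV; fun_prop

/-- A basis of the middle field over the prime field. -/
def midBasis (c : Ctx) : List (List ℕ) := fixV c.p c.T (c.h ^ min c.n c.T.length)

@[fun_prop]
theorem pt_midBasis {c : γ → Ctx} (hc : PT c) : PT (fun z => midBasis (c z)) := by
  unfold midBasis; fun_prop

/-- A basis of the large field over the middle field. -/
def topBasis (c : Ctx) : List (List ℕ) :=
  (greedy c.p c.T (midBasis c) 1 ((stdL c.T).map fun x => [x])).map fun v => v.headD []

@[fun_prop]
theorem pt_topBasis {c : γ → Ctx} (hc : PT c) : PT (fun z => topBasis (c z)) := by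
  unfold topBasis; fun_prop

/-- The elements of large order among the candidates in the middle field. -/
def gammas (c : Ctx) : List (List ℕ) :=
  (cands c.p c.T (midBasis c)).flatMap fun x => ifz (lowOrder c.p c.T (c.n * c.m) x) [x] []

@[fun_prop]
theorem pt_gammas {c : γ → Ctx} (hc : PT c) : PT (fun z => gammas (c z)) := by
  unfold gammas; fun_prop

/-- The coordinates of `x` given by the trace form and `B`. -/
def coordV (c : Ctx) (B : List (List ℕ)) (x : List ℕ) : List (List ℕ) :=
  B.map fun e => traceV c (mulV c.p c.T e x)

@[fun_prop]
theorem pt_coordV {c : γ → Ctx} {B : γ → List (List ℕ)} {x : γ → List ℕ} (hc : PT c) (hB : PT B)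
    (hx : PT x) : PT (fun z => coordV (c z) (B z) (x z)) := by
  unfold coordV; fun_prop

/-- The values at `x` of the parity checks of the `i`-th space of the subspace design. -/
def checkV (c : Ctx) (B : List (List ℕ)) (g : List ℕ) (i : ℕ) (x : List ℕ) : List (List ℕ) :=
  ((rg c.T (2 * c.s)).map fun l => dotL c.p c.T
    ((rg c.T c.m).map fun j => powV c.p c.T g ((2 * c.s * i + l + 1) * (j + 1))) (coordV c B x)) ++
  (rg c.T c.s).map fun l => dotL c.p c.T
    ((rg c.T c.m).map fun j => powV c.p c.T g ((l + 1) * (j + 1)))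
    (((rg c.T c.m).zip (coordV c B x)).map fun z => frob c z.1 z.2)

@[fun_prop]
theorem pt_checkV {c : γ → Ctx} {B : γ → List (List ℕ)} {g x : γ → List ℕ} {i : γ → ℕ}
    (hc : PT c) (hB : PT B) (hg : PT g) (hi : PT i) (hx : PT x) :
    PT (fun z => checkV (c z) (B z) (g z) (i z) (x z)) := by
  unfold checkV; fun_prop

/-- A basis over the prime field of the `i`-th space of the subspace design, which is the whole
field if no candidate has large order. -/
def designV (c : Ctx) (i : ℕ) : List (List ℕ) :=
  ifz (isCons (gammas c)) (stdL c.T)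
    ((kerBy c.p ((stdL c.T).map fun x =>
      ((checkV c (topBasis c) ((gammas c).headD []) i x).flatten, [x]))).map fun v => v.headD [])

@[fun_prop]
theorem pt_designV {c : γ → Ctx} {i : γ → ℕ} (hc : PT c) (hi : PT i) :
    PT (fun z => designV (c z) (i z)) := by
  unfold designV; fun_prop

/-- A basis of the small field over the prime field. -/
def botBasis (c : Ctx) : List (List ℕ) := fixV c.p c.T c.h

@[fun_prop]
theorem pt_botBasis {c : γ → Ctx} (hc : PT c) : PT (fun z => botBasis (c z)) := by
  unfold botBasis; fun_prop

/-- The construction of the subspace design. -/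
def constructV (c : Ctx) : List (List (List ℕ)) :=
  (rg c.T c.k).map fun i =>
    (greedy c.p c.T (botBasis c) 1 ((designV c i).map fun x => [x])).map fun v => v.headD []

@[fun_prop]
theorem pt_constructV {c : γ → Ctx} (hc : PT c) : PT (fun z => constructV (c z)) := by
  unfold constructV; fun_prop

/-- The number of coefficients of each of the interpolation polynomials that are multiplied by the
received word; the remaining one has `k - 1` more. -/
def degN (c : Ctx) : ℕ := (c.n - c.k + 1) / (c.s + 1) + 1

@[fun_prop]
theorem pt_degN {c : γ → Ctx} (hc : PT c) : PT (fun z => degN (c z)) := by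
  unfold degN; fun_prop

/-- The `j`-fold application of `z ↦ z ^ h * a`. -/
def opPowV (c : Ctx) (a : List ℕ) (j : ℕ) (z : List ℕ) : List ℕ :=
  (rg c.T j).foldl (fun acc _ => mulV c.p c.T a (powV c.p c.T acc c.h)) z

@[fun_prop]
theorem pt_opPowV {c : γ → Ctx} {a x : γ → List ℕ} {j : γ → ℕ} (hc : PT c) (ha : PT a)
    (hj : PT j) (hx : PT x) : PT (fun z => opPowV (c z) (a z) (j z) (x z)) := by
  unfold opPowV
  have hp : PT (fun z => (c z).p) := by fun_prop
  have hT : PT (fun z => (c z).T) := by fun_prop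
  exact PT.foldl_bd (by fun_prop) (by fun_prop) (by fun_prop) ((hp.pb.add hT.pb).add hx.pb)
    (fun z => bd_of_sz_le (by omega)) fun z acc a _ h => bd_mulV (by omega) (by omega) _ _

/-- The entry of a vector at position `i`. -/
def nthV (T : List (List (List ℕ))) (v : List (List ℕ)) (i : ℕ) : List ℕ :=
  (v.drop i).headD (zeroV T)

@[fun_prop]
theorem pt_nthV {T : γ → List (List (List ℕ))} {v : γ → List (List ℕ)} {i : γ → ℕ}
    (hT : PT T) (hv : PT v) (hi : PT i) : PT (fun z => nthV (T z) (v z) (i z)) := by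
  unfold nthV; fun_prop

/-- The coefficients of the interpolation condition at `(a, β, y)`. -/
def interpRow (c : Ctx) (a b y : List ℕ) : List (List ℕ) :=
  ((rg c.T (degN c + c.k - 1)).map fun q => opPowV c a q b) ++
    (rg c.T c.s).flatMap fun u => (rg c.T (degN c)).map fun j => opPowV c a j (frob c (c.n * u) y)

@[fun_prop]
theorem pt_interpRow {c : γ → Ctx} {a b y : γ → List ℕ} (hc : PT c) (ha : PT a) (hb : PT b)
    (hy : PT y) : PT (fun z => interpRow (c z) (a z) (b z) (y z)) := by
  unfold interpRow; fun_prop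

/-- All interpolation conditions. -/
def interpRows (c : Ctx) (a : List (List ℕ)) (β y : List (List (List ℕ))) : List (List (List ℕ)) :=
  (a.zip (β.zip y)).flatMap fun z => (z.2.1.zip z.2.2).map fun w => interpRow c z.1 w.1 w.2

@[fun_prop]
theorem pt_interpRows {c : γ → Ctx} {a : γ → List (List ℕ)} {b y : γ → List (List (List ℕ))}
    (hc : PT c) (ha : PT a) (hb : PT b) (hy : PT y) :
    PT (fun z => interpRows (c z) (a z) (b z) (y z)) := by
  unfold interpRows; fun_prop

/-- The total number of coefficients of the interpolation polynomials. -/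
def numCoeff (c : Ctx) : ℕ := degN c + c.k - 1 + c.s * degN c

@[fun_prop]
theorem pt_numCoeff {c : γ → Ctx} (hc : PT c) : PT (fun z => numCoeff (c z)) := by
  unfold numCoeff; fun_prop

/-- A nonzero solution of the interpolation problem. -/
def interpV (c : Ctx) (a : List (List ℕ)) (β y : List (List (List ℕ))) : List (List ℕ) :=
  (kerBy c.p ((stdV c.T (numCoeff c)).map fun v =>
    (((interpRows c a β y).map fun r => dotL c.p c.T v r).flatten, v))).headD []

@[fun_prop]
theorem pt_interpV {c : γ → Ctx} {a : γ → List (List ℕ)} {b y : γ → List (List (List ℕ))}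
    (hc : PT c) (ha : PT a) (hb : PT b) (hy : PT y) :
    PT (fun z => interpV (c z) (a z) (b z) (y z)) := by
  unfold interpV; fun_prop

/-- The coefficient of `x ^ i` in `v₀ A₀ + ∑ u, A_(u+1) g ^ (τ ^ u)`, where `v = (v₀, g)`. -/
def solveCoeff (c : Ctx) (A v : List (List ℕ)) (i : ℕ) : List ℕ :=
  vsum c.p c.T (mulV c.p c.T (nthV c.T v 0) (nthV c.T A i) ::
    (rg c.T c.s).flatMap fun u => (rg c.T (degN c)).flatMap fun j => (rg c.T c.k).map fun l =>
      ifz (eqN (j + l) i) (zeroV c.T) (mulV c.p c.T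
        (nthV c.T A (degN c + c.k - 1 + u * degN c + j))
        (frob c (j + c.n * u) (nthV c.T v (l + 1)))))

@[fun_prop]
theorem pt_solveCoeff {c : γ → Ctx} {A v : γ → List (List ℕ)} {i : γ → ℕ} (hc : PT c) (hA : PT A)
    (hv : PT v) (hi : PT i) : PT (fun z => solveCoeff (c z) (A z) (v z) (i z)) := by
  unfold solveCoeff; fun_prop

/-- The space in which the messages are searched for. -/
def searchV (c : Ctx) : List (List (List ℕ)) :=
  ((botBasis c).map fun x => emb c.T (c.k + 1) 0 x) ++
    (rg c.T c.k).flatMap fun i => (designV c i).map fun x => emb c.T (c.k + 1) (i + 1) x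

@[fun_prop]
theorem pt_searchV {c : γ → Ctx} (hc : PT c) : PT (fun z => searchV (c z)) := by
  unfold searchV; fun_prop

/-- The messages that solve the equation given by the interpolation polynomials. -/
def messagesV (c : Ctx) (A : List (List ℕ)) : List (List (List ℕ)) :=
  greedy c.p c.T (botBasis c) c.k ((kerBy c.p ((searchV c).map fun v =>
    (((rg c.T (degN c + c.k - 1)).map fun i => solveCoeff c A v i).flatten, v))).map
      fun v => v.tail)

@[fun_prop]
theorem pt_messagesV {c : γ → Ctx} {A : γ → List (List ℕ)} (hc : PT c) (hA : PT A) :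
    PT (fun z => messagesV (c z) (A z)) := by
  unfold messagesV; fun_prop

/-- The codeword of a message. -/
def encodeV (c : Ctx) (a : List (List ℕ)) (β : List (List (List ℕ))) (f : List (List ℕ)) :
    List (List (List ℕ)) :=
  (a.zip β).map fun z => z.2.map fun b =>
    dotL c.p c.T f ((rg c.T c.k).map fun q => opPowV c z.1 q b)

@[fun_prop]
theorem pt_encodeV {c : γ → Ctx} {a f : γ → List (List ℕ)} {b : γ → List (List (List ℕ))}
    (hc : PT c) (ha : PT a) (hb : PT b) (hf : PT f) :
    PT (fun z => encodeV (c z) (a z) (b z) (f z)) := by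
  unfold encodeV; fun_prop

/-- The decoder. -/
def decodeV (c : Ctx) (a : List (List ℕ)) (β y : List (List (List ℕ))) :
    List (List (List (List ℕ))) :=
  (messagesV c (interpV c a β y)).map fun f => encodeV c a β f

@[fun_prop]
theorem pt_decodeV {c : γ → Ctx} {a : γ → List (List ℕ)} {b y : γ → List (List (List ℕ))}
    (hc : PT c) (ha : PT a) (hb : PT b) (hy : PT y) :
    PT (fun z => decodeV (c z) (a z) (b z) (y z)) := by
  unfold decodeV; fun_prop

/-- The parameters obtained from `m`, `s` and the input of the construction, a tuple that ends
with an unused zero. -/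
def mkCtx (m s : ℕ) (x : ℕ × List (List (List ℕ)) × ℕ × ℕ × ℕ × ℕ) : Ctx :=
  ⟨x.1, x.2.1, x.2.2.1, x.2.2.2.1, x.2.2.2.2.1, m, s⟩

theorem pt_mkCtx {m s : γ → ℕ} {x : γ → ℕ × List (List (List ℕ)) × ℕ × ℕ × ℕ × ℕ} (hm : PT m)
    (hs : PT s) (hx : PT x) : PT (fun z => mkCtx (m z) (s z) (x z)) := by
  have : PT (fun z => ((x z).1, (x z).2.1, (x z).2.2.1, (x z).2.2.2.1, (x z).2.2.2.2.1, m z, s z))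
    := by fun_prop
  exact this

theorem pt_construct : PT (fun z : (ℕ × ℕ) × (ℕ × List (List (List ℕ)) × ℕ × ℕ × ℕ × ℕ) =>
    constructV (mkCtx z.1.1 z.1.2 z.2)) :=
  pt_constructV (pt_mkCtx (by fun_prop) (by fun_prop) (by fun_prop))

theorem pt_decode : PT (fun z : (ℕ × ℕ) × ((ℕ × List (List (List ℕ)) × ℕ × ℕ × ℕ × ℕ) ×
      List (List ℕ) × List (List (List ℕ)) × List (List (List ℕ)) × ℕ) =>
    decodeV (mkCtx z.1.1 z.1.2 z.2.1) z.2.2.1 z.2.2.2.1 z.2.2.2.2.1) :=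
  pt_decodeV (pt_mkCtx (by fun_prop) (by fun_prop) (by fun_prop)) (by fun_prop) (by fun_prop)
    (by fun_prop)

/-- A polynomial-time function of a parameter and an input is computed, for each value of the
parameter that is at most as large as the input, by a program whose running time has a bound
independent of the parameter. -/
theorem PT.exists_prog {α β δ : Type} [Enc α] [Enc β] [Enc δ] {f : α × β → δ} (hf : PT f) :
    ∃ c : ℕ, ∀ a : α, ∃ P : Prog, ∀ c' ≥ c, ∀ x : β, sz a ≤ 2 * sz x →
      RunsInPolyTime c' P (enc x) (enc (f (a, x))) := by
  obtain ⟨P, B, ⟨c, hB⟩, hP⟩ := hf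
  -- the program writes the parameter in front of the input
  refine ⟨20 * 6 ^ (c + 2) + c + 2, fun a => ⟨Prog.comp P (Prog.pair
    (Prog.prim (PrimOp.const (enc a))) (Prog.prim PrimOp.skip)), fun c' hc x ha => ?_⟩⟩
  obtain ⟨t, ht, hle⟩ := hP (a, x)
  have h1 := Run.prim (PrimOp.const (enc a)) (enc x)
  have h2 := Run.prim PrimOp.skip (enc x)
  refine ⟨_, Run.comp (Run.pair h1 h2) ht, ?_⟩
  have h3 : ((enc x).size + ((PrimOp.const (enc a)).apply (enc x)).size) = sz x + sz a := rfl
  have h4 : ((enc x).size + (PrimOp.skip.apply (enc x)).size) = sz x + sz x := rfl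
  have h5 : (enc x).size = sz x := rfl
  rw [h3, h4, h5]
  have h6 := one_le_sz x
  have h7 := hle.trans (hB _)
  rw [sz_prod] at h7
  have h8 : (sz a + sz x + 1 + 2) ^ c ≤ (6 * sz x) ^ c := Nat.pow_le_pow_left (by omega) c
  have h9 : (sz x + sz a) ^ 2 ≤ (6 * sz x) ^ 2 := Nat.pow_le_pow_left (by omega) 2
  have h10 : (sz x + sz x) ^ 2 ≤ (6 * sz x) ^ 2 := Nat.pow_le_pow_left (by omega) 2
  have h11 : (6 * sz x) ^ c ≤ (6 * sz x) ^ (c + 2) := Nat.pow_le_pow_right (by omega) (by omega)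
  have h12 : (6 * sz x) ^ 2 ≤ (6 * sz x) ^ (c + 2) := Nat.pow_le_pow_right (by omega) (by omega)
  have h13 : 1 ≤ (6 * sz x) ^ (c + 2) := Nat.one_le_pow _ _ (by omega)
  calc _ ≤ 20 * (6 * sz x) ^ (c + 2) := by omega
    _ = 20 * 6 ^ (c + 2) * sz x ^ (c + 2) := by rw [mul_pow, mul_assoc]
    _ ≤ c' * sz x ^ c' := Nat.mul_le_mul (by omega) (Nat.pow_le_pow_right h6 (by omega))

end

/-! ### Linearly independent lists -/

section
variable {F V W : Type*} [Field F] [AddCommGroup V] [Module F V] [AddCommGroup W] [Module F W]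

/-- The list `l` is linearly independent. -/
def LIList (F : Type*) {V : Type*} [Field F] [AddCommGroup V] [Module F V] (l : List V) : Prop :=
  LinearIndependent F l.get

/-- The span of a list. -/
def spanL (F : Type*) {V : Type*} [Field F] [AddCommGroup V] [Module F V] (l : List V) :
    Submodule F V := Submodule.span F {x | x ∈ l}

theorem spanL_eq_range (l : List V) : spanL F l = Submodule.span F (Set.range l.get) := by
  rw [spanL, Set.range_list_get]

theorem isBasisList_iff {l : List V} {U : Submodule F V} :
    IsBasisList F l U ↔ LIList F l ∧ spanL F l = U := by
  rw [IsBasisList, LIList, spanL_eq_range]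

theorem liList_nil : LIList F ([] : List V) := by
  have : IsEmpty (Fin ([] : List V).length) := by simp only [List.length_nil]; infer_instance
  exact linearIndependent_empty_type

theorem liList_cons {x : V} {l : List V} : LIList F (x :: l) ↔ x ∉ spanL F l ∧ LIList F l := by
  have : (x :: l).get = (Fin.cons x l.get : Fin (l.length + 1) → V) := by
    funext i
    refine Fin.cases ?_ (fun i => ?_) i <;> rfl
  rw [LIList, LIList, spanL_eq_range, this, linearIndependent_finCons, and_comm]

theorem spanL_nil : spanL F ([] : List V) = ⊥ := by simp [spanL]

theorem spanL_cons (x : V) (l : List V) : spanL F (x :: l) = Submodule.span F {x} ⊔ spanL F l := by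
  rw [spanL, spanL, ← Submodule.span_union]
  congr 1
  ext y; simp

theorem spanL_append (l l' : List V) : spanL F (l ++ l') = spanL F l ⊔ spanL F l' := by
  rw [spanL, spanL, spanL, ← Submodule.span_union]
  congr 1
  ext y; simp

theorem mem_spanL_of_mem {x : V} {l : List V} (h : x ∈ l) : x ∈ spanL F l :=
  Submodule.subset_span h

theorem spanL_le {l : List V} {U : Submodule F V} : spanL F l ≤ U ↔ ∀ x ∈ l, x ∈ U :=
  Submodule.span_le

theorem spanL_perm {l l' : List V} (h : l.Perm l') : spanL F l = spanL F l' := by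
  rw [spanL, spanL]
  congr 1
  ext y
  exact h.mem_iff

theorem LIList.perm {l l' : List V} (h : l.Perm l') (hl : LIList F l) : LIList F l' := by
  induction h with
  | nil => exact hl
  | cons x h ih =>
    rw [liList_cons] at hl ⊢
    rw [← spanL_perm h]
    exact ⟨hl.1, ih hl.2⟩
  | swap x y l =>
    rw [liList_cons, liList_cons] at hl ⊢
    obtain ⟨h1, h2, h3⟩ := hl
    refine ⟨fun h => h1 ?_, fun h => h1 ?_, h3⟩
    · rw [spanL] at h h2 ⊢
      have e : ∀ z : V, {w | w ∈ z :: l} = insert z {w | w ∈ l} := fun z => by ext; simp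
      rw [e] at h ⊢
      exact mem_span_insert_exchange h h2
    · rw [spanL_cons]; exact Submodule.mem_sup_right h
  | trans _ _ ih1 ih2 => exact ih2 (ih1 hl)

theorem spanL_map (T : V →ₗ[F] W) (l : List V) : spanL F (l.map T) = (spanL F l).map T := by
  rw [spanL, spanL, Submodule.map_span]
  congr 1
  ext y; simp

theorem LIList.map {T : V →ₗ[F] W} {l : List V} (hl : LIList F l)
    (hT : ∀ x ∈ spanL F l, T x = 0 → x = 0) : LIList F (l.map T) := by
  have : (l.map T).get = (T ∘ l.get) ∘ Fin.cast (by simp) := by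
    funext i; simp
  rw [LIList, this]
  refine LinearIndependent.comp ?_ _ (Fin.cast_injective _)
  refine LinearIndependent.map hl ?_
  rw [← spanL_eq_range]
  exact Submodule.disjoint_def.2 fun x hx h => hT x hx h

theorem liList_of_length_eq {l : List V} (h : spanL F l = ⊤)
    (hd : l.length = finrank F V) : LIList F l :=
  linearIndependent_of_top_le_span_of_card_eq_finrank (by rw [← spanL_eq_range, h])
    (by simpa using hd)

/-- The elimination step for one linear form: `v₀` is the pivot, the form vanishes on `l₁`, and
the elements of `l₂` are combined with the pivot. -/
theorem LIList.elim {φ : V →ₗ[F] F} {l₁ l₂ : List V} {v₀ : V} (hl : LIList F (l₁ ++ v₀ :: l₂))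
    (h₁ : ∀ v ∈ l₁, φ v = 0) (h₀ : φ v₀ ≠ 0) :
    LIList F (l₁ ++ l₂.map fun v => φ v₀ • v + (-φ v) • v₀) ∧
      spanL F (l₁ ++ l₂.map fun v => φ v₀ • v + (-φ v) • v₀) =
        spanL F (l₁ ++ v₀ :: l₂) ⊓ LinearMap.ker φ := by
  let T : V →ₗ[F] V := φ v₀ • LinearMap.id - φ.smulRight v₀
  have hTe : ∀ v, φ v₀ • v + (-φ v) • v₀ = T v := fun v => by
    simp [T, sub_eq_add_neg]
  simp only [hTe]
  change LIList F (l₁ ++ l₂.map T) ∧ spanL F (l₁ ++ l₂.map T) = _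
  have hTφ : ∀ v, φ (T v) = 0 := fun v => by rw [← hTe]; simp; ring
  -- the span of the pivot and `l₂`
  have hspan : spanL F (l₂.map T) = spanL F (v₀ :: l₂) ⊓ LinearMap.ker φ := by
    rw [spanL_map, spanL_cons]
    apply le_antisymm
    · rintro _ ⟨x, hx, rfl⟩
      refine ⟨?_, hTφ x⟩
      rw [← hTe]
      exact Submodule.add_mem _ (Submodule.mem_sup_right (Submodule.smul_mem _ _ hx))
        (Submodule.mem_sup_left (Submodule.smul_mem _ _ (Submodule.mem_span_singleton_self _)))
    · rintro y ⟨hy, hφ⟩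
      obtain ⟨u, hu, x, hx, rfl⟩ := Submodule.mem_sup.1 hy
      obtain ⟨c, rfl⟩ := Submodule.mem_span_singleton.1 hu
      refine ⟨(φ v₀)⁻¹ • x, Submodule.smul_mem _ _ hx, ?_⟩
      have h2 : c * φ v₀ + φ x = 0 := by simpa using hφ
      rw [← hTe, smul_smul, mul_inv_cancel₀ h₀, one_smul, map_smul, smul_eq_mul, add_comm]
      congr 2
      field_simp
      linear_combination -h2
  have hle : spanL F l₁ ≤ LinearMap.ker φ := spanL_le.2 h₁
  refine ⟨?_, ?_⟩
  · induction l₁ with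
    | nil =>
      rw [List.nil_append] at hl ⊢
      rw [liList_cons] at hl
      refine hl.2.map fun x hx h => ?_
      rw [← hTe] at h
      by_contra hx0
      have h3 : φ x ≠ 0 := by
        intro h3
        rw [h3, neg_zero, zero_smul, add_zero] at h
        exact hx0 ((smul_eq_zero.1 h).resolve_left h₀)
      refine hl.1 ?_
      have h4 : v₀ = (φ x)⁻¹ • φ v₀ • x := by
        rw [eq_inv_smul_iff₀ h3]
        rw [neg_smul, ← sub_eq_add_neg] at h
        exact (sub_eq_zero.1 h).symm
      rw [h4]
      exact Submodule.smul_mem _ _ (Submodule.smul_mem _ _ hx)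
    | cons v l₁ ih =>
      rw [List.cons_append, liList_cons] at hl ⊢
      refine ⟨fun h => hl.1 ?_, ih hl.2 (fun w hw => h₁ w (by simp [hw]))
        (spanL_le.2 fun w hw => h₁ w (by simp [hw]))⟩
      rw [spanL_append, hspan] at h
      rw [spanL_append]
      exact (sup_le_sup_left inf_le_left _ : _ ≤ spanL F l₁ ⊔ spanL F (v₀ :: l₂)) h
  · rw [spanL_append, spanL_append, hspan, sup_inf_assoc_of_le _ hle]

end

/-! ### Coordinates -/

section
variable {p N : ℕ} [Fact p.Prime] {L : Type*} [Field L] [Algebra (ZMod p) L]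
  (b : Basis (Fin N) (ZMod p) L)

/-- The list of the coordinates of a field element. -/
noncomputable def crd (x : L) : List ℕ := List.ofFn fun i => (b.repr x i).val

/-- The table of the products of the elements of the basis. -/
noncomputable def tbl : List (List (List ℕ)) :=
  List.ofFn fun i => List.ofFn fun j => crd b (b i * b j)

/-- The lists of coordinates of the entries of a vector. -/
noncomputable def rep {r : ℕ} (v : Fin r → L) : List (List ℕ) := List.ofFn fun i => crd b (v i)

@[simp]
theorem length_tbl : (tbl b).length = N := by simp [tbl]

theorem md_eq (a : ℕ) : md p a = (a : ZMod p).val := by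
  have hp := (Fact.out : p.Prime).pos
  rw [ZMod.val_natCast, md, Nat.mod_eq_of_lt]
  exact (Nat.mod_lt _ hp).trans (Nat.lt_succ_self p)

theorem zip_ofFn {α β : Type*} {n : ℕ} (f : Fin n → α) (g : Fin n → β) :
    (List.ofFn f).zip (List.ofFn g) = List.ofFn fun i => (f i, g i) := by
  apply List.ext_getElem <;> simp

theorem map_range_eq_ofFn {α : Type*} (r : ℕ) (f : ℕ → α) :
    (List.range r).map f = List.ofFn fun i : Fin r => f i := by
  apply List.ext_getElem <;> simp

theorem foldl_ofFn {A M : Type*} [AddCommMonoid M] {α : Type*} {n : ℕ} (c : M → A) (F : A → α → A)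
    (g : Fin n → α) (u : Fin n → M) (h : ∀ z i, F (c z) (g i) = c (z + u i)) (z : M) :
    (List.ofFn g).foldl F (c z) = c (z + ∑ i, u i) := by
  induction n generalizing z with
  | zero => simp
  | succ n ih =>
    rw [List.ofFn_succ, List.foldl_cons, h, ih _ (fun i => u i.succ) fun z i => h z i.succ,
      Fin.sum_univ_succ, add_assoc]

theorem lin_crd (a c : ℕ) (x y : L) :
    lin p a (crd b x) c (crd b y) = crd b ((a : ZMod p) • x + (c : ZMod p) • y) := by
  rw [lin, crd, crd, zip_ofFn, crd, List.map_ofFn]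
  congr 1
  funext i
  simp [md_eq]

theorem linV_rep {r : ℕ} (a c : ℕ) (x y : Fin r → L) :
    linV p a (rep b x) c (rep b y) = rep b ((a : ZMod p) • x + (c : ZMod p) • y) := by
  rw [linV, rep, rep, zip_ofFn, rep, List.map_ofFn]
  congr 1
  funext i
  simp [lin_crd]

theorem zeroV_tbl : zeroV (tbl b) = crd b 0 := by
  rw [zeroV, tbl, List.map_ofFn, crd]
  congr 1
  funext i
  simp

theorem nonzero_eq_zero_iff (l : List ℕ) : nonzero l = 0 ↔ ∀ a ∈ l, a = 0 := by
  have : ∀ (l : List ℕ) acc, l.foldl (fun acc a => ifz a acc 1) acc = 0 ↔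
      acc = 0 ∧ ∀ a ∈ l, a = 0 := by
    intro l
    induction l with
    | nil => simp
    | cons a l ih =>
      intro acc
      rw [List.foldl_cons, ih]
      by_cases ha : a = 0 <;> simp [ifz, ha]
  rw [nonzero, this]; simp

theorem nonzero_crd (x : L) : nonzero (crd b x) = 0 ↔ x = 0 := by
  rw [nonzero_eq_zero_iff, crd, List.forall_mem_ofFn_iff]
  constructor
  · intro h
    apply b.repr.injective
    ext i
    simpa using h i
  · rintro rfl i; simp

theorem mulV_crd (x y : L) : mulV p (tbl b) (crd b x) (crd b y) = crd b (x * y) := by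
  rw [mulV, zeroV_tbl, tbl]
  have h0 : (crd b x).zip (List.ofFn fun i => List.ofFn fun j => crd b (b i * b j)) =
    List.ofFn fun i => ((b.repr x i).val, List.ofFn fun j => crd b (b i * b j)) := zip_ofFn _ _
  rw [h0, foldl_ofFn (crd b) _ _ (fun i => ∑ j, (b.repr x i * b.repr y j) • (b i * b j)), zero_add]
  · congr 1
    conv_rhs => rw [← b.sum_repr x, ← b.sum_repr y, Finset.sum_mul_sum]
    refine Finset.sum_congr rfl fun i _ => Finset.sum_congr rfl fun j _ => ?_
    rw [smul_mul_smul_comm]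
  · intro z i
    have h1 : (crd b y).zip (List.ofFn fun j => crd b (b i * b j)) =
      List.ofFn fun j => ((b.repr y j).val, crd b (b i * b j)) := zip_ofFn _ _
    simp only [h1]
    refine foldl_ofFn (crd b) _ _ _ (fun z j => ?_) z
    simp only
    rw [lin_crd]
    simp

theorem powV_crd (x : L) {e : ℕ} (he : e ≠ 0) : powV p (tbl b) (crd b x) e = crd b (x ^ e) := by
  rw [powV]
  induction e using Nat.strong_induction_on with
  | _ e ih =>
    have hdig := Nat.digits_of_two_le_of_pos (b := 2) le_rfl (Nat.pos_of_ne_zero he)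
    rcases Nat.lt_or_ge e 2 with h2 | h2
    · obtain rfl : e = 1 := by omega
      simp [bits]
    · have hne : e / 2 ≠ 0 := by omega
      have hb : bits e = bits (e / 2) ++ [e % 2] := by
        rw [bits, hdig, List.reverse_cons, bits]
      have hbne : bits (e / 2) ≠ [] := by
        simp [bits, Nat.digits_ne_nil_iff_ne_zero, hne]
      rw [hb, List.tail_append_of_ne_nil hbne, List.foldl_append, ih _ (by omega) hne]
      simp only [List.foldl_cons, List.foldl_nil, ifz, mulV_crd]
      have := Nat.div_add_mod e 2
      split_ifs with h
      · rw [← pow_add]; congr 2; omega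
      · rw [← pow_add, ← pow_succ]; congr 2; omega

theorem vsum_ofFn {r : ℕ} (f : Fin r → L) :
    vsum p (tbl b) (List.ofFn fun i => crd b (f i)) = crd b (∑ i, f i) := by
  rw [vsum, zeroV_tbl, foldl_ofFn (crd b) _ _ f, zero_add]
  intro z i
  rw [lin_crd]; simp

theorem vsum_map (l : List L) : vsum p (tbl b) (l.map (crd b)) = crd b l.sum := by
  have : l.map (crd b) = List.ofFn fun i => crd b (l.get i) := by
    apply List.ext_getElem <;> simp
  rw [this, vsum_ofFn]
  congr 1
  simp

theorem dotL_ofFn {r : ℕ} (f g : Fin r → L) :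
    dotL p (tbl b) (List.ofFn fun i => crd b (f i)) (List.ofFn fun i => crd b (g i)) =
      crd b (∑ i, f i * g i) := by
  rw [dotL, zip_ofFn, List.map_ofFn, ← vsum_ofFn]
  congr 2
  funext i
  simp [mulV_crd]

/-! ### Correctness of the elimination -/

/-- The values of linear forms. -/
def vals {V : Type*} [AddCommGroup V] [Module (ZMod p) V] (φs : List (V →ₗ[ZMod p] ZMod p))
    (v : V) : List ℕ := φs.map fun φ => (φ v).val

theorem natCast_sub_val (c : ZMod p) : ((p - c.val : ℕ) : ZMod p) = -c := by
  rw [Nat.cast_sub (ZMod.val_lt c).le]; simp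

theorem lin_vals {V : Type*} [AddCommGroup V] [Module (ZMod p) V]
    (φs : List (V →ₗ[ZMod p] ZMod p)) (a c : ZMod p) (v w : V) :
    lin p a.val (vals φs v) (p - c.val) (vals φs w) = vals φs (a • v + (-c) • w) := by
  induction φs with
  | nil => rfl
  | cons φ φs ih =>
    have e : ∀ v, vals (φ :: φs) v = (φ v).val :: vals φs v := fun _ => rfl
    rw [e, e, e, ← ih, lin, List.zip_cons_cons, List.map_cons, lin, md_eq]
    congr 2
    push_cast
    rw [natCast_sub_val]
    simp

/-- A vector together with the values of linear forms. -/
noncomputable def item {r : ℕ} (φs : List ((Fin r → L) →ₗ[ZMod p] ZMod p)) (v : Fin r → L) :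
    List ℕ × List (List ℕ) := (vals φs v, rep b v)

theorem cutFold_pivot {r : ℕ} (φ : (Fin r → L) →ₗ[ZMod p] ZMod p)
    (φs : List ((Fin r → L) →ₗ[ZMod p] ZMod p)) (v₀ : Fin r → L) (h₀ : φ v₀ ≠ 0)
    (l out : List (Fin r → L)) :
    ((l.map (item b (φ :: φs))).foldl (cutStep p)
      (((φ v₀).val, item b φs v₀), out.map (item b φs))).2 =
      ((l.map fun v => φ v₀ • v + (-φ v) • v₀).reverse ++ out).map (item b φs) := by
  induction l generalizing out with
  | nil => simp
  | cons v l ih =>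
    have : cutStep p (((φ v₀).val, item b φs v₀), out.map (item b φs)) (item b (φ :: φs) v) =
        (((φ v₀).val, item b φs v₀), ((φ v₀ • v + (-φ v) • v₀) :: out).map (item b φs)) := by
      rw [cutStep, ifz, if_neg (by simpa using h₀)]
      refine Prod.ext rfl (congrArg₂ List.cons (Prod.ext ?_ ?_) rfl)
      · exact lin_vals φs (φ v₀) (φ v) v v₀
      · change linV p (φ v₀).val (rep b v) (p - (φ v).val) (rep b v₀) = rep b _
        rw [linV_rep, natCast_sub_val]
        simp
    rw [List.map_cons, List.foldl_cons, this, ih]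
    simp

theorem cutFold_noPivot {r : ℕ} (φ : (Fin r → L) →ₗ[ZMod p] ZMod p)
    (φs : List ((Fin r → L) →ₗ[ZMod p] ZMod p)) (l out : List (Fin r → L))
    (hl : ∀ v ∈ l, φ v = 0) :
    (l.map (item b (φ :: φs))).foldl (cutStep p) ((0, [], []), out.map (item b φs)) =
      ((0, [], []), (l.reverse ++ out).map (item b φs)) := by
  induction l generalizing out with
  | nil => simp
  | cons v l ih =>
    have h : φ v = 0 := hl v (by simp)
    have : cutStep p ((0, [], []), out.map (item b φs)) (item b (φ :: φs) v) =
        ((0, [], []), (v :: out).map (item b φs)) := by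
      have e : (item b (φ :: φs) v).1.headD 0 = 0 := by simp [item, vals, h]
      rw [cutStep, ifz, if_pos rfl, ifz, if_pos e]
      rfl
    rw [List.map_cons, List.foldl_cons, this, ih _ fun w hw => hl w (by simp [hw])]
    simp

theorem cutHead_spec {r : ℕ} (φ : (Fin r → L) →ₗ[ZMod p] ZMod p)
    (φs : List ((Fin r → L) →ₗ[ZMod p] ZMod p)) {l : List (Fin r → L)} (hl : LIList (ZMod p) l) :
    ∃ l' : List (Fin r → L), cutHead p (l.map (item b (φ :: φs))) = l'.map (item b φs) ∧
      LIList (ZMod p) l' ∧ spanL (ZMod p) l' = spanL (ZMod p) l ⊓ LinearMap.ker φ := by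
  by_cases h : ∀ v ∈ l, φ v = 0
  · refine ⟨l.reverse, ?_, hl.perm l.reverse_perm.symm, ?_⟩
    · have := cutFold_noPivot b φ φs l [] h
      rw [List.map_nil] at this
      rw [cutHead, this, List.append_nil]
    · rw [spanL_perm l.reverse_perm, left_eq_inf]
      exact spanL_le.2 h
  · -- split the list at the pivot
    obtain ⟨l₁, v₀, l₂, rfl, h₁, h₀⟩ : ∃ l₁ v₀ l₂, l = l₁ ++ v₀ :: l₂ ∧ (∀ v ∈ l₁, φ v = 0) ∧
        φ v₀ ≠ 0 := by
      clear hl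
      induction l with
      | nil => simp at h
      | cons v l ih =>
        by_cases hv : φ v = 0
        · obtain ⟨l₁, v₀, l₂, rfl, h₁, h₀⟩ := ih (by simpa [hv] using h)
          exact ⟨v :: l₁, v₀, l₂, rfl, by simpa [hv] using h₁, h₀⟩
        · exact ⟨[], v, l, rfl, by simp, hv⟩
    have helim := hl.elim h₁ h₀
    have hperm : (l₁ ++ l₂.map fun v => φ v₀ • v + (-φ v) • v₀).Perm
        ((l₂.map fun v => φ v₀ • v + (-φ v) • v₀).reverse ++ l₁.reverse) :=
      List.perm_append_comm.trans ((List.reverse_perm _).symm.append (List.reverse_perm _).symm)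
    refine ⟨_, ?_, helim.1.perm hperm, (spanL_perm hperm).symm.trans helim.2⟩
    have h2 := cutFold_noPivot b φ φs l₁ [] h₁
    rw [List.map_nil, List.append_nil] at h2
    rw [cutHead, List.map_append, List.foldl_append, h2, List.map_cons, List.foldl_cons]
    have : cutStep p ((0, [], []), l₁.reverse.map (item b φs)) (item b (φ :: φs) v₀) =
        (((φ v₀).val, item b φs v₀), l₁.reverse.map (item b φs)) := by
      have e : (item b (φ :: φs) v₀).1.headD 0 ≠ 0 := by simpa [item, vals] using h₀
      rw [cutStep, ifz, if_pos rfl, ifz, if_neg e]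
      rfl
    rw [this, cutFold_pivot b φ φs v₀ h₀]

/-- Correctness of the computation of kernels. -/
theorem kerBy_forms {r : ℕ} (φs : List ((Fin r → L) →ₗ[ZMod p] ZMod p)) {l : List (Fin r → L)}
    (hl : LIList (ZMod p) l) :
    ∃ l' : List (Fin r → L), kerBy p (l.map (item b φs)) = l'.map (rep b) ∧
      LIList (ZMod p) l' ∧
      ∀ y, y ∈ spanL (ZMod p) l' ↔ y ∈ spanL (ZMod p) l ∧ ∀ φ ∈ φs, φ y = 0 := by
  have iter : ∀ (φs : List ((Fin r → L) →ₗ[ZMod p] ZMod p)) (l : List (Fin r → L)),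
      LIList (ZMod p) l → ∃ l' : List (Fin r → L),
        (cutHead p)^[φs.length] (l.map (item b φs)) = l'.map (item b []) ∧
        LIList (ZMod p) l' ∧
        ∀ y, y ∈ spanL (ZMod p) l' ↔ y ∈ spanL (ZMod p) l ∧ ∀ φ ∈ φs, φ y = 0 := by
    intro φs
    induction φs with
    | nil => intro l hl; exact ⟨l, rfl, hl, by simp⟩
    | cons φ φs ih =>
      intro l hl
      obtain ⟨l₁, h1, h2, h3⟩ := cutHead_spec b φ φs hl
      obtain ⟨l₂, h4, h5, h6⟩ := ih l₁ h2
      refine ⟨l₂, ?_, h5, fun y => ?_⟩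
      · rw [List.length_cons, Function.iterate_succ_apply, h1, h4]
      · rw [h6, h3]
        simp [and_assoc]
  cases l with
  | nil =>
    refine ⟨[], by simp [kerBy], hl, fun y => ?_⟩
    rw [spanL_nil, Submodule.mem_bot]
    constructor
    · rintro rfl; simp
    · exact fun h => h.1
  | cons v l =>
    obtain ⟨l', h1, h2, h3⟩ := iter φs _ hl
    refine ⟨l', ?_, h2, h3⟩
    rw [kerBy, List.foldl_const]
    have : (((v :: l).map (item b φs)).headD ([], [])).1.length = φs.length := by
      simp [item, vals]
    rw [this, h1, List.map_map]
    rfl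

/-- Correctness of the computation of kernels of additive maps with values in the field. -/
theorem kerBy_spec {r : ℕ} (us : List ((Fin r → L) → L))
    (hus : ∀ u ∈ us, ∀ x y, u (x + y) = u x + u y) {l : List (Fin r → L)}
    (hl : LIList (ZMod p) l) (g : List (List ℕ) → List (List ℕ))
    (hg : ∀ v ∈ l, g (rep b v) = us.map fun u => crd b (u v)) :
    ∃ l' : List (Fin r → L),
      kerBy p ((l.map (rep b)).map fun v => ((g v).flatten, v)) = l'.map (rep b) ∧
      LIList (ZMod p) l' ∧
      ∀ y, y ∈ spanL (ZMod p) l' ↔ y ∈ spanL (ZMod p) l ∧ ∀ u ∈ us, u y = 0 := by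
  classical
  let lm : ((Fin r → L) → L) → ((Fin r → L) →ₗ[ZMod p] L) := fun u =>
    if h : ∀ x y, u (x + y) = u x + u y then (AddMonoidHom.mk' u h).toZModLinearMap p else 0
  have hlm : ∀ u ∈ us, ∀ v, lm u v = u v := fun u hu v => by
    simp only [lm, dif_pos (hus u hu)]
    rfl
  let φs : List ((Fin r → L) →ₗ[ZMod p] ZMod p) :=
    us.flatMap fun u => List.ofFn fun i => (b.coord i) ∘ₗ lm u
  obtain ⟨l', h1, h2, h3⟩ := kerBy_forms b φs hl
  refine ⟨l', ?_, h2, fun y => ?_⟩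
  · rw [← h1, List.map_map]
    congr 1
    refine List.map_congr_left fun v hv => Prod.ext ?_ rfl
    change (g (rep b v)).flatten = vals φs v
    rw [hg v hv, vals, List.map_flatMap, List.flatMap_def]
    congr 1
    refine List.map_congr_left fun u hu => ?_
    rw [List.map_ofFn, crd]
    congr 1
    funext i
    simp [hlm u hu]
  · rw [h3]
    refine and_congr_right fun _ => ?_
    simp only [φs, List.mem_flatMap, List.mem_ofFn]
    constructor
    · intro h u hu
      apply b.repr.injective
      ext i
      have := h _ ⟨u, hu, i, rfl⟩
      simpa [hlm u hu] using this
    · rintro h _ ⟨u, hu, i, rfl⟩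
      simp [hlm u hu, h u hu]

end

/-! ### Correctness of the selection of bases -/

section
variable {p N : ℕ} [Fact p.Prime] {L : Type*} [Field L] [Algebra (ZMod p) L]
  (b : Basis (Fin N) (ZMod p) L)

theorem stdL_tbl : stdL (tbl b) = List.ofFn fun i => crd b (b i) := by
  rw [stdL, rg_eq le_rfl, length_tbl, map_range_eq_ofFn]
  congr 1
  funext i
  rw [map_range_eq_ofFn, crd]
  congr 1
  funext j
  have : Fact (1 < p) := ⟨(Fact.out : p.Prime).one_lt⟩
  rw [eqN_eq, b.repr_self, Finsupp.single_apply]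
  by_cases h : j = i
  · subst h; simp [ZMod.val_one]
  · rw [if_neg (fun h' => h (Fin.ext h')), if_neg fun h' => h h'.symm, ZMod.val_zero]

theorem emb_tbl {r : ℕ} (hr : r ≤ N) (i : Fin r) (x : L) :
    emb (tbl b) r i (crd b x) = rep b (Pi.single i x) := by
  rw [emb, rg_eq (by simpa using hr), map_range_eq_ofFn, rep]
  congr 1
  funext j
  rw [eqN_eq, ifz, Pi.single_apply, zeroV_tbl]
  by_cases h : j = i
  · subst h; simp
  · rw [if_neg (fun h' => h (Fin.ext h')), if_neg h]; simp

theorem stdV_tbl {r : ℕ} (hr : r ≤ N) : ∃ l : List (Fin r → L),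
    stdV (tbl b) r = l.map (rep b) ∧ LIList (ZMod p) l ∧ spanL (ZMod p) l = ⊤ := by
  let l : List (Fin r → L) :=
    (List.ofFn fun i : Fin r => List.ofFn fun j => Pi.single i (b j)).flatten
  have hspan : spanL (ZMod p) l = ⊤ := by
    rw [eq_top_iff, ← (Pi.basis fun _ : Fin r => b).span_eq]
    refine Submodule.span_mono ?_
    rintro _ ⟨⟨i, j⟩, rfl⟩
    rw [Pi.basis_apply]
    simp only [l, Set.mem_ofPred_eq, List.mem_flatten, List.mem_ofFn]
    exact ⟨_, ⟨i, rfl⟩, List.mem_ofFn.2 ⟨j, rfl⟩⟩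
  refine ⟨l, ?_, liList_of_length_eq hspan ?_, hspan⟩
  · rw [stdV, rg_eq (by simpa using hr), List.flatMap_def, map_range_eq_ofFn, List.map_flatten,
      List.map_ofFn]
    congr 2
    funext i
    simp only [Function.comp]
    rw [stdL_tbl, List.map_ofFn, List.map_ofFn]
    congr 1
    funext j
    exact emb_tbl b hr i (b j)
  · rw [finrank_eq_card_basis (Pi.basis fun _ : Fin r => b)]
    simp [l, List.length_flatten, List.map_ofFn, List.sum_ofFn]

/-- The standard symmetric bilinear form on vectors over the prime field. -/
noncomputable def dotForm (r : ℕ) : LinearMap.BilinForm (ZMod p) (Fin r → L) :=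
  LinearMap.mk₂ (ZMod p) (fun v w => ∑ i, ∑ j, b.repr (v i) j * b.repr (w i) j)
    (fun v v' w => by simp [add_mul, Finset.sum_add_distrib])
    (fun c v w => by simp [Finset.mul_sum, mul_assoc])
    (fun v w w' => by simp [mul_add, Finset.sum_add_distrib])
    (fun c v w => by simp [Finset.mul_sum, mul_left_comm])

theorem dotForm_apply {r : ℕ} (v w : Fin r → L) :
    dotForm b r v w = ∑ i, ∑ j, b.repr (v i) j * b.repr (w i) j := rfl

theorem dotForm_symm {r : ℕ} (v w : Fin r → L) : dotForm b r v w = dotForm b r w v := by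
  simp [dotForm_apply, mul_comm]

theorem dotForm_eq_zero {r : ℕ} {v : Fin r → L} (h : ∀ w, dotForm b r v w = 0) : v = 0 := by
  funext i
  apply b.repr.injective
  ext j
  have := h (Pi.single i (b j))
  rw [dotForm_apply, Finset.sum_eq_single i, Finset.sum_eq_single j] at this
  · simpa using this
  · intro j' _ hj
    simp [hj.symm]
  · simp
  · intro i' _ hi
    simp [hi]
  · simp

theorem dot_rep {r : ℕ} (v w : Fin r → L) :
    dot p (rep b v).flatten (rep b w).flatten = (dotForm b r v w).val := by
  let F : ℕ → ℕ × ℕ → ℕ := fun acc z => md p (acc + z.1 * z.2)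
  have hcrd : ∀ (x y : L) (a : ZMod p), ((crd b x).zip (crd b y)).foldl F a.val =
      (a + ∑ j, b.repr x j * b.repr y j).val := by
    intro x y a
    rw [crd, crd, zip_ofFn]
    refine foldl_ofFn (fun a : ZMod p => a.val) F _ _ (fun z j => ?_) a
    simp [F, md_eq]
  have key : ∀ (r : ℕ) (v w : Fin r → L) (a : ZMod p),
      ((rep b v).flatten.zip (rep b w).flatten).foldl F a.val =
        (a + ∑ i, ∑ j, b.repr (v i) j * b.repr (w i) j).val := by
    intro r
    induction r with
    | zero => intro v w a; simp [rep]
    | succ r ih =>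
      intro v w a
      have e : ∀ v : Fin (r + 1) → L,
          (rep b v).flatten = crd b (v 0) ++ (rep b fun i => v i.succ).flatten := fun v => by
        rw [rep, List.ofFn_succ, List.flatten_cons, rep]
      rw [e, e, List.zip_append (by simp [crd]), List.foldl_append, hcrd, ih, Fin.sum_univ_succ,
        add_assoc]
  have := key r v w 0
  rw [ZMod.val_zero, zero_add] at this
  exact this

variable {K : Type*} [Field K] [Algebra K L]

/-- Correctness of the selection of a basis over the subfield `K` spanned by `F`. -/
theorem greedy_spec {F : List L} (hF : ∀ x, x ∈ spanL (ZMod p) F ↔ ∃ k : K, algebraMap K L k = x)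
    {r : ℕ} (hr : r ≤ N) (l : List (Fin r → L)) :
    ∃ l' : List (Fin r → L),
      greedy p (tbl b) (F.map (crd b)) r (l.map (rep b)) = l'.map (rep b) ∧
      LIList K l' ∧ spanL K l' = spanL K l := by
  let B := dotForm b r
  have hrefl : B.IsRefl := fun v w h => by
    rw [dotForm_symm]; exact h
  have hnd : B.Nondegenerate := by
    refine (LinearMap.IsRefl.nondegenerate_iff_separatingLeft hrefl).2 ?_
    exact fun v h => dotForm_eq_zero b h
  -- the annihilator of a vector space over `K`, and its annihilator
  let S : Submodule K (Fin r → L) → Submodule (ZMod p) (Fin r → L) :=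
    fun U => AddSubgroup.toZModSubmodule p U.toAddSubgroup
  have hS : ∀ U v, v ∈ S U ↔ v ∈ U := fun U v => Iff.rfl
  have hdual : ∀ U v, v ∈ U ↔ ∀ φ ∈ B.orthogonal (S U), B φ v = 0 := fun U v => by
    have : FiniteDimensional (ZMod p) (Fin r → L) :=
      Module.Finite.of_basis (Pi.basis fun _ : Fin r => b)
    rw [← hS]
    conv_lhs => rw [← LinearMap.BilinForm.orthogonal_orthogonal hnd hrefl (S U)]
    rw [LinearMap.BilinForm.mem_orthogonal_iff]
  have hmul : ∀ (x : L) (v : Fin r → L),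
      (rep b v).map (fun y => mulV p (tbl b) (crd b x) y) = rep b (x • v) := fun x v => by
    rw [rep, rep, List.map_ofFn]
    congr 1
    funext i
    simp [mulV_crd]
  obtain ⟨std, hstd, hstdLI, hstdspan⟩ := stdV_tbl b hr
  suffices key : ∃ An l' : List (Fin r → L),
      (l.map (rep b)).foldl (greedyStep p (tbl b) (F.map (crd b))) (stdV (tbl b) r, []) =
        (An.map (rep b), l'.map (rep b)) ∧ LIList (ZMod p) An ∧
      spanL (ZMod p) An = B.orthogonal (S (spanL K l)) ∧ LIList K l' ∧ spanL K l' = spanL K l by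
    obtain ⟨An, l', h1, -, -, h2, h3⟩ := key
    exact ⟨l', by rw [greedy, h1], h2, h3⟩
  induction l using List.reverseRecOn with
  | nil =>
    refine ⟨std, [], by simp [hstd], hstdLI, ?_, liList_nil, rfl⟩
    rw [hstdspan, eq_comm, eq_top_iff]
    intro φ _
    rw [LinearMap.BilinForm.mem_orthogonal_iff]
    intro v hv
    rw [hS, spanL_nil, Submodule.mem_bot] at hv
    rw [hv]
    change B 0 φ = 0
    simp
  | append_singleton l v ih =>
    obtain ⟨An, l', h1, h2, h3, h4, h5⟩ := ih
    rw [List.map_append, List.foldl_append, h1]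
    -- the linear forms that cut out the new annihilator
    let φs : List ((Fin r → L) →ₗ[ZMod p] ZMod p) := F.map fun f => B.flip (f • v)
    obtain ⟨An', g1, g2, g3⟩ := kerBy_forms b φs h2
    have hk : kerBy p ((An.map (rep b)).map fun φ =>
        ((F.map (crd b)).map fun f => dot p φ.flatten
          ((rep b v).map fun x => mulV p (tbl b) f x).flatten, φ)) = An'.map (rep b) := by
      rw [← g1, List.map_map]
      congr 1
      refine List.map_congr_left fun φ _ => Prod.ext ?_ rfl
      simp only [Function.comp, item, vals, φs, List.map_map]
      refine List.map_congr_left fun f _ => ?_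
      simp only [Function.comp, hmul, dot_rep]
      rfl
    have hsp : spanL K (l ++ [v]) = spanL K l ⊔ spanL K [v] := spanL_append _ _
    have hv : spanL K [v] = Submodule.span K {v} := by
      rw [spanL_cons, spanL_nil, sup_bot_eq]
    have hAn' : spanL (ZMod p) An' = B.orthogonal (S (spanL K (l ++ [v]))) := by
      ext φ
      rw [g3, h3, LinearMap.BilinForm.mem_orthogonal_iff, LinearMap.BilinForm.mem_orthogonal_iff]
      have hF' : (∀ ψ ∈ φs, ψ φ = 0) ↔ ∀ k : K, B (k • v) φ = 0 := by
        simp only [φs, List.mem_map, forall_exists_index, and_imp, forall_apply_eq_imp_iff₂]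
        constructor
        · intro h k
          let U : Submodule (ZMod p) L :=
            { carrier := {x | B φ (x • v) = 0}
              add_mem' := fun {x y} hx hy => by
                simp only [Set.mem_ofPred_eq] at hx hy ⊢
                rw [add_smul, map_add, hx, hy, add_zero]
              zero_mem' := by simp
              smul_mem' := fun c x hx => by
                simp only [Set.mem_ofPred_eq] at hx ⊢
                rw [smul_assoc, map_smul, hx, smul_zero] }
          have hU : spanL (ZMod p) F ≤ U := spanL_le.2 fun f hf => h f hf
          have := hU ((hF (algebraMap K L k)).2 ⟨k, rfl⟩)
          have e : algebraMap K L k • v = k • v := by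
            rw [algebraMap_smul]
          have h' : B φ (algebraMap K L k • v) = 0 := this
          rw [e] at h'
          rw [← h']
          exact dotForm_symm b _ _
        · intro h f hf
          obtain ⟨k, hk⟩ := (hF f).1 (mem_spanL_of_mem hf)
          have := h k
          rw [← algebraMap_smul L k v, hk] at this
          rw [← this]
          exact dotForm_symm b _ _
      rw [hF', hsp, hv]
      constructor
      · rintro ⟨a1, a2⟩ w hw
        rw [hS] at hw
        obtain ⟨w₁, hw₁, w₂, hw₂, rfl⟩ := Submodule.mem_sup.1 hw
        obtain ⟨k, rfl⟩ := Submodule.mem_span_singleton.1 hw₂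
        have e1 : B w₁ φ = 0 := a1 w₁ hw₁
        change B (w₁ + k • v) φ = 0
        rw [map_add, LinearMap.add_apply, e1, a2, add_zero]
      · intro a
        refine ⟨fun w hw => a w (Submodule.mem_sup_left hw), fun k => a _ ?_⟩
        exact Submodule.mem_sup_right (Submodule.smul_mem _ _ (Submodule.mem_span_singleton_self v))
    -- the membership test
    have htest : nonzero ((An.map (rep b)).map fun φ => dot p φ.flatten (rep b v).flatten) = 0 ↔
        v ∈ spanL K l := by
      rw [nonzero_eq_zero_iff, hdual, ← h3]
      simp only [List.map_map, List.mem_map, forall_exists_index, and_imp,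
        forall_apply_eq_imp_iff₂, Function.comp, dot_rep, ZMod.val_eq_zero]
      constructor
      · intro h φ hφ
        have : spanL (ZMod p) An ≤ LinearMap.ker (B.flip v) := spanL_le.2 fun φ hφ => h φ hφ
        exact this hφ
      · exact fun h φ hφ => h φ (mem_spanL_of_mem hφ)
    by_cases hmem : v ∈ spanL K l
    · refine ⟨An', l', ?_, g2, hAn', h4, ?_⟩
      · simp only [List.map_cons, List.map_nil, List.foldl_cons, List.foldl_nil, greedyStep, hk,
          htest.2 hmem, ifz, if_true]
      · rw [h5, hsp, hv, left_eq_sup, Submodule.span_singleton_le_iff_mem]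
        exact hmem
    · refine ⟨An', l' ++ [v], ?_, g2, hAn', ?_, ?_⟩
      · have h6 : nonzero ((An.map (rep b)).map fun φ => dot p φ.flatten (rep b v).flatten) ≠ 0 :=
          fun h => hmem (htest.1 h)
        simp only [List.map_cons, List.map_nil, List.foldl_cons, List.foldl_nil, greedyStep, hk,
          ifz, if_neg h6, List.map_append]
      · have h7 : LIList K (v :: l') := liList_cons.2 ⟨by rw [h5]; exact hmem, h4⟩
        exact h7.perm (List.perm_append_singleton v l').symm
      · rw [spanL_append, h5, hsp]

end

/-! ### The Frobenius and skew polynomials -/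

section
variable (K : Type*) {L : Type*} [Field K] [Field L] [Algebra K L]

/-- The `j`-th power of the Frobenius of `L` over the finite field `K`. -/
noncomputable def frobPow (L : Type*) [Field L] [Algebra K L] [Finite K] (j : ℕ) : L →ₐ[K] L :=
  letI := Fintype.ofFinite K
  FiniteField.frobeniusAlgHom K L ^ j

theorem frobPow_apply [Finite K] (j : ℕ) (x : L) : frobPow K L j x = x ^ Nat.card K ^ j := by
  let := Fintype.ofFinite K
  rw [frobPow, AlgHom.coe_pow, FiniteField.coe_frobeniusAlgHom, pow_iterate,
    Nat.card_eq_fintype_card]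

theorem add_pow_card_pow [Finite K] (j : ℕ) (x y : L) :
    (x + y) ^ Nat.card K ^ j = x ^ Nat.card K ^ j + y ^ Nat.card K ^ j := by
  simp only [← frobPow_apply K, map_add]

theorem sub_pow_card_pow [Finite K] (j : ℕ) (x y : L) :
    (x - y) ^ Nat.card K ^ j = x ^ Nat.card K ^ j - y ^ Nat.card K ^ j := by
  simp only [← frobPow_apply K, map_sub]

theorem sum_pow_card_pow [Finite K] {ι : Type*} (s : Finset ι) (f : ι → L) (j : ℕ) :
    (∑ i ∈ s, f i) ^ Nat.card K ^ j = ∑ i ∈ s, f i ^ Nat.card K ^ j := by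
  simp only [← frobPow_apply K, map_sum]

theorem algebraMap_pow_card_pow [Finite K] (j : ℕ) (c : K) :
    algebraMap K L c ^ Nat.card K ^ j = algebraMap K L c := by
  rw [← frobPow_apply K, AlgHom.commutes]

/-- The elements of the small field are those fixed by the Frobenius. -/
theorem pow_card_eq_self_iff [Finite K] (x : L) :
    x ^ Nat.card K = x ↔ ∃ c : K, algebraMap K L c = x := by
  constructor
  · intro h
    let := Fintype.ofFinite K
    rw [Nat.card_eq_fintype_card] at h
    have h1 := FiniteField.X_pow_card_sub_X_ne_zero L (Fintype.one_lt_card (α := K))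
    have h2 : x ∈ ((Polynomial.X ^ Fintype.card K - Polynomial.X : Polynomial K).map
        (algebraMap K L)).roots := by
      rw [Polynomial.mem_roots (by simpa using h1)]
      simp [h]
    have h3 : (Polynomial.X ^ Fintype.card K - Polynomial.X : Polynomial K).roots.map
        (algebraMap K L) = ((Polynomial.X ^ Fintype.card K - Polynomial.X : Polynomial K).map
        (algebraMap K L)).roots := by
      refine (Polynomial.Splits.roots_map (Polynomial.splits_iff_card_roots.2 ?_) _).symm
      rw [FiniteField.roots_X_pow_card_sub_X,
        FiniteField.X_pow_card_sub_X_natDegree_eq K Fintype.one_lt_card]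
      rfl
    rw [← h3] at h2
    obtain ⟨c, _, hc⟩ := Multiset.mem_map.1 h2
    exact ⟨c, hc⟩
  · rintro ⟨c, rfl⟩
    simpa using algebraMap_pow_card_pow K (L := L) 1 c

/-- The `j`-fold application of `z ↦ z ^ h * a`. -/
noncomputable def opPow (j : ℕ) (a z : L) : L := z ^ Nat.card K ^ j * genPow K j a

omit [Algebra K L] [Field K] in
theorem opPow_zero (a z : L) : opPow K 0 a z = z := by simp [opPow, genPow]

omit [Algebra K L] [Field K] in
theorem opPow_succ (j : ℕ) (a z : L) : opPow K (j + 1) a z = opPow K j a (z ^ Nat.card K * a) := by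
  rw [opPow, opPow, genPow, genPow, Finset.prod_range_succ, mul_pow, ← pow_mul, ← pow_succ']
  ring

variable [Finite K]

theorem opPow_add (j : ℕ) (a z w : L) : opPow K j a (z + w) = opPow K j a z + opPow K j a w := by
  rw [opPow, add_pow_card_pow, add_mul]; rfl

theorem opPow_sub (j : ℕ) (a z w : L) : opPow K j a (z - w) = opPow K j a z - opPow K j a w := by
  rw [opPow, sub_pow_card_pow, sub_mul]; rfl

omit [Algebra K L] [Finite K] [Field K] in
theorem opPow_mul (j : ℕ) (a c z : L) :
    opPow K j a (c * z) = c ^ Nat.card K ^ j * opPow K j a z := by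
  rw [opPow, opPow, mul_pow, mul_assoc]

theorem opPow_smul (j : ℕ) (a : L) (c : K) (z : L) : opPow K j a (c • z) = c • opPow K j a z := by
  rw [Algebra.smul_def, Algebra.smul_def, opPow_mul, algebraMap_pow_card_pow]

omit [Finite K] [Algebra K L] [Field K] in
theorem opPow_succ' (j : ℕ) (a z : L) : opPow K (j + 1) a z = opPow K j a z ^ Nat.card K * a := by
  induction j generalizing z with
  | zero => rw [opPow_succ, opPow_zero, opPow_zero]
  | succ j ih => rw [opPow_succ, ih, ← opPow_succ]

/-- Right division of a skew polynomial by `x - c`, with quotient `g` and remainder `r`, in terms of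
the evaluations: at the parameter `a`, the polynomial `x - c` is the map `z ↦ z ^ h * a - c * z`. -/
theorem skew_division (d : ℕ) (f : ℕ → L) (c : L) : ∃ (g : ℕ → L) (r : L),
    (∀ a z, ∑ j ∈ Finset.range (d + 1), f j * opPow K j a z =
      ∑ j ∈ Finset.range d, g j * opPow K j a (z ^ Nat.card K * a - c * z) + r * z) ∧
    ((∀ j < d, g j = 0) → r = 0 → ∀ j < d + 1, f j = 0) := by
  induction d generalizing f with
  | zero =>
    refine ⟨0, f 0, fun a z => by simp [opPow_zero], fun _ h j hj => ?_⟩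
    obtain rfl : j = 0 := by omega
    exact h
  | succ d ih =>
    obtain ⟨g, r, h1, h2⟩ :=
      ih fun j => if j = d then f d + f (d + 1) * c ^ Nat.card K ^ d else f j
    refine ⟨fun j => if j = d then f (d + 1) else g j, r, fun a z => ?_, fun hg hr => ?_⟩
    · have e1 := h1 a z
      rw [Finset.sum_range_succ] at e1
      rw [Finset.sum_range_succ, Finset.sum_range_succ, Finset.sum_range_succ (n := d)]
      have e2 : ∑ j ∈ Finset.range d,
          (if j = d then f d + f (d + 1) * c ^ Nat.card K ^ d else f j) * opPow K j a z =
          ∑ j ∈ Finset.range d, f j * opPow K j a z :=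
        Finset.sum_congr rfl fun j hj => by
          rw [if_neg (Finset.mem_range.1 hj).ne]
      have e3 : ∑ j ∈ Finset.range d, (if j = d then f (d + 1) else g j) *
          opPow K j a (z ^ Nat.card K * a - c * z) =
          ∑ j ∈ Finset.range d, g j * opPow K j a (z ^ Nat.card K * a - c * z) :=
        Finset.sum_congr rfl fun j hj => by
          rw [if_neg (Finset.mem_range.1 hj).ne]
      rw [e2] at e1
      rw [e3]
      simp only [if_true] at e1 ⊢
      rw [opPow_succ, opPow_sub, opPow_mul K d a c z]
      linear_combination e1
    · have h3 : f (d + 1) = 0 := by simpa using hg d (by omega)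
      have h4 := h2 (fun j hj => by
        have := hg j (by omega)
        simpa only [if_neg hj.ne] using this) hr
      intro j hj
      rcases Nat.lt_or_ge j (d + 1) with hjd | hjd
      · have := h4 j hjd
        by_cases hj' : j = d
        · subst hj'; simpa [h3] using this
        · rwa [if_neg hj'] at this
      · obtain rfl : j = d + 1 := by omega
        exact h3

/-- A nonzero skew polynomial of degree `< d` cannot vanish on spaces of total dimension `d` at
parameters from distinct conjugacy classes.  If it vanishes at `z₀ ≠ 0`, it can be divided by `x - c`,
where `c` is conjugate to the parameter of `z₀`; the map `x - c` has a kernel of dimension one at this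
parameter and is injective at all others, so the total dimension drops by at most one. -/
theorem skew_root_count [Finite L] {ℓ : ℕ} (a : Fin ℓ → L) (ha : ∀ i, a i ≠ 0)
    (hconj : ∀ i j, i ≠ j → ¬ IsSigmaConj K (a i) (a j)) (d : ℕ) (f : ℕ → L)
    (V : Fin ℓ → Submodule K L) (hV : d ≤ ∑ i, finrank K (V i))
    (h : ∀ i, ∀ z ∈ V i, ∑ j ∈ Finset.range d, f j * opPow K j (a i) z = 0) :
    ∀ j < d, f j = 0 := by
  have : FiniteDimensional K L := inferInstance
  induction d generalizing f V with
  | zero => intro j hj; omega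
  | succ d ih =>
    obtain ⟨i₀, hi₀⟩ : ∃ i, V i ≠ ⊥ := by
      by_contra! h0
      have : ∑ i, finrank K (V i) = 0 := Finset.sum_eq_zero fun i _ => by rw [h0 i, finrank_bot]
      omega
    obtain ⟨z₀, hz₀, hz₀'⟩ := Submodule.exists_mem_ne_zero_of_ne_bot hi₀
    set c := z₀ ^ Nat.card K * a i₀ * z₀⁻¹ with hc
    have hcz : z₀ ^ Nat.card K * a i₀ - c * z₀ = 0 := by
      rw [hc]; field_simp; ring
    obtain ⟨g, r, h1, h2⟩ := skew_division K d f c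
    have hr : r = 0 := by
      have := h i₀ z₀ hz₀
      rw [h1, hcz] at this
      have e : ∀ j, opPow K j (a i₀) 0 = 0 := fun j => by
        have := opPow_sub K j (a i₀) 0 0
        simpa using this
      simpa [e, hz₀'] using this
    -- the maps `x - c`
    let δ : Fin ℓ → (L →ₗ[K] L) := fun i =>
      LinearMap.mulRight K (a i) ∘ₗ (frobPow K L 1).toLinearMap - LinearMap.mulLeft K c
    have hδ : ∀ i z, δ i z = z ^ Nat.card K * a i - c * z := fun i z => by
      simp [δ, frobPow_apply]
    have hker : ∀ i, finrank K (LinearMap.ker (δ i)) ≤ if i = i₀ then 1 else 0 := by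
      intro i
      split_ifs with hi
      · subst hi
        have hle : LinearMap.ker (δ i) ≤ Submodule.span K {z₀} := by
          intro z hz
          rw [LinearMap.mem_ker, hδ, hc] at hz
          have h3 : (z * z₀⁻¹) ^ Nat.card K = z * z₀⁻¹ := by
            rw [mul_pow, inv_pow]
            have := ha i
            have h4 : z₀ ^ Nat.card K ≠ 0 := pow_ne_zero _ hz₀'
            field_simp at hz ⊢
            have h5 : a i * (z ^ Nat.card K * z₀ - z₀ ^ Nat.card K * z) = 0 := by
              linear_combination hz
            have h6 := (mul_eq_zero.1 h5).resolve_left this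
            linear_combination h6
          obtain ⟨k, hk⟩ := (pow_card_eq_self_iff K _).1 h3
          refine Submodule.mem_span_singleton.2 ⟨k, ?_⟩
          rw [Algebra.smul_def, hk]
          field_simp
        exact (Submodule.finrank_mono hle).trans (finrank_span_singleton hz₀').le
      · rw [Nat.le_zero, Submodule.finrank_eq_zero, LinearMap.ker_eq_bot']
        intro z hz
        by_contra hz0
        refine hconj i i₀ hi ⟨z * z₀⁻¹, mul_ne_zero hz0 (inv_ne_zero hz₀'), ?_⟩
        rw [hδ, hc] at hz
        rw [mul_pow, inv_pow]
        have h4 : z₀ ^ Nat.card K ≠ 0 := pow_ne_zero _ hz₀'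
        field_simp at hz ⊢
        linear_combination -hz
    have hdim : ∀ i, finrank K (V i) ≤ finrank K ((V i).map (δ i)) + if i = i₀ then 1 else 0 := by
      intro i
      have h3 := LinearMap.finrank_range_add_finrank_ker ((δ i).domRestrict (V i))
      rw [LinearMap.range_domRestrict] at h3
      have h4 : finrank K (LinearMap.ker ((δ i).domRestrict (V i))) ≤
          finrank K (LinearMap.ker (δ i)) := by
        rw [LinearMap.ker_domRestrict, ← Submodule.finrank_map_subtype_eq]
        exact Submodule.finrank_mono (Submodule.map_comap_le _ _)
      have := hker i
      omega
    have hg : ∀ j < d, g j = 0 := by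
      refine ih g (fun i => (V i).map (δ i)) ?_ ?_
      · have h5 := Finset.sum_le_sum fun i (_ : i ∈ Finset.univ) => hdim i
        rw [Finset.sum_add_distrib] at h5
        simp only [Finset.sum_ite_eq', Finset.mem_univ, if_true] at h5
        omega
      · rintro i _ ⟨z, hz, rfl⟩
        have := h i z hz
        rw [h1, hr, zero_mul, add_zero] at this
        rwa [hδ]
    exact h2 hg hr

end

/-! ### The folded Wronskian and subspace designs over the middle field -/

section
open Polynomial
variable {E : Type*} [Field E]

/-- The folded Wronskian `det (g_a(γ ^ b X))`. -/
noncomputable def foldedWronskian (γ : E) {s : ℕ} (g : Fin s → E[X]) : E[X] :=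
  (Matrix.of fun a b : Fin s => (g a).comp (C (γ ^ (b : ℕ)) * X)).det

theorem coeff_prod_sum_of_natDegree_le {ι : Type*} (t : Finset ι) (f : ι → E[X]) (r : ι → ℕ)
    (h : ∀ i ∈ t, (f i).natDegree ≤ r i) :
    (∏ i ∈ t, f i).coeff (∑ i ∈ t, r i) = ∏ i ∈ t, (f i).coeff (r i) := by
  classical
  induction t using Finset.induction with
  | empty => simp
  | insert i t hi ih =>
    have ht : ∀ j ∈ t, (f j).natDegree ≤ r j := fun j hj => h j (Finset.mem_insert_of_mem hj)
    rw [Finset.prod_insert hi, Finset.sum_insert hi, Finset.prod_insert hi,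
      coeff_mul_add_eq_of_natDegree_le (h i (Finset.mem_insert_self i t))
        ((natDegree_prod_le t f).trans (Finset.sum_le_sum ht)), ih ht]

theorem natDegree_comp_C_mul_X_le (f : E[X]) (c : E) :
    (f.comp (C c * X)).natDegree ≤ f.natDegree := by
  refine natDegree_comp_le.trans ?_
  calc f.natDegree * (C c * X).natDegree ≤ f.natDegree * 1 :=
        Nat.mul_le_mul_left _ ((natDegree_C_mul_le c X).trans natDegree_X_le)
    _ = _ := mul_one _

theorem natDegree_foldedWronskian_le (γ : E) {s m : ℕ} (g : Fin s → E[X])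
    (hg : ∀ a, (g a).natDegree ≤ m) : (foldedWronskian γ g).natDegree ≤ s * m := by
  rw [foldedWronskian, Matrix.det_apply]
  refine natDegree_sum_le_of_forall_le _ _ fun σ _ => ?_
  refine (natDegree_smul_le _ _).trans ((natDegree_prod_le _ _).trans ?_)
  calc _ ≤ ∑ _i : Fin s, m := Finset.sum_le_sum fun i _ =>
        (natDegree_comp_C_mul_X_le _ _).trans (hg _)
    _ = s * m := by simp

/-- The folded Wronskian of polynomials of distinct degrees is nonzero if the order of `γ` is
large: its leading coefficient is a Vandermonde determinant. -/
theorem foldedWronskian_ne_zero (γ : E) {s : ℕ} (g : Fin s → E[X]) (hg : ∀ a, g a ≠ 0)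
    (hγ : Function.Injective fun a => γ ^ (g a).natDegree) : foldedWronskian γ g ≠ 0 := by
  have hcoeff : (foldedWronskian γ g).coeff (∑ a, (g a).natDegree) =
      (Matrix.of fun a b : Fin s => (g a).leadingCoeff *
        Matrix.vandermonde (fun a => γ ^ (g a).natDegree) a b).det := by
    rw [foldedWronskian, ← Matrix.det_transpose, Matrix.det_apply, finsetSum_coeff,
      ← Matrix.det_transpose, Matrix.det_apply]
    refine Finset.sum_congr rfl fun σ _ => ?_
    rw [coeff_smul]
    congr 1
    simp only [Matrix.transpose_apply, Matrix.of_apply]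
    rw [coeff_prod_sum_of_natDegree_le _ _ _ fun a _ => natDegree_comp_C_mul_X_le _ _]
    refine Finset.prod_congr rfl fun a _ => ?_
    rw [comp_C_mul_X_coeff, Matrix.vandermonde_apply, leadingCoeff, ← pow_mul, ← pow_mul,
      mul_comm (g a).natDegree]
  intro h
  rw [h, coeff_zero, Matrix.det_mul_column] at hcoeff
  rcases mul_eq_zero.1 hcoeff.symm with h | h
  · rw [Finset.prod_eq_zero_iff] at h
    obtain ⟨a, _, ha⟩ := h
    exact hg a (leadingCoeff_eq_zero.1 ha)
  · exact Matrix.det_vandermonde_ne_zero_iff.2 hγ h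

/-- A space of polynomials contains polynomials of as many degrees as its dimension. -/
theorem exists_distinct_natDegree (m : ℕ) (W : Submodule E E[X]) (hW : W ≤ degreeLT E m) (s : ℕ)
    (hs : finrank E W = s) : ∃ f : Fin s → E[X], (∀ a, f a ∈ W ∧ f a ≠ 0) ∧
      Function.Injective fun a => (f a).natDegree := by
  induction m generalizing W s with
  | zero =>
    have : W = ⊥ := by
      rw [eq_bot_iff]
      intro f hf
      have := hW hf
      rw [mem_degreeLT] at this
      simpa using this
    subst this
    rw [finrank_bot] at hs
    subst hs
    exact ⟨Fin.elim0, fun a => a.elim0, fun a => a.elim0⟩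
  | succ m ih =>
    by_cases hle : W ≤ degreeLT E m
    · exact ih W hle s hs
    · obtain ⟨f₀, hf₀, hf₀'⟩ := Set.not_subset.1 hle
      have hdeg : ∀ f ∈ W, f ∉ degreeLT E m → f.natDegree = m ∧ f ≠ 0 := by
        intro f hf hf'
        have h1 := hW hf
        rw [mem_degreeLT] at h1 hf'
        have h0 : f ≠ 0 := by
          rintro rfl
          exact hf' (by simp)
        rw [degree_eq_natDegree h0, Nat.cast_lt] at h1 hf'
        exact ⟨by omega, h0⟩
      have : FiniteDimensional E W :=
        Submodule.finiteDimensional_of_le (S₂ := degreeLT E (m + 1)) hW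
      have hlt : W ⊓ degreeLT E m < W :=
        lt_of_le_of_ne inf_le_left fun h => hle (by rw [← h]; exact inf_le_right)
      have hdim : finrank E W ≤ finrank E ↥(W ⊓ degreeLT E m) + 1 := by
        have h1 := LinearMap.finrank_range_add_finrank_ker ((lcoeff E m).domRestrict W)
        have h2 : finrank E (LinearMap.ker ((lcoeff E m).domRestrict W)) ≤
            finrank E ↥(W ⊓ degreeLT E m) := by
          rw [LinearMap.ker_domRestrict, ← Submodule.finrank_map_subtype_eq]
          have hle' : Submodule.map W.subtype
              (Submodule.comap W.subtype (LinearMap.ker (lcoeff E m))) ≤ W ⊓ degreeLT E m := by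
            rintro _ ⟨⟨f, hf⟩, hf', rfl⟩
            refine ⟨hf, ?_⟩
            by_contra hcon
            obtain ⟨h3, h4⟩ := hdeg f hf hcon
            have h5 : f.coeff m = 0 := hf'
            rw [← h3] at h5
            exact h4 (leadingCoeff_eq_zero.1 h5)
          have : FiniteDimensional E ↥(W ⊓ degreeLT E m) :=
            Submodule.finiteDimensional_of_le inf_le_left
          exact Submodule.finrank_mono hle'
        have h3 : finrank E (LinearMap.range ((lcoeff E m).domRestrict W)) ≤ 1 :=
          (Submodule.finrank_le _).trans (finrank_self E).le
        omega
      have hlt' := Submodule.finrank_lt_finrank_of_lt hlt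
      obtain ⟨s, rfl⟩ : ∃ s', s = s' + 1 := ⟨s - 1, by omega⟩
      obtain ⟨f, hf, hinj⟩ := ih (W ⊓ degreeLT E m) inf_le_right s (by omega)
      have hfdeg : ∀ a, (f a).natDegree < m := fun a => by
        have h1 := (hf a).1.2
        rw [SetLike.mem_coe, mem_degreeLT, degree_eq_natDegree (hf a).2, Nat.cast_lt] at h1
        exact h1
      obtain ⟨h3, h4⟩ := hdeg f₀ hf₀ hf₀'
      refine ⟨Fin.cons f₀ f, fun a => ?_, fun a a' h => ?_⟩
      · refine Fin.cases ⟨hf₀, h4⟩ (fun a => ⟨(hf a).1.1, (hf a).2⟩) a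
      · revert h
        refine Fin.cases ?_ (fun a => ?_) a <;> refine Fin.cases ?_ (fun a' => ?_) a'
        · simp
        · intro h
          have := hfdeg a'
          simp only [Fin.cons_zero, Fin.cons_succ] at h
          omega
        · intro h
          have := hfdeg a
          simp only [Fin.cons_zero, Fin.cons_succ] at h
          omega
        · intro h
          simp only [Fin.cons_succ] at h
          rw [hinj h]

/-- The folded Wronskian of a family divides the folded Wronskian of each family in its span. -/
theorem foldedWronskian_dvd (γ : E) {s : ℕ} (f g : Fin s → E[X])
    (h : ∀ a, f a ∈ Submodule.span E (Set.range g)) :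
    foldedWronskian γ g ∣ foldedWronskian γ f := by
  choose P hP using fun a => (Submodule.mem_span_range_iff_exists_fun E).1 (h a)
  have : (Matrix.of fun a b : Fin s => (f a).comp (C (γ ^ (b : ℕ)) * X)) =
      (Matrix.of fun a c : Fin s => C (P a c)) *
        (Matrix.of fun a b : Fin s => (g a).comp (C (γ ^ (b : ℕ)) * X)) := by
    ext1 a b
    rw [Matrix.mul_apply]
    simp only [Matrix.of_apply]
    rw [← hP a, sum_comp]
    refine Finset.sum_congr rfl fun c _ => ?_
    rw [smul_comp, smul_eq_C_mul]
  rw [foldedWronskian, foldedWronskian, this, Matrix.det_mul]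
  exact dvd_mul_left _ _

/-- The multiplicity of a zero of the folded Wronskian: the rows that belong to polynomials which
vanish at `x, γ x, …, γ ^ (s - 1) x` are divisible by `X - x`. -/
theorem pow_dvd_foldedWronskian (γ x : E) {s : ℕ} (f : Fin s → E[X]) (W W' : Submodule E E[X])
    (hW : finrank E W = s) [FiniteDimensional E W] (hf : ∀ a, f a ∈ W) (hle : W' ≤ W)
    (hW' : ∀ g ∈ W', ∀ b < s, g.eval (γ ^ b * x) = 0) :
    (X - C x) ^ finrank E W' ∣ foldedWronskian γ f := by
  classical
  let U : Submodule E W := W'.comap W.subtype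
  have hU : finrank E U = finrank E W' := by
    rw [← Submodule.finrank_map_subtype_eq, Submodule.map_comap_subtype, inf_eq_right.2 hle]
  obtain ⟨U', hU'⟩ := U.exists_isCompl
  have : Module.Free E U := Module.Free.of_divisionRing E U
  have : Module.Free E U' := Module.Free.of_divisionRing E U'
  let B := ((finBasis E U).prod (finBasis E U')).map (Submodule.prodEquivOfIsCompl U U' hU')
  have hcard : Fintype.card (Fin (finrank E U) ⊕ Fin (finrank E U')) = s := by
    rw [← finrank_eq_card_basis B, hW]
  let e : Fin (finrank E U) ⊕ Fin (finrank E U') ≃ Fin s := Fintype.equivFinOfCardEq hcard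
  let g : Fin s → E[X] := fun a => (B (e.symm a) : E[X])
  have hspan : ∀ a, f a ∈ Submodule.span E (Set.range g) := by
    intro a
    have h1 : (⟨f a, hf a⟩ : W) ∈ Submodule.span E (Set.range B) := by
      rw [B.span_eq]; trivial
    have h2 := Submodule.mem_map_of_mem (f := W.subtype) h1
    rw [Submodule.map_span] at h2
    refine Submodule.span_mono ?_ h2
    rintro _ ⟨_, ⟨i, rfl⟩, rfl⟩
    exact ⟨e i, by simp [g]⟩
  refine dvd_trans ?_ (foldedWronskian_dvd γ f g hspan)
  -- factor `X - x` out of the rows that belong to `W'`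
  let c : Fin s → E[X] := fun a => if g a ∈ W' then X - C x else 1
  have hdvd : ∀ a b : Fin s, c a ∣ (g a).comp (C (γ ^ (b : ℕ)) * X) := by
    intro a b
    simp only [c]
    split_ifs with h
    · rw [dvd_iff_isRoot, IsRoot, eval_comp]
      simpa using hW' _ h b b.2
    · exact one_dvd _
  choose M hM using hdvd
  have hdet : foldedWronskian γ g = (∏ a, c a) * (Matrix.of fun a b => M a b).det := by
    rw [foldedWronskian, ← Matrix.det_mul_column]
    congr 1
    ext1 a b
    exact hM a b
  rw [hdet]
  refine dvd_mul_of_dvd_left ?_ _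
  have hprod : ∏ a, c a = (X - C x) ^ (Finset.univ.filter fun a => g a ∈ W').card := by
    rw [← Finset.prod_filter_mul_prod_filter_not Finset.univ (fun a => g a ∈ W')]
    rw [Finset.prod_congr rfl (g := fun _ => X - C x), Finset.prod_const,
      Finset.prod_eq_one, mul_one]
    · intro a ha
      simp only [c, if_neg (Finset.mem_filter.1 ha).2]
    · intro a ha
      simp only [c, if_pos (Finset.mem_filter.1 ha).2]
  rw [hprod]
  refine pow_dvd_pow _ ?_
  rw [← hU]
  calc finrank E U = (Finset.univ.image fun i : Fin (finrank E U) => e (Sum.inl i)).card := by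
        rw [Finset.card_image_of_injective (f := fun i => e (Sum.inl i)) _
          (e.injective.comp Sum.inl_injective), Finset.card_univ, Fintype.card_fin]
    _ ≤ _ := by
        refine Finset.card_le_card fun a ha => ?_
        obtain ⟨i, _, rfl⟩ := Finset.mem_image.1 ha
        refine Finset.mem_filter.2 ⟨Finset.mem_univ _, ?_⟩
        have : B (Sum.inl i) = (finBasis E U i : W) := by
          simp [B]
        simp only [g, Equiv.symm_apply_apply, this]
        exact (finBasis E U i).2

theorem pow_injOn_of_pow_ne_one {γ : E} {M : ℕ} (h0 : γ ≠ 0) (hγ : ∀ e, 1 ≤ e → e < M → γ ^ e ≠ 1)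
    {i j : ℕ} (hi : i < j + M) (hj : j < i + M) (h : γ ^ i = γ ^ j) : i = j := by
  wlog hij : i ≤ j generalizing i j
  · exact (this hj hi h.symm (by omega)).symm
  by_contra hne
  refine hγ (j - i) (by omega) (by omega) ?_
  have h1 : γ ^ j = γ ^ i * γ ^ (j - i) := by rw [← pow_add]; congr 1; omega
  rw [← h] at h1
  exact (mul_left_cancel₀ (pow_ne_zero i h0) (by rw [mul_one]; exact h1)).symm

/-- The spaces of polynomials that vanish at consecutive powers of an element `γ` of large order
form a subspace design over the field.  For each `i` the `s + 1` points `γ ^ (2 s i + t + 1)`, `t ≤ s`,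
are zeros of the folded Wronskian of multiplicity `dim W' i`, and its degree is at most
`s (m - 1)`. -/
theorem folded_design {γ : E} {M m s k : ℕ} (h0 : γ ≠ 0) (hγ : ∀ e, 1 ≤ e → e < M → γ ^ e ≠ 1)
    (hm : m ≤ M) (hk : 2 * s * k ≤ M) (hs : 1 ≤ s) (W : Submodule E E[X])
    (hW : W ≤ degreeLT E m) (hWs : finrank E W = s) (W' : Fin k → Submodule E E[X])
    (hle : ∀ i, W' i ≤ W)
    (hW' : ∀ i, ∀ f ∈ W' i, ∀ l < 2 * s, f.eval (γ ^ (2 * s * i + l + 1)) = 0) :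
    (s + 1) * ∑ i, finrank E (W' i) ≤ s * (m - 1) := by
  have : FiniteDimensional E W := Submodule.finiteDimensional_of_le (S₂ := degreeLT E m) hW
  obtain ⟨f, hf, hinj⟩ := exists_distinct_natDegree m W hW s hWs
  have hdeg : ∀ a, (f a).natDegree < m := fun a => by
    have h1 := hW (hf a).1
    rw [mem_degreeLT, degree_eq_natDegree (hf a).2, Nat.cast_lt] at h1
    exact h1
  have hne : foldedWronskian γ f ≠ 0 := foldedWronskian_ne_zero γ f (fun a => (hf a).2)
    fun a a' h => hinj (pow_injOn_of_pow_ne_one h0 hγ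
      (by have := hdeg a; dsimp only; omega) (by have := hdeg a'; dsimp only; omega) h)
  have hlt : ∀ (i : Fin k) (t : Fin (s + 1)), 2 * s * (i : ℕ) + t + 1 ≤ M := fun i t => by
    have h1 : 2 * s * ((i : ℕ) + 1) ≤ 2 * s * k := Nat.mul_le_mul_left _ i.2
    have h2 := t.2
    rw [mul_add] at h1
    omega
  have hpts : Function.Injective fun z : Fin k × Fin (s + 1) =>
      γ ^ (2 * s * (z.1 : ℕ) + z.2 + 1) := by
    rintro ⟨i, t⟩ ⟨j, u⟩ h
    have h1 := hlt i t
    have h2 := hlt j u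
    have h3 := pow_injOn_of_pow_ne_one h0 hγ (by dsimp only; omega) (by dsimp only; omega) h
    simp only at h3
    have ht := t.2
    have hu := u.2
    rcases lt_trichotomy (i : ℕ) (j : ℕ) with hij | hij | hij
    · have : 2 * s * ((i : ℕ) + 1) ≤ 2 * s * j := Nat.mul_le_mul_left _ hij
      rw [mul_add] at this
      omega
    · rw [hij] at h3
      exact Prod.ext (Fin.ext hij) (Fin.ext (by simpa using h3))
    · have : 2 * s * ((j : ℕ) + 1) ≤ 2 * s * i := Nat.mul_le_mul_left _ hij
      rw [mul_add] at this
      omega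
  have hdvd : ∏ z : Fin k × Fin (s + 1),
      (X - C (γ ^ (2 * s * (z.1 : ℕ) + z.2 + 1))) ^ finrank E (W' z.1) ∣ foldedWronskian γ f := by
    refine Finset.prod_dvd_of_coprime (fun z _ z' _ hz => ?_) fun z _ => ?_
    · exact (pairwise_coprime_X_sub_C hpts hz).pow
    · refine pow_dvd_foldedWronskian γ _ f W (W' z.1) hWs (fun a => (hf a).1) (hle z.1) ?_
      intro g hg b hb
      have := hW' z.1 g hg (z.2 + b) (by have := z.2.2; omega)
      rw [← pow_add]
      convert this using 2
      ring
  have h1 := natDegree_le_of_dvd hdvd hne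
  rw [natDegree_prod_of_monic _ _ fun z _ => (monic_X_sub_C _).pow _] at h1
  simp only [natDegree_pow, natDegree_X_sub_C, mul_one] at h1
  have h2 : ∑ z : Fin k × Fin (s + 1), finrank E (W' z.1) = (s + 1) * ∑ i, finrank E (W' i) := by
    rw [Fintype.sum_prod_type, Finset.mul_sum]
    exact Finset.sum_congr rfl fun i _ => (Finset.sum_const (finrank E (W' i))).trans (by
      rw [Finset.card_univ, Fintype.card_fin, smul_eq_mul])
  rw [h2] at h1
  exact h1.trans (natDegree_foldedWronskian_le γ f fun a => by have := hdeg a; omega)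

end

/-! ### Linearized equations cutting a space over `E` down to a small space over `K` -/

section
variable {K E X : Type*} [Field K] [Field E] [Algebra K E] [Finite E] [AddCommGroup X]
  [Module K X] [Finite X]

/-- The composition of a `K`-linear form with values in `E` with the `a`-th power of the Frobenius
map `z ↦ z ^ |K|`. -/
noncomputable def frobForm [Finite K] (a : ℕ) (f : X →ₗ[K] E) : X →ₗ[K] E :=
  (frobPow K E a).toLinearMap ∘ₗ f

omit [Finite E] [Finite X] in
theorem frobForm_apply [Finite K] (a : ℕ) (f : X →ₗ[K] E) (x : X) :
    frobForm a f x = f x ^ Nat.card K ^ a := by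
  simp [frobForm, frobPow_apply]

omit [Finite E] [Finite X] in
theorem frobForm_add [Finite K] (a : ℕ) (f g : X →ₗ[K] E) :
    frobForm a (f + g) = frobForm a f + frobForm a g := LinearMap.comp_add _ _ _

omit [Finite E] [Finite X] in
theorem frobForm_smul [Finite K] (a : ℕ) (c : E) (f : X →ₗ[K] E) :
    frobForm a (c • f) = c ^ Nat.card K ^ a • frobForm a f := by
  ext x
  simp [frobForm_apply, mul_pow]

omit [Finite E] [Finite X] in
theorem frobForm_frobForm [Finite K] (a a' : ℕ) (f : X →ₗ[K] E) :
    frobForm a (frobForm a' f) = frobForm (a' + a) f := by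
  ext x
  simp [frobForm_apply, pow_add, pow_mul]

omit [Finite E] [Finite X] in
theorem frobForm_mem_span [Finite K] (a : ℕ) (S : Set (X →ₗ[K] E)) {f : X →ₗ[K] E}
    (hf : f ∈ Submodule.span E S) : frobForm a f ∈ Submodule.span E (frobForm a '' S) := by
  induction hf using Submodule.span_induction with
  | mem x hx => exact Submodule.subset_span ⟨x, hx, rfl⟩
  | zero => rw [frobForm, LinearMap.comp_zero]; exact zero_mem _
  | add x y _ _ hx hy => rw [frobForm_add]; exact add_mem hx hy
  | smul c x _ hx => rw [frobForm_smul]; exact Submodule.smul_mem _ _ hx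

/-- A Frobenius stable space of forms that separates points has at least the dimension of the
space: this is Galois descent, obtained from the trace. -/
theorem finrank_le_of_frob_stable [Finite K] (N : Submodule E (X →ₗ[K] E))
    (hN : ∀ f ∈ N, frobForm 1 f ∈ N) (hsep : ∀ x, (∀ f ∈ N, f x = 0) → x = 0) :
    finrank K X ≤ finrank E N := by
  have hfin : Finite (X →ₗ[K] E) := Finite.of_injective _ DFunLike.coe_injective
  have hsurj : ∀ f ∈ N, ∃ g ∈ N, frobForm 1 g = f := by
    have hinj : Function.Injective fun f : N => (⟨frobForm 1 f.1, hN _ f.2⟩ : N) := by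
      intro f g h
      ext x
      have := LinearMap.congr_fun (Subtype.ext_iff.1 h) x
      rw [frobForm_apply, frobForm_apply, ← frobPow_apply, ← frobPow_apply] at this
      exact (frobPow K E 1).toRingHom.injective this
    intro f hf
    obtain ⟨g, hg⟩ := Finite.surjective_of_injective hinj ⟨f, hf⟩
    exact ⟨g, g.2, Subtype.ext_iff.1 hg⟩
  let B := finBasis K X
  have hpow : ∀ (j : ℕ) (c : Fin (finrank K X) → E), (∀ f ∈ N, ∑ i, c i * f (B i) = 0) →
      ∀ f ∈ N, ∑ i, c i ^ Nat.card K ^ j * f (B i) = 0 := by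
    intro j
    induction j with
    | zero => intro c hc; simpa using hc
    | succ j ih =>
      intro c hc f hf
      obtain ⟨g, hg, rfl⟩ := hsurj f hf
      have h1 := congrArg (frobPow K E 1) (ih c hc g hg)
      rw [map_sum, map_zero] at h1
      rw [← h1]
      refine Finset.sum_congr rfl fun i _ => ?_
      rw [map_mul, frobPow_apply, frobPow_apply, frobForm_apply, ← pow_mul, ← pow_add]
  have hli : LinearIndependent E fun i => (LinearMap.applyₗ' E (B i) ∘ₗ N.subtype : N →ₗ[E] E) := by
    rw [Fintype.linearIndependent_iff]
    intro c hc
    have hc' : ∀ f ∈ N, ∑ i, c i * f (B i) = 0 := fun f hf => by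
      have := LinearMap.congr_fun hc ⟨f, hf⟩
      simpa using this
    have htr : ∀ lam : E, ∀ i, Algebra.trace K E (lam * c i) = 0 := by
      intro lam
      have hx : ∑ i, Algebra.trace K E (lam * c i) • B i = 0 := by
        refine hsep _ fun f hf => ?_
        rw [map_sum]
        calc _ = ∑ i, ∑ j ∈ Finset.range (finrank K E),
              lam ^ Nat.card K ^ j * (c i ^ Nat.card K ^ j * f (B i)) := by
              refine Finset.sum_congr rfl fun i _ => ?_
              rw [map_smul, Algebra.smul_def, FiniteField.algebraMap_trace_eq_sum_pow,
                Finset.sum_mul]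
              exact Finset.sum_congr rfl fun j _ => by rw [mul_pow, mul_assoc]
          _ = 0 := by
              rw [Finset.sum_comm]
              refine Finset.sum_eq_zero fun j _ => ?_
              rw [← Finset.mul_sum, hpow j c hc' f hf, mul_zero]
      exact Fintype.linearIndependent_iff.1 B.linearIndependent _ hx
    intro i
    by_contra hne
    refine Algebra.trace_ne_zero K E (LinearMap.ext fun z => ?_)
    have := htr (z * (c i)⁻¹) i
    rwa [inv_mul_cancel_right₀ hne] at this
  have h1 := hli.fintype_card_le_finrank
  rw [Fintype.card_fin] at h1
  exact h1.trans (Subspace.dual_finrank_eq (K := E) (V := N)).le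

omit [Finite E] in
/-- Vandermonde elimination with coefficients in a module. -/
theorem vandermonde_module {M ι : Type*} [AddCommGroup M] [Module E M] (J : Finset ι) (g : ι → E)
    (hg : ∀ i ∈ J, ∀ j ∈ J, g i = g j → i = j) (v : ι → M) (s : ℕ) (hs : J.card ≤ s)
    (h : ∀ l < s, ∑ j ∈ J, g j ^ l • v j = 0) : ∀ j ∈ J, v j = 0 := by
  classical
  open Polynomial in
  have hP : ∀ P : Polynomial E, P.natDegree < s → ∑ j ∈ J, P.eval (g j) • v j = 0 := by
    intro P hP
    calc _ = ∑ j ∈ J, ∑ l ∈ Finset.range s, P.coeff l • (g j ^ l • v j) := by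
          refine Finset.sum_congr rfl fun j _ => ?_
          rw [Polynomial.eval_eq_sum_range' hP, Finset.sum_smul]
          exact Finset.sum_congr rfl fun l _ => by rw [smul_smul]
      _ = 0 := by
          rw [Finset.sum_comm]
          refine Finset.sum_eq_zero fun l hl => ?_
          rw [← Finset.smul_sum, h l (Finset.mem_range.1 hl), smul_zero]
  intro j hj
  have h1 := hP (∏ i ∈ J.erase j, (Polynomial.X - Polynomial.C (g i))) (by
    rw [Polynomial.natDegree_prod_of_monic _ _ fun i _ => Polynomial.monic_X_sub_C _]
    simp only [Polynomial.natDegree_X_sub_C, Finset.sum_const, smul_eq_mul, mul_one]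
    have := Finset.card_erase_lt_of_mem hj
    omega)
  rw [Finset.sum_eq_single j] at h1
  · rw [Polynomial.eval_prod] at h1
    refine (smul_eq_zero.1 h1).resolve_left ?_
    refine Finset.prod_ne_zero_iff.2 fun i hi => ?_
    simp only [Polynomial.eval_sub, Polynomial.eval_X, Polynomial.eval_C]
    rw [sub_ne_zero]
    intro heq
    exact (Finset.mem_erase.1 hi).1 (hg _ hj _ (Finset.mem_of_mem_erase hi) heq).symm
  · intro i hi hne
    rw [Polynomial.eval_prod, Finset.prod_eq_zero (Finset.mem_erase.2 ⟨hne, hi⟩) (by simp),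
      zero_smul]
  · intro h; exact absurd hj h

omit [Finite E] in
/-- A family of vectors has at most as many pivots (vectors outside of the span of the later
vectors) as the dimension of its span. -/
theorem exists_pivots {M : Type*} [AddCommGroup M] [Module E M] [FiniteDimensional E M] (m : ℕ)
    (v : ℕ → M) : ∃ J : Finset ℕ, J ⊆ Finset.range m ∧
      J.card ≤ finrank E (Submodule.span E (v '' Set.Iio m)) ∧
      ∀ j < m, j ∉ J → v j ∈ Submodule.span E (v '' Set.Ioo j m) := by
  classical
  have key : ∀ r ≤ m, ∃ J : Finset ℕ, J ⊆ Finset.range m ∧ (∀ j ∈ J, m - r ≤ j) ∧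
      J.card ≤ finrank E (Submodule.span E (v '' Set.Ico (m - r) m)) ∧
      ∀ j < m, m - r ≤ j → j ∉ J → v j ∈ Submodule.span E (v '' Set.Ioo j m) := by
    intro r
    induction r with
    | zero => exact fun _ => ⟨∅, by simp, by simp, by simp, fun j _ _ _ => by omega⟩
    | succ r ih =>
      intro hr
      obtain ⟨J, h1, h2, h3, h4⟩ := ih (by omega)
      obtain ⟨i, hi⟩ : ∃ i, m - r = i + 1 := ⟨m - r - 1, by omega⟩
      have hi' : m - (r + 1) = i := by omega
      rw [hi'] at *
      rw [hi] at h2 h3 h4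
      have hmono : Submodule.span E (v '' Set.Ico (i + 1) m) ≤
          Submodule.span E (v '' Set.Ico i m) := by
        refine Submodule.span_mono (Set.image_mono fun j hj => ?_)
        rw [Set.mem_Ico] at *
        omega
      have hIoo : Set.Ioo i m = Set.Ico (i + 1) m := by
        ext j
        simp only [Set.mem_Ioo, Set.mem_Ico]
        omega
      by_cases hv : v i ∈ Submodule.span E (v '' Set.Ico (i + 1) m)
      · refine ⟨J, h1, fun j hj => by have := h2 j hj; omega,
          h3.trans (Submodule.finrank_mono hmono), fun j hj hij hJ => ?_⟩
        rcases Nat.eq_or_lt_of_le hij with rfl | hlt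
        · rwa [hIoo]
        · exact h4 j hj hlt hJ
      · refine ⟨insert i J, ?_, ?_, ?_, fun j hj hij hJ => ?_⟩
        · exact Finset.insert_subset (Finset.mem_range.2 (by omega)) h1
        · intro j hj
          rcases Finset.mem_insert.1 hj with rfl | hj
          · exact le_rfl
          · have := h2 j hj; omega
        · refine (Finset.card_insert_le _ _).trans ?_
          have hlt : Submodule.span E (v '' Set.Ico (i + 1) m) <
              Submodule.span E (v '' Set.Ico i m) :=
            lt_of_le_of_ne hmono fun h => hv (by
              rw [h]
              exact Submodule.subset_span ⟨i, Set.mem_Ico.2 (by omega), rfl⟩)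
          have := Submodule.finrank_lt_finrank_of_lt hlt
          omega
        · rw [Finset.mem_insert, not_or] at hJ
          exact h4 j hj (by omega) hJ.2
  obtain ⟨J, h1, _, h3, h4⟩ := key m le_rfl
  rw [Nat.sub_self] at h3 h4
  refine ⟨J, h1, ?_, fun j hj hJ => h4 j hj (Nat.zero_le _) hJ⟩
  rwa [show Set.Iio m = Set.Ico 0 m by ext j; simp]

/-- The equations `∑ j, g_j ^ (l + 1) * φ_j ^ (q ^ j) = 0` for `l < s` cut a space on which the
forms `φ_j` span a space of dimension `d ≤ s` over `E` down to dimension `d * m` over `K`.  Modulo the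
powers `φ_j ^ (q ^ a)` with `a < j`, only the at most `d` pivots among the forms contribute to the
equations, and these can be solved for `φ_j ^ (q ^ j)` by a Vandermonde argument.  Hence the powers
with `a < j < m` span a Frobenius stable space. -/
theorem finrank_le_of_linearized_equations [Finite K] {m d s : ℕ} (hds : d ≤ s)
    (φ : ℕ → X →ₗ[K] E) (g : ℕ → E) (hg0 : ∀ j < m, g j ≠ 0)
    (hg : ∀ i < m, ∀ j < m, g i = g j → i = j)
    (hsep : ∀ x, (∀ j < m, φ j x = 0) → x = 0)
    (hd : finrank E (Submodule.span E (φ '' Set.Iio m)) = d)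
    (heq : ∀ l < s, ∀ x, ∑ j ∈ Finset.range m, g j ^ (l + 1) * φ j x ^ Nat.card K ^ j = 0) :
    finrank K X ≤ d * m := by
  have hfin : Finite (X →ₗ[K] E) := Finite.of_injective _ DFunLike.coe_injective
  obtain ⟨J, hJm, hJd, hJ⟩ := exists_pivots (E := E) m φ
  -- the Frobenius powers below the diagonal; the equations put the diagonal into their span
  let N : Submodule E (X →ₗ[K] E) :=
    Submodule.span E {f | ∃ j < m, ∃ a < j, f = frobForm a (φ j)}
  have hnotJ : ∀ j < m, j ∉ J → frobForm j (φ j) ∈ N := by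
    intro j hj hj'
    have h1 := frobForm_mem_span j _ (hJ j hj hj')
    refine Submodule.span_mono ?_ h1
    rintro _ ⟨_, ⟨i, hi, rfl⟩, rfl⟩
    exact ⟨i, hi.2, j, hi.1, rfl⟩
  have hdiag : ∀ j < m, frobForm j (φ j) ∈ N := by
    intro j hj
    by_cases hj' : j ∈ J
    · have hJlt : ∀ i ∈ J, i < m := fun i hi => Finset.mem_range.1 (hJm hi)
      have h1 := vandermonde_module J g (fun i hi i' hi' => hg i (hJlt i hi) i' (hJlt i' hi'))
        (fun i => g i • N.mkQ (frobForm i (φ i))) s (by omega) ?_ j hj'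
      · have := (smul_eq_zero.1 h1).resolve_left (hg0 j hj)
        rwa [Submodule.mkQ_apply, Submodule.Quotient.mk_eq_zero] at this
      · intro l hl
        have h2 : ∑ i ∈ Finset.range m, g i ^ (l + 1) • frobForm i (φ i) = 0 := by
          ext x
          rw [LinearMap.sum_apply]
          simpa [frobForm_apply] using heq l hl x
        have h3 := congrArg N.mkQ h2
        rw [map_sum, map_zero, ← Finset.sum_subset hJm] at h3
        · rw [← h3]
          refine Finset.sum_congr rfl fun i _ => ?_
          rw [map_smul, smul_smul, pow_succ]
        · intro i hi hi'
          rw [map_smul, Submodule.mkQ_apply,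
            (Submodule.Quotient.mk_eq_zero N).2 (hnotJ i (Finset.mem_range.1 hi) hi'), smul_zero]
    · exact hnotJ j hj hj'
  have hstab : ∀ f ∈ N, frobForm 1 f ∈ N := by
    intro f hf
    have h1 := frobForm_mem_span 1 _ hf
    refine Submodule.span_le.2 ?_ h1
    rintro _ ⟨_, ⟨j, hj, a, ha, rfl⟩, rfl⟩
    rw [SetLike.mem_coe, frobForm_frobForm]
    rcases Nat.lt_or_ge (a + 1) j with h | h
    · exact Submodule.subset_span ⟨j, hj, a + 1, h, rfl⟩
    · rw [show a + 1 = j by omega]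
      exact hdiag j hj
  have hmem : ∀ j < m, φ j ∈ N := by
    intro j hj
    have h0 : frobForm 0 (φ j) = φ j := by
      ext x
      simp [frobForm_apply]
    rcases Nat.eq_zero_or_pos j with rfl | h
    · rw [← h0]; exact hdiag 0 hj
    · exact Submodule.subset_span ⟨j, hj, 0, h, h0.symm⟩
  refine (finrank_le_of_frob_stable N hstab fun x hx => hsep x fun j hj =>
    hx _ (hmem j hj)).trans ?_
  -- `N` is spanned by the Frobenius powers of a basis of the span of the forms
  have : Module.Free E (Submodule.span E (φ '' Set.Iio m)) :=
    Module.Free.of_divisionRing E ↥(Submodule.span E (φ '' Set.Iio m))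
  let B := finBasis E (Submodule.span E (φ '' Set.Iio m))
  let w : Fin (finrank E (Submodule.span E (φ '' Set.Iio m))) × Fin m → X →ₗ[K] E :=
    fun z => frobForm (z.2 : ℕ) (B z.1 : X →ₗ[K] E)
  have hN : N ≤ Submodule.span E (Set.range w) := by
    refine Submodule.span_le.2 ?_
    rintro _ ⟨j, hj, a, ha, rfl⟩
    have h1 : φ j ∈ Submodule.span E (Set.range fun i => (B i : X →ₗ[K] E)) := by
      have h2 : (⟨φ j, Submodule.subset_span ⟨j, hj, rfl⟩⟩ : Submodule.span E (φ '' Set.Iio m)) ∈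
          Submodule.span E (Set.range B) := by rw [B.span_eq]; trivial
      have h3 := Submodule.mem_map_of_mem (f := Submodule.subtype _) h2
      rw [Submodule.map_span, ← Set.range_comp] at h3
      exact h3
    refine Submodule.span_mono ?_ (frobForm_mem_span a _ h1)
    rintro _ ⟨_, ⟨i, rfl⟩, rfl⟩
    exact ⟨(i, ⟨a, by omega⟩), rfl⟩
  refine (Submodule.finrank_mono hN).trans ((finrank_range_le_card w).trans ?_)
  rw [Fintype.card_prod, Fintype.card_fin, Fintype.card_fin, hd]

end

/-! ### Correctness of the computation of the subfields and of the subspace design -/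

section
variable {p N : ℕ} [Fact p.Prime] {L : Type*} [Field L] [Algebra (ZMod p) L]
  (b : Basis (Fin N) (ZMod p) L)

/-- Kernels of additive maps on a list of field elements, regarded as vectors of length one. -/
theorem kerBy_crd (us : List (L → L)) (hus : ∀ u ∈ us, ∀ x y, u (x + y) = u x + u y) {l : List L}
    (hl : LIList (ZMod p) l) (g : List ℕ → List (List ℕ))
    (hg : ∀ x ∈ l, g (crd b x) = us.map fun u => crd b (u x)) :
    ∃ l' : List L, (kerBy p ((l.map (crd b)).map fun x => ((g x).flatten, [x]))).map
        (fun v => v.headD []) = l'.map (crd b) ∧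
      LIList (ZMod p) l' ∧
      ∀ y, y ∈ spanL (ZMod p) l' ↔ y ∈ spanL (ZMod p) l ∧ ∀ u ∈ us, u y = 0 := by
  let T : L →ₗ[ZMod p] (Fin 1 → L) := LinearMap.pi fun _ => LinearMap.id
  let S : (Fin 1 → L) →ₗ[ZMod p] L := LinearMap.proj 0
  have hST : ∀ v, T (S v) = v := fun v => funext fun i => by rw [Subsingleton.elim i 0]; rfl
  obtain ⟨l', h1, h2, h3⟩ := kerBy_spec b (us.map fun u v => u (v 0))
    (by
      simp only [List.mem_map, forall_exists_index, and_imp, forall_apply_eq_imp_iff₂]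
      exact fun u hu x y => hus u hu _ _) (l := l.map T)
    (hl.map fun x _ hx => congrFun hx 0) (fun v => g (v.headD []))
    (by
      simp only [List.mem_map, forall_exists_index, and_imp, forall_apply_eq_imp_iff₂,
        List.map_map]
      exact fun x hx => hg x hx)
  refine ⟨l'.map S, ?_, h2.map fun v _ hv => by rw [← hST v, hv, map_zero], fun y => ?_⟩
  · have h4 : ((l.map T).map (rep b)).map (fun v => ((g (v.headD [])).flatten, v)) =
        (l.map (crd b)).map fun x => ((g x).flatten, [x]) := by
      rw [List.map_map, List.map_map, List.map_map]
      rfl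
    rw [← h4, h1, List.map_map, List.map_map]
    rfl
  · have h5 : y ∈ spanL (ZMod p) (l'.map S) ↔ T y ∈ spanL (ZMod p) l' := by
      rw [spanL_map]
      constructor
      · rintro ⟨v, hv, rfl⟩
        rwa [hST]
      · exact fun h => ⟨T y, h, rfl⟩
    rw [h5, h3]
    refine and_congr ?_ ?_
    · rw [spanL_map]
      constructor
      · rintro ⟨x, hx, hxy⟩
        obtain rfl : x = y := congrFun hxy 0
        exact hx
      · exact fun h => ⟨y, h, rfl⟩
    · simp only [List.mem_map, forall_exists_index, and_imp, forall_apply_eq_imp_iff₂]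
      rfl

theorem stdL_spec : ∃ l : List L, stdL (tbl b) = l.map (crd b) ∧ LIList (ZMod p) l ∧
    spanL (ZMod p) l = ⊤ := by
  have h1 : spanL (ZMod p) (List.ofFn b) = ⊤ := by
    rw [spanL, ← b.span_eq]
    congr 1
    ext x
    simp [List.mem_ofFn]
  refine ⟨List.ofFn b, ?_, liList_of_length_eq h1 ?_, h1⟩
  · rw [stdL_tbl, List.map_ofFn]
    rfl
  · rw [finrank_eq_card_basis b]
    simp

theorem sub_crd (x y : L) : lin p 1 (crd b x) (p - 1) (crd b y) = crd b (x - y) := by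
  rw [lin_crd, Nat.cast_sub (Fact.out : p.Prime).one_lt.le]
  simp [sub_eq_add_neg]

theorem fixV_spec {e : ℕ} (he : e ≠ 0) (hadd : ∀ x y : L, (x + y) ^ e = x ^ e + y ^ e) :
    ∃ l : List L, fixV p (tbl b) e = l.map (crd b) ∧ LIList (ZMod p) l ∧
      ∀ x, x ∈ spanL (ZMod p) l ↔ x ^ e = x := by
  obtain ⟨l, h1, h2, h3⟩ := stdL_spec b
  obtain ⟨l', h4, h5, h6⟩ := kerBy_crd b [fun x => x ^ e - x]
    (by simp only [List.mem_singleton, forall_eq]; intro x y; rw [hadd]; ring) h2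
    (fun x => [lin p 1 (powV p (tbl b) x e) (p - 1) x])
    (fun x _ => by rw [powV_crd b x he, sub_crd]; rfl)
  refine ⟨l', ?_, h5, fun x => ?_⟩
  · rw [← h4, fixV, h1]
    simp only [List.flatten_cons, List.flatten_nil, List.append_nil]
  · rw [h6, h3]
    simp [sub_eq_zero]

variable {K : Type*} [Field K] [Algebra K L]

theorem greedy_crd {F : List L} (hF : ∀ x, x ∈ spanL (ZMod p) F ↔ ∃ k : K, algebraMap K L k = x)
    (hN : 1 ≤ N) (l : List L) :
    ∃ l' : List L,
      (greedy p (tbl b) (F.map (crd b)) 1 ((l.map (crd b)).map fun x => [x])).map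
        (fun v => v.headD []) = l'.map (crd b) ∧
      LIList K l' ∧ spanL K l' = spanL K l := by
  let T : L →ₗ[K] (Fin 1 → L) := LinearMap.pi fun _ => LinearMap.id
  let S : (Fin 1 → L) →ₗ[K] L := LinearMap.proj 0
  have hST : ∀ v, T (S v) = v := fun v => funext fun i => by rw [Subsingleton.elim i 0]; rfl
  obtain ⟨l', h1, h2, h3⟩ := greedy_spec b hF hN (l.map T)
  refine ⟨l'.map S, ?_, h2.map fun v _ hv => by rw [← hST v, hv, map_zero], ?_⟩
  · have h4 : (l.map T).map (rep b) = (l.map (crd b)).map fun x => [x] := by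
      rw [List.map_map, List.map_map]
      rfl
    rw [← h4, h1, List.map_map, List.map_map]
    rfl
  · rw [spanL_map, h3, spanL_map, ← Submodule.map_comp]
    exact Submodule.map_id _

theorem lowOrder_spec {M : ℕ} (hM : 2 ≤ M) (hMN : M ≤ N) (x : L) :
    lowOrder p (tbl b) M (crd b x) = 0 ↔ x ≠ 0 ∧ ∀ e, 1 ≤ e → e < M → x ^ e ≠ 1 := by
  have key : ∀ (l : List ℕ) (acc : ℕ), l.foldl (fun acc e =>
      ifz (nonzero (lin p 1 (powV p (tbl b) (crd b x) (e + 2)) (p - 1) (crd b x))) 1 acc) acc = 0 ↔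
        acc = 0 ∧ ∀ e ∈ l, x ^ (e + 2) ≠ x := by
    intro l
    induction l with
    | nil => simp
    | cons e l ih =>
      intro acc
      rw [List.foldl_cons, ih, powV_crd b x (by omega), sub_crd, ifz]
      have h1 : nonzero (crd b (x ^ (e + 2) - x)) = 0 ↔ x ^ (e + 2) = x := by
        rw [nonzero_crd, sub_eq_zero]
      split_ifs with h
      · simp [h1.1 h]
      · have h2 : x ^ (e + 2) ≠ x := fun h' => h (h1.2 h')
        simp [h2]
  rw [lowOrder, rg_eq (by rw [length_tbl]; omega), key]
  simp only [true_and, List.mem_range]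
  constructor
  · intro h
    have h0 : x ≠ 0 := by
      rintro rfl
      exact h 0 (by omega) (by simp)
    refine ⟨h0, fun e he heM h1 => h (e - 1) (by omega) ?_⟩
    rw [show e - 1 + 2 = e + 1 by omega, pow_succ, h1, one_mul]
  · rintro ⟨h0, h⟩ e he h1
    refine h (e + 1) (by omega) (by omega) ?_
    have h2 : x ^ (e + 1) * x = 1 * x := by rw [← pow_succ, h1, one_mul]
    exact mul_right_cancel₀ h0 h2

/-- There are few elements of low order: they are roots of `X ^ e - 1` with `e < M`, or zero. -/
theorem length_le_of_lowOrder {M : ℕ} (hM : 2 ≤ M) (l : List L) (hl : l.Nodup)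
    (h : ∀ x ∈ l, ¬ (x ≠ 0 ∧ ∀ e, 1 ≤ e → e < M → x ^ e ≠ 1)) : l.length ≤ M * M := by
  classical
  rw [← List.toFinset_card_of_nodup hl]
  have hsub : l.toFinset ⊆ {0} ∪ (Finset.Ico 1 M).biUnion fun e =>
      (Polynomial.nthRoots e (1 : L)).toFinset := by
    intro x hx
    have := h x (List.mem_toFinset.1 hx)
    rw [Finset.mem_union, Finset.mem_singleton, Finset.mem_biUnion]
    by_contra hcon
    rw [not_or] at hcon
    refine this ⟨hcon.1, fun e he heM h1 => hcon.2 ⟨e, Finset.mem_Ico.2 ⟨he, heM⟩, ?_⟩⟩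
    rw [Multiset.mem_toFinset, Polynomial.mem_nthRoots (by omega)]
    exact h1
  refine (Finset.card_le_card hsub).trans ((Finset.card_union_le _ _).trans ?_)
  have h2 : ((Finset.Ico 1 M).biUnion fun e => (Polynomial.nthRoots e (1 : L)).toFinset).card ≤
      ∑ _e ∈ Finset.Ico 1 M, M := by
    refine Finset.card_biUnion_le.trans (Finset.sum_le_sum fun e he => ?_)
    refine (Multiset.toFinset_card_le _).trans ((Polynomial.card_nthRoots e 1).trans ?_)
    exact (Finset.mem_Ico.1 he).2.le
  rw [Finset.sum_const, Nat.card_Ico, smul_eq_mul] at h2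
  rw [Finset.card_singleton]
  obtain ⟨M, rfl⟩ : ∃ M', M = M' + 2 := ⟨M - 2, by omega⟩
  have h3 : M + 2 - 1 = M + 1 := by omega
  rw [h3] at h2
  have h4 : (M + 2) * (M + 2) = (M + 1) * (M + 2) + (M + 2) := by ring
  omega

theorem cands_spec {B : List L} (hB : LIList (ZMod p) B) :
    ∃ l : List L, cands p (tbl b) (B.map (crd b)) = l.map (crd b) ∧ l.Nodup ∧
      (∀ x ∈ l, x ∈ spanL (ZMod p) B) ∧ l.length = min (N * N + 1) (2 ^ B.length) := by
  induction B using List.reverseRecOn with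
  | nil => exact ⟨[0], by simp [cands, zeroV_tbl], by simp, by simp, by simp⟩
  | append_singleton B v ih =>
    have h0 : v ∉ spanL (ZMod p) B ∧ LIList (ZMod p) B :=
      liList_cons.1 (hB.perm (List.perm_append_singleton v B))
    obtain ⟨l, h1, h2, h3, h4⟩ := ih h0.2
    refine ⟨(l ++ l.map fun x => x + v).take (N * N + 1), ?_, ?_, ?_, ?_⟩
    · rw [cands, List.map_append, List.foldl_append]
      change List.foldl _ (cands p (tbl b) (B.map (crd b))) _ = _
      rw [h1]
      simp only [List.map_cons, List.map_nil, List.foldl_cons, List.foldl_nil, length_tbl,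
        List.map_take, List.map_append, List.map_map]
      congr 2
      refine List.map_congr_left fun x _ => ?_
      simp [lin_crd]
    · refine List.Nodup.sublist (List.take_sublist _ _) (List.Nodup.append h2
        (h2.map fun x y hxy => add_right_cancel hxy) ?_)
      intro x hx hx'
      obtain ⟨y, hy, rfl⟩ := List.mem_map.1 hx'
      refine h0.1 ?_
      have := sub_mem (h3 _ hx) (h3 _ hy)
      simpa using this
    · intro x hx
      rw [spanL_append]
      rcases List.mem_append.1 (List.mem_of_mem_take hx) with hx | hx
      · exact Submodule.mem_sup_left (h3 _ hx)
      · obtain ⟨y, hy, rfl⟩ := List.mem_map.1 hx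
        exact add_mem (Submodule.mem_sup_left (h3 _ hy))
          (Submodule.mem_sup_right (mem_spanL_of_mem (List.mem_singleton_self v)))
    · rw [List.length_take, List.length_append, List.length_map, h4, List.length_append,
        List.length_singleton, pow_succ]
      omega

end

/-! ### The spaces of the design and their bases -/

section
variable {p N : ℕ} [Fact p.Prime] {K E L : Type*} [Field K] [Field E] [Field L] [Finite K]
  [Finite E] [Finite L] [Algebra K E] [Algebra E L] [Algebra K L] [IsScalarTower K E L]
  [Algebra (ZMod p) L] (b : Basis (Fin N) (ZMod p) L)

/-- The parameters of the algorithms, for given fields. -/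
noncomputable def fieldCtx (K : Type*) (n k m s : ℕ) : Ctx :=
  ⟨p, tbl b, Nat.card K, n, k, m, s⟩

/-- The parity checks of the subspace design: evaluations of the coordinates, taken as a
polynomial over `E`, at powers of `γ`, and linearized equations. -/
def designSpace (K : Type*) {E L : Type*} [Field K] [Field E] [Field L] [Finite K] [Algebra K E]
    [Algebra E L] [Algebra K L] [IsScalarTower K E L] {m : ℕ} (e : Fin m → L) (γ : E) (s i : ℕ) :
    Submodule K L where
  carrier := {x | (∀ l < 2 * s, ∑ j : Fin m,
      γ ^ ((2 * s * i + l + 1) * ((j : ℕ) + 1)) * Algebra.trace E L (e j * x) = 0) ∧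
    ∀ l < s, ∑ j : Fin m,
      γ ^ ((l + 1) * ((j : ℕ) + 1)) * Algebra.trace E L (e j * x) ^ Nat.card K ^ (j : ℕ) = 0}
  add_mem' := by
    rintro x y ⟨hx, hx'⟩ ⟨hy, hy'⟩
    constructor
    · intro l hl
      simp only [mul_add (e _), map_add, mul_add (γ ^ _), Finset.sum_add_distrib, hx l hl, hy l hl,
        add_zero]
    · intro l hl
      simp only [mul_add (e _), map_add, add_pow_card_pow, mul_add (γ ^ _), Finset.sum_add_distrib,
        hx' l hl, hy' l hl, add_zero]
  zero_mem' := by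
    refine ⟨fun l _ => by simp, fun l _ => ?_⟩
    refine Finset.sum_eq_zero fun j _ => ?_
    rw [mul_zero, map_zero, zero_pow (pow_ne_zero _ Nat.card_pos.ne'), mul_zero]
  smul_mem' := by
    rintro c x ⟨hx, hx'⟩
    have hc : ∀ y : L, Algebra.trace E L (y * c • x) =
        algebraMap K E c * Algebra.trace E L (y * x) := by
      intro y
      rw [mul_smul_comm, ← algebraMap_smul E c, map_smul, smul_eq_mul]
    constructor
    · intro l hl
      simp only [hc, mul_left_comm _ (algebraMap K E c), ← Finset.mul_sum, hx l hl, mul_zero]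
    · intro l hl
      simp only [hc, mul_pow, algebraMap_pow_card_pow, mul_left_comm _ (algebraMap K E c),
        ← Finset.mul_sum, hx' l hl, mul_zero]

omit [Finite K] in
theorem card_eq_card_pow (n : ℕ) (hn : finrank K E = n) : Nat.card E = Nat.card K ^ n := by
  rw [Module.natCard_eq_pow_finrank (K := K) (V := E), hn]

omit [IsScalarTower K E L] in
theorem mul_le_length (b : Basis (Fin N) (ZMod p) L) {n m : ℕ} (hn : finrank K E = n)
    (hm : finrank E L = m) : n * m ≤ N := by
  have h1 : Nat.card L = p ^ N := by
    have := Module.finite_of_finite (ZMod p) (M := L)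
    rw [Module.natCard_eq_pow_finrank (K := ZMod p) (V := L), finrank_eq_card_basis b]
    simp
  have h2 : Nat.card L = Nat.card K ^ (n * m) := by
    rw [Module.natCard_eq_pow_finrank (K := E) (V := L), card_eq_card_pow n hn, hm, pow_mul]
  obtain ⟨r, hr⟩ : ∃ r : ℕ, Nat.card K = p ^ r := by
    have h3 : Nat.card K ∣ p ^ N := by
      rw [← h1, Module.natCard_eq_pow_finrank (K := K) (V := L)]
      exact dvd_pow_self _ Module.finrank_pos.ne'
    obtain ⟨r, _, hr⟩ := (Nat.dvd_prime_pow Fact.out).1 h3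
    exact ⟨r, hr⟩
  rw [h1, hr, ← pow_mul] at h2
  have h4 := Nat.pow_right_injective (Fact.out : p.Prime).two_le h2
  have h5 : r ≠ 0 := by
    rintro rfl
    have := Finite.one_lt_card (α := K)
    rw [hr, pow_zero] at this
    omega
  rw [h4]
  exact Nat.le_mul_of_pos_left _ (Nat.pos_of_ne_zero h5)

omit [Finite L] in
theorem fixV_subfield (F : Type*) [Field F] [Finite F] [Algebra F L] :
    ∃ l : List L, fixV p (tbl b) (Nat.card F) = l.map (crd b) ∧ LIList (ZMod p) l ∧
      ∀ x, x ∈ spanL (ZMod p) l ↔ ∃ c : F, algebraMap F L c = x := by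
  obtain ⟨l, h1, h2, h3⟩ := fixV_spec b (e := Nat.card F) Nat.card_pos.ne' fun x y => by
    simpa using add_pow_card_pow F 1 x y
  exact ⟨l, h1, h2, fun x => by rw [h3, pow_card_eq_self_iff]⟩

section
variable {n k m s : ℕ}

omit [IsScalarTower K E L] [Finite K] [Finite L] [Algebra K L] in
theorem midBasis_spec (h1 : n ≤ N) (hn : finrank K E = n) :
    ∃ l : List L, midBasis (fieldCtx b K n k m s) = l.map (crd b) ∧
    LIList (ZMod p) l ∧ ∀ x, x ∈ spanL (ZMod p) l ↔ ∃ c : E, algebraMap E L c = x := by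
  rw [midBasis, fieldCtx]
  simp only [length_tbl]
  rw [min_eq_left h1, ← card_eq_card_pow (E := E) n hn]
  exact fixV_subfield b E

omit [IsScalarTower K E L] [Finite K] [Finite L] [Algebra K L] in
theorem topBasis_spec (h1 : n ≤ N) (hN : 1 ≤ N) (hn : finrank K E = n) (hm : finrank E L = m) :
    ∃ e : Basis (Fin m) E L,
      topBasis (fieldCtx b K n k m s) = List.ofFn fun j => crd b (e j) := by
  obtain ⟨F, hF1, -, hF2⟩ := midBasis_spec (E := E) (k := k) (m := m) (s := s) b h1 hn
  obtain ⟨l, hl1, -, hl2⟩ := stdL_spec b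
  obtain ⟨l', h3, h4, h5⟩ := greedy_crd b hF2 hN l
  have h6 : spanL E l' = ⊤ := by
    rw [h5, eq_top_iff]
    intro x _
    have hx : x ∈ spanL (ZMod p) l := hl2 ▸ Submodule.mem_top
    let U : Submodule (ZMod p) L := AddSubgroup.toZModSubmodule p (spanL E l).toAddSubgroup
    have : spanL (ZMod p) l ≤ U := spanL_le.2 fun y hy => by
      change y ∈ spanL E l
      exact mem_spanL_of_mem hy
    exact this hx
  rw [spanL_eq_range] at h6
  let e : Basis (Fin l'.length) E L := Basis.mk h4 h6.ge
  have hlen : l'.length = m := by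
    rw [← hm, finrank_eq_card_basis e, Fintype.card_fin]
  subst hlen
  refine ⟨e, ?_⟩
  have h7 : topBasis (fieldCtx b K n k l'.length s) = l'.map (crd b) := by
    rw [← h3, topBasis]
    change (greedy p (tbl b) (midBasis (fieldCtx b K n k l'.length s)) 1
      ((stdL (tbl b)).map fun x => [x])).map _ = _
    rw [← hl1, ← hF1]
  rw [h7]
  apply List.ext_getElem
  · simp
  · intro i h8 h9
    rw [List.getElem_map, List.getElem_ofFn]
    exact congrArg (crd b) (Basis.mk_apply h4 h6.ge _).symm

omit [Finite L] [Algebra K L] in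
theorem frob_spec {j : ℕ} (hj : j ≤ N) (x : L) :
    frob (fieldCtx b K n k m s) j (crd b x) = crd b (x ^ Nat.card K ^ j) := by
  rw [frob, fieldCtx]
  simp only [length_tbl]
  rw [min_eq_left hj, powV_crd b x (pow_ne_zero _ Nat.card_pos.ne')]

omit [Finite L] in
theorem vsum_ofFn' {r : ℕ} (f : ℕ → L) :
    vsum p (tbl b) ((List.range r).map fun i => crd b (f i)) =
      crd b (∑ i ∈ Finset.range r, f i) := by
  rw [map_range_eq_ofFn, vsum_ofFn, Finset.sum_range]

omit [IsScalarTower K E L] [Algebra K L] in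
theorem traceV_spec (hm1 : m ≤ N) (hnm : n * m ≤ N) (hn : finrank K E = n) (hm : finrank E L = m)
    (x : L) :
    traceV (fieldCtx b K n k m s) (crd b x) = crd b (algebraMap E L (Algebra.trace E L x)) := by
  rw [FiniteField.algebraMap_trace_eq_sum_pow, hm, ← vsum_ofFn', traceV]
  change vsum p (tbl b) ((rg (tbl b) m).map _) = _
  rw [rg_eq (by rw [length_tbl]; omega)]
  congr 1
  refine List.map_congr_left fun u hu => ?_
  rw [List.mem_range] at hu
  change frob _ (n * u) _ = _
  rw [frob_spec b ((Nat.mul_le_mul_left n hu.le).trans hnm), pow_mul,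
    ← card_eq_card_pow (E := E) n hn]

omit [IsScalarTower K E L] [Algebra K L] in
theorem coordV_spec (hm1 : m ≤ N) (hnm : n * m ≤ N) (hn : finrank K E = n) (hm : finrank E L = m)
    (e : Fin m → L) (x : L) :
    coordV (fieldCtx b K n k m s) (List.ofFn fun j => crd b (e j)) (crd b x) =
      List.ofFn fun j => crd b (algebraMap E L (Algebra.trace E L (e j * x))) := by
  rw [coordV, List.map_ofFn]
  congr 1
  funext j
  simp only [Function.comp]
  change traceV _ (mulV p (tbl b) _ _) = _
  rw [mulV_crd, traceV_spec (E := E) b hm1 hnm hn hm]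

omit [IsScalarTower K E L] [Algebra K L] in
theorem checkV_spec (hm1 : m ≤ N) (hnm : n * m ≤ N) (hsN : 2 * s ≤ N) (hn : finrank K E = n)
    (hm : finrank E L = m) (e : Fin m → L) (γ : E) (i : ℕ) (x : L) :
    checkV (fieldCtx b K n k m s) (List.ofFn fun j => crd b (e j)) (crd b (algebraMap E L γ)) i
        (crd b x) =
      ((List.range (2 * s)).map (fun l (x : L) => algebraMap E L (∑ j : Fin m,
        γ ^ ((2 * s * i + l + 1) * ((j : ℕ) + 1)) * Algebra.trace E L (e j * x))) ++
      (List.range s).map (fun l (x : L) => algebraMap E L (∑ j : Fin m,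
        γ ^ ((l + 1) * ((j : ℕ) + 1)) * Algebra.trace E L (e j * x) ^ Nat.card K ^ (j : ℕ)))).map
      fun u => crd b (u x) := by
  rw [checkV, coordV_spec (E := E) b hm1 hnm hn hm, List.map_append, List.map_map, List.map_map]
  have hrg : ∀ j ≤ N, rg (tbl b) j = List.range j := fun j hj => rg_eq (by rwa [length_tbl])
  change List.map _ (rg (tbl b) (2 * s)) ++ List.map _ (rg (tbl b) s) = _
  rw [hrg (2 * s) hsN, hrg s (by omega)]
  congr 1
  · refine List.map_congr_left fun l _ => ?_
    change dotL p (tbl b) ((rg (tbl b) m).map fun j =>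
      powV p (tbl b) (crd b (algebraMap E L γ)) ((2 * s * i + l + 1) * (j + 1))) _ = _
    rw [hrg m hm1, map_range_eq_ofFn]
    simp only [powV_crd b _ (mul_ne_zero (Nat.succ_ne_zero _) (Nat.succ_ne_zero _))]
    rw [dotL_ofFn]
    simp
  · refine List.map_congr_left fun l _ => ?_
    change dotL p (tbl b) ((rg (tbl b) m).map fun j =>
      powV p (tbl b) (crd b (algebraMap E L γ)) ((l + 1) * (j + 1)))
      (((rg (tbl b) m).zip _).map _) = _
    have h1 : List.range m = List.ofFn fun j : Fin m => (j : ℕ) := by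
      rw [← map_range_eq_ofFn m fun j => j, List.map_id']
    rw [hrg m hm1, map_range_eq_ofFn, h1, zip_ofFn, List.map_ofFn]
    simp only [powV_crd b _ (mul_ne_zero (Nat.succ_ne_zero _) (Nat.succ_ne_zero _)),
      Function.comp_def]
    have h2 : ∀ (j : Fin m) (z : L), frob (fieldCtx b K n k m s) j (crd b z) =
        crd b (z ^ Nat.card K ^ (j : ℕ)) := fun j z => frob_spec b (j.2.le.trans hm1) z
    simp only [h2]
    rw [dotL_ofFn]
    simp

/-- What the construction computes: either the design given by an element `γ` of large order, or
the whole space, which happens only for small `n`. -/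
theorem designV_spec (hm1 : 2 ≤ m) (hn1 : 1 ≤ n) (hnm : n * m ≤ N) (hsm : 2 * s ≤ m)
    (hn : finrank K E = n) (hm : finrank E L = m) :
    ∃ H : ℕ → Submodule K L,
      (∀ i, ∃ l : List L, designV (fieldCtx b K n k m s) i = l.map (crd b) ∧ LIList (ZMod p) l ∧
        ∀ x, x ∈ spanL (ZMod p) l ↔ x ∈ H i) ∧
      (((∀ i, H i = ⊤) ∧ 2 ^ n ≤ (n * m) * (n * m)) ∨
        ∃ (e : Basis (Fin m) E L) (γ : E), γ ≠ 0 ∧ (∀ j, 1 ≤ j → j < n * m → γ ^ j ≠ 1) ∧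
          ∀ i, H i = designSpace K e γ s i) := by
  have h1 : m ≤ n * m := Nat.le_mul_of_pos_left _ hn1
  have h2 : n ≤ n * m := Nat.le_mul_of_pos_right _ (by omega)
  have hnN : n ≤ N := h2.trans hnm
  obtain ⟨F, hF1, hF2, hF3⟩ := midBasis_spec (E := E) (k := k) (m := m) (s := s) b hnN hn
  obtain ⟨cs, hc1, hc2, hc3, hc4⟩ := cands_spec b hF2
  obtain ⟨std, hs1, hs2, hs3⟩ := stdL_spec b
  have hg : gammas (fieldCtx b K n k m s) = (cs.flatMap fun x =>
      if lowOrder p (tbl b) (n * m) (crd b x) = 0 then [x] else []).map (crd b) := by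
    rw [gammas]
    change (cands p (tbl b) (midBasis (fieldCtx b K n k m s))).flatMap _ = _
    rw [hF1, hc1, List.flatMap_map, List.map_flatMap]
    congr 1
    funext x
    change ifz (lowOrder p (tbl b) (n * m) (crd b x)) [crd b x] [] = _
    unfold ifz
    split_ifs <;> rfl
  cases hgs : cs.flatMap fun x => if lowOrder p (tbl b) (n * m) (crd b x) = 0 then [x] else [] with
  | nil =>
    rw [hgs] at hg
    refine ⟨fun _ => ⊤, fun i => ⟨std, ?_, hs2, fun x => ?_⟩, Or.inl ⟨fun _ => rfl, ?_⟩⟩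
    · rw [designV, hg]
      exact hs1
    · rw [hs3]
      exact ⟨fun _ => Submodule.mem_top, fun _ => Submodule.mem_top⟩
    · have hlow : cs.length ≤ (n * m) * (n * m) := by
        refine length_le_of_lowOrder (by omega) cs hc2 fun x hx => ?_
        rw [← lowOrder_spec b (by omega) hnm]
        intro h0
        have : x ∈ cs.flatMap fun x =>
            if lowOrder p (tbl b) (n * m) (crd b x) = 0 then [x] else [] :=
          List.mem_flatMap.2 ⟨x, hx, by simp [h0]⟩
        rw [hgs] at this
        exact List.not_mem_nil this
      -- all candidates are rejected, so they are all the `2 ^ |F|` subset sums of `F`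
      have hNN : (n * m) * (n * m) ≤ N * N := Nat.mul_le_mul hnm hnm
      have hlen : n ≤ F.length := by
        have hcard : Nat.card (spanL (ZMod p) F) = Nat.card E := by
          refine Nat.card_congr (Equiv.ofBijective (fun c : E =>
            (⟨algebraMap E L c, (hF3 _).2 ⟨c, rfl⟩⟩ : spanL (ZMod p) F)) ⟨?_, ?_⟩).symm
          · intro x y hxy
            exact (algebraMap E L).injective (Subtype.ext_iff.1 hxy)
          · rintro ⟨x, hx⟩
            obtain ⟨c, hc⟩ := (hF3 x).1 hx
            exact ⟨c, Subtype.ext hc⟩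
        have hfr : finrank (ZMod p) (spanL (ZMod p) F) = F.length := by
          rw [spanL_eq_range, finrank_span_eq_card hF2, Fintype.card_fin]
        have h3 : Nat.card E = p ^ F.length := by
          rw [← hcard, Module.natCard_eq_pow_finrank (K := ZMod p), hfr, Nat.card_zmod]
        have h4 : Nat.card K ∣ p ^ F.length := by
          rw [← h3, card_eq_card_pow (K := K) n hn]
          exact dvd_pow_self _ (by omega)
        obtain ⟨r, _, hr⟩ := (Nat.dvd_prime_pow Fact.out).1 h4
        rw [card_eq_card_pow (K := K) n hn, hr, ← pow_mul] at h3
        rw [← Nat.pow_right_injective (Fact.out : p.Prime).two_le h3]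
        refine Nat.le_mul_of_pos_left _ (Nat.pos_of_ne_zero ?_)
        rintro rfl
        have := Finite.one_lt_card (α := K)
        rw [hr, pow_zero] at this
        omega
      have := Nat.pow_le_pow_right (show 0 < 2 by omega) hlen
      omega
  | cons g gs =>
    rw [hgs] at hg
    obtain ⟨e, he⟩ := topBasis_spec (K := K) (E := E) (k := k) (s := s) b hnN (by omega) hn hm
    have hmem : g ∈ cs.flatMap fun x =>
        if lowOrder p (tbl b) (n * m) (crd b x) = 0 then [x] else [] := by
      rw [hgs]; exact List.mem_cons_self
    obtain ⟨x, hx, hgx⟩ := List.mem_flatMap.1 hmem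
    have hlow : g = x ∧ lowOrder p (tbl b) (n * m) (crd b x) = 0 := by
      split_ifs at hgx with h0
      · exact ⟨List.mem_singleton.1 hgx, h0⟩
      · exact absurd hgx List.not_mem_nil
    obtain ⟨rfl, hlow⟩ := hlow
    obtain ⟨γ, rfl⟩ := (hF3 _).1 (hc3 _ hx)
    obtain ⟨h3, h4⟩ := (lowOrder_spec b (by omega) hnm _).1 hlow
    refine ⟨fun i => designSpace K e γ s i, fun i => ?_, Or.inr ⟨e, γ, ?_, ?_, fun i => rfl⟩⟩
    · let us : List (L → L) :=
        (List.range (2 * s)).map (fun l (x : L) => algebraMap E L (∑ j : Fin m,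
          γ ^ ((2 * s * i + l + 1) * ((j : ℕ) + 1)) * Algebra.trace E L (e j * x))) ++
        (List.range s).map (fun l (x : L) => algebraMap E L (∑ j : Fin m,
          γ ^ ((l + 1) * ((j : ℕ) + 1)) * Algebra.trace E L (e j * x) ^ Nat.card K ^ (j : ℕ)))
      have hus : ∀ u ∈ us, ∀ x y, u (x + y) = u x + u y := by
        intro u hu x y
        rcases List.mem_append.1 hu with hu | hu <;> obtain ⟨l, _, rfl⟩ := List.mem_map.1 hu <;>
          dsimp only <;> rw [← map_add, ← Finset.sum_add_distrib] <;> congr 1 <;>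
          refine Finset.sum_congr rfl fun j _ => ?_
        · rw [mul_add (e j), map_add, mul_add]
        · rw [mul_add (e j), map_add, add_pow_card_pow, mul_add]
      obtain ⟨l, hl1, hl2, hl3⟩ := kerBy_crd b us hus hs2 _
        fun x _ => checkV_spec (k := k) b (by omega) hnm (by omega) hn hm e γ i x
      · refine ⟨l, ?_, hl2, fun x => ?_⟩
        · rw [← hl1, designV, hg, he, ← hs1]
          rfl
        · rw [hl3, hs3]
          simp only [us, Submodule.mem_top, true_and, List.mem_append, List.mem_map, List.mem_range,
            or_imp, forall_and, forall_exists_index, and_imp, forall_apply_eq_imp_iff₂,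
            FaithfulSMul.algebraMap_eq_zero_iff]
          rfl
    · rintro rfl
      exact h3 (map_zero _)
    · intro j hj hj' h5
      exact h4 j hj hj' (by rw [← map_pow, h5, map_one])

omit [Finite L] in
theorem botBasis_spec : ∃ l : List L, botBasis (fieldCtx b K n k m s) = l.map (crd b) ∧
    LIList (ZMod p) l ∧ ∀ x, x ∈ spanL (ZMod p) l ↔ ∃ c : K, algebraMap K L c = x :=
  fixV_subfield b K

omit [Finite L] in
theorem constructV_spec (hN : 1 ≤ N) (hk : k ≤ N) (H : ℕ → Submodule K L)
    (hH : ∀ i, ∃ l : List L, designV (fieldCtx b K n k m s) i = l.map (crd b) ∧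
      LIList (ZMod p) l ∧ ∀ x, x ∈ spanL (ZMod p) l ↔ x ∈ H i) :
    ∃ B : Fin k → List L, (∀ i, IsBasisList K (B i) (H i)) ∧
      constructV (fieldCtx b K n k m s) = List.ofFn fun i => (B i).map (crd b) := by
  obtain ⟨F, hF1, -, hF2⟩ := botBasis_spec (K := K) (n := n) (k := k) (m := m) (s := s) b
  choose l hl1 hl2 hl3 using hH
  choose B hB1 hB2 hB3 using fun i => greedy_crd b hF2 hN (l i)
  refine ⟨fun i => B i, fun i => isBasisList_iff.2 ⟨hB2 i, ?_⟩, ?_⟩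
  · rw [hB3]
    refine le_antisymm (spanL_le.2 fun x hx => (hl3 i x).1 (mem_spanL_of_mem hx)) fun x hx => ?_
    let U : Submodule (ZMod p) L := AddSubgroup.toZModSubmodule p (spanL K (l i)).toAddSubgroup
    have : spanL (ZMod p) (l i) ≤ U := spanL_le.2 fun y hy => by
      change y ∈ spanL K (l i)
      exact mem_spanL_of_mem hy
    exact this ((hl3 i x).2 hx)
  · rw [constructV]
    change (rg (tbl b) k).map _ = _
    rw [rg_eq (by rw [length_tbl]; omega), map_range_eq_ofFn]
    refine congrArg List.ofFn (funext fun i => ?_)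
    change (greedy p (tbl b) (botBasis (fieldCtx b K n k m s)) 1
      ((designV (fieldCtx b K n k m s) i).map fun x => [x])).map _ = _
    rw [← hB1, hl1, hF1]

end
end

/-! ### The subspace design -/

section
variable {K E L : Type*} [Field K] [Field E] [Field L] [Finite K]
  [Finite E] [Finite L] [Algebra K E] [Algebra E L] [Algebra K L] [IsScalarTower K E L]

theorem eq_zero_of_trace_mul_eq_zero {m : ℕ} (e : Basis (Fin m) E L) {x : L}
    (h : ∀ j, Algebra.trace E L (e j * x) = 0) : x = 0 := by
  have h1 : ∀ y, Algebra.trace E L (y * x) = 0 := fun y => by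
    have h2 : (Algebra.trace E L ∘ₗ LinearMap.mulRight E x) = 0 := e.ext fun j => h j
    exact LinearMap.congr_fun h2 y
  refine (traceForm_nondegenerate E L).1 x fun y => ?_
  rw [Algebra.traceForm_apply, mul_comm]
  exact h1 y

open Polynomial in
/-- The polynomial over `E` whose coefficients are the coordinates of `x`. -/
noncomputable def coordPoly {m : ℕ} (e : Fin m → L) : L →ₗ[E] E[X] :=
  ∑ j : Fin m, (monomial (j : ℕ)) ∘ₗ (Algebra.trace E L ∘ₗ LinearMap.mulLeft E (e j))

open Polynomial in
omit [Finite E] [Finite L] in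
theorem coordPoly_apply {m : ℕ} (e : Fin m → L) (x : L) :
    coordPoly (E := E) e x = ∑ j : Fin m, monomial (j : ℕ) (Algebra.trace E L (e j * x)) := by
  simp [coordPoly]

omit [Finite E] [Finite L] in
theorem eval_coordPoly {m : ℕ} (e : Fin m → L) (x : L) (γ : E) (c : ℕ) :
    γ ^ c * (coordPoly e x).eval (γ ^ c) =
      ∑ j : Fin m, γ ^ (c * ((j : ℕ) + 1)) * Algebra.trace E L (e j * x) := by
  rw [coordPoly_apply, Polynomial.eval_finsetSum, Finset.mul_sum]
  refine Finset.sum_congr rfl fun j _ => ?_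
  rw [Polynomial.eval_monomial, ← pow_mul, mul_add, pow_add, mul_one]
  ring

theorem coordPoly_injective {m : ℕ} (e : Basis (Fin m) E L) :
    Function.Injective (coordPoly (E := E) e) := by
  rw [← LinearMap.ker_eq_bot, LinearMap.ker_eq_bot']
  intro x hx
  refine eq_zero_of_trace_mul_eq_zero e fun j => ?_
  have := congrArg (fun f => Polynomial.coeff f (j : ℕ)) hx
  simp only [coordPoly_apply, Polynomial.finsetSum_coeff, Polynomial.coeff_monomial,
    Polynomial.coeff_zero] at this
  rw [Finset.sum_eq_single j] at this
  · simpa using this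
  · intro i _ hi
    rw [if_neg (fun h => hi (Fin.ext h))]
  · simp

/-- The dimension of the intersection with the linearized equations is controlled by the dimension
over `E` of the space cut out by the other equations. -/
theorem finrank_designSpace_inf_le {m s i M : ℕ} (e : Basis (Fin m) E L) {γ : E} (h0 : γ ≠ 0)
    (hγ : ∀ j, 1 ≤ j → j < M → γ ^ j ≠ 1) (hm : m ≤ M) (D : Submodule E L)
    (W : Submodule K L) (hW : W ≤ designSpace K e γ s i) (hWD : W ≤ D.restrictScalars K)
    (hD : finrank E D ≤ s) : finrank K W ≤ finrank E D * m := by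
  let ψ : ℕ → D →ₗ[E] E := fun j =>
    if h : j < m then (Algebra.trace E L ∘ₗ LinearMap.mulLeft E (e ⟨j, h⟩)) ∘ₗ D.subtype else 0
  let res : (D →ₗ[E] E) →ₗ[E] (W →ₗ[K] E) :=
    { toFun := fun f => f.restrictScalars K ∘ₗ Submodule.inclusion hWD
      map_add' := fun f g => rfl
      map_smul' := fun c f => rfl }
  let φ : ℕ → W →ₗ[K] E := fun j => res (ψ j)
  have hφ : ∀ (j : Fin m) (x : W), φ j x = Algebra.trace E L (e j * x) := fun j x => by
    simp only [φ, ψ, dif_pos j.2]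
    rfl
  have hfin : Finite (W →ₗ[K] E) := Finite.of_injective _ DFunLike.coe_injective
  have hspan : finrank E (Submodule.span E (φ '' Set.Iio m)) ≤ finrank E D := by
    have h1 : Submodule.span E (φ '' Set.Iio m) ≤ LinearMap.range res := by
      refine Submodule.span_le.2 ?_
      rintro _ ⟨j, _, rfl⟩
      exact ⟨ψ j, rfl⟩
    refine (Submodule.finrank_mono h1).trans ((LinearMap.finrank_range_le res).trans ?_)
    exact (Subspace.dual_finrank_eq (K := E) (V := D)).le
  refine (finrank_le_of_linearized_equations (s := s) (hspan.trans hD) φ (fun j => γ ^ (j + 1))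
    (fun j _ => pow_ne_zero _ h0) (fun i hi j hj h => ?_) (fun x hx => ?_) rfl
    (fun l hl x => ?_)).trans (Nat.mul_le_mul_right m hspan)
  · have := pow_injOn_of_pow_ne_one h0 hγ (by omega) (by omega) h
    omega
  · refine Subtype.ext (eq_zero_of_trace_mul_eq_zero e fun j => ?_)
    rw [← hφ]
    exact hx j j.2
  · rw [Finset.sum_range]
    have h1 := (hW x.2).2 l hl
    rw [← h1]
    refine Finset.sum_congr rfl fun j _ => ?_
    rw [hφ, ← pow_mul, mul_comm ((j : ℕ) + 1)]

/-- The subspaces cut out by the evaluations alone form a design over `E` by `folded_design`; the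
linearized equations turn it into a design over `K`, at the cost of a factor `m` that does not depend
on `n`. -/
theorem sum_finrank_designSpace_inf_le {m s k M : ℕ} (e : Basis (Fin m) E L) {γ : E} (h0 : γ ≠ 0)
    (hγ : ∀ j, 1 ≤ j → j < M → γ ^ j ≠ 1) (hm : m ≤ M) (hk : 2 * s * k ≤ M) (hs : 1 ≤ s)
    (W : Submodule E L) (hW : finrank E W = s) :
    ∑ i : Fin k, finrank K ↥(designSpace K e γ s i ⊓ W.restrictScalars K) ≤ m * m := by
  let D : Fin k → Submodule E L := fun i =>
    { carrier := {x | x ∈ W ∧ ∀ l < 2 * s, ∑ j : Fin m,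
        γ ^ ((2 * s * i + l + 1) * ((j : ℕ) + 1)) * Algebra.trace E L (e j * x) = 0}
      add_mem' := by
        rintro x y ⟨hx', hx⟩ ⟨hy', hy⟩
        refine ⟨add_mem hx' hy', fun l hl => ?_⟩
        simp only [mul_add (e _), map_add, mul_add (γ ^ _), Finset.sum_add_distrib, hx l hl,
          hy l hl, add_zero]
      zero_mem' := ⟨zero_mem _, fun l _ => by simp⟩
      smul_mem' := by
        rintro c x ⟨hx', hx⟩
        refine ⟨Submodule.smul_mem _ _ hx', fun l hl => ?_⟩
        simp only [mul_smul_comm, map_smul, smul_eq_mul, mul_left_comm _ c, ← Finset.mul_sum,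
          hx l hl, mul_zero] }
  have hDW : ∀ i, D i ≤ W := fun i x hx => hx.1
  have hDs : ∀ i, finrank E (D i) ≤ s := fun i => hW ▸ Submodule.finrank_mono (hDW i)
  have hinj := coordPoly_injective e
  have hdeg : W.map (coordPoly e) ≤ Polynomial.degreeLT E m := by
    rintro _ ⟨x, _, rfl⟩
    rw [coordPoly_apply]
    refine Submodule.sum_mem _ fun j _ => Polynomial.mem_degreeLT.2 ?_
    exact (Polynomial.degree_monomial_le _ _).trans_lt (by exact_mod_cast j.2)
  have hfr : ∀ U : Submodule E L, finrank E (U.map (coordPoly e)) = finrank E U := fun U =>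
    (Submodule.equivMapOfInjective (coordPoly e) hinj U).finrank_eq.symm
  have key := folded_design h0 hγ hm hk hs (W.map (coordPoly e)) hdeg ((hfr W).trans hW)
    (fun i => (D i).map (coordPoly e)) (fun i => Submodule.map_mono (hDW i)) (by
      rintro i _ ⟨x, hx, rfl⟩ l hl
      have h1 := hx.2 l hl
      rw [← eval_coordPoly] at h1
      exact (mul_eq_zero.1 h1).resolve_left (pow_ne_zero _ h0))
  simp only [hfr] at key
  have h1 : ∑ i, finrank E (D i) ≤ m := by
    by_contra hcon
    have h2 : (s + 1) * (m + 1) ≤ (s + 1) * ∑ i, finrank E (D i) :=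
      Nat.mul_le_mul_left _ (by omega)
    have h3 : s * (m - 1) ≤ (s + 1) * m := Nat.mul_le_mul (by omega) (by omega)
    rw [mul_add] at h2
    omega
  calc ∑ i : Fin k, finrank K ↥(designSpace K e γ s i ⊓ W.restrictScalars K)
      _ ≤ ∑ i : Fin k, finrank E (D i) * m := Finset.sum_le_sum fun i _ =>
          finrank_designSpace_inf_le e h0 hγ hm (D i) _ inf_le_left
            (fun x hx => ⟨hx.2, hx.1.1⟩) (hDs i)
      _ = (∑ i, finrank E (D i)) * m := (Finset.sum_mul _ _ _).symm
      _ ≤ m * m := Nat.mul_le_mul_right m h1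

/-- Each of the `3 s` equations with values in `E` lowers the dimension over `K` by at most `n`. -/
theorem finrank_designSpace {m n s i : ℕ} (hn : finrank K E = n) (e : Basis (Fin m) E L) (γ : E) :
    n * m ≤ finrank K (designSpace K e γ s i) + 3 * s * n := by
  let T₁ : Fin (2 * s) → L →ₗ[K] E := fun l => (∑ j : Fin m,
    LinearMap.mulLeft E (γ ^ ((2 * s * i + l + 1) * ((j : ℕ) + 1))) ∘ₗ
      (Algebra.trace E L ∘ₗ LinearMap.mulLeft E (e j))).restrictScalars K
  let T₂ : Fin s → L →ₗ[K] E := fun l => ∑ j : Fin m,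
    (LinearMap.mulLeft E (γ ^ (((l : ℕ) + 1) * ((j : ℕ) + 1)))).restrictScalars K ∘ₗ
      (frobPow K E j).toLinearMap ∘ₗ
        (Algebra.trace E L ∘ₗ LinearMap.mulLeft E (e j)).restrictScalars K
  let T : L →ₗ[K] (Fin (2 * s) ⊕ Fin s → E) := LinearMap.pi (Sum.elim T₁ T₂)
  have hker : LinearMap.ker T ≤ designSpace K e γ s i := by
    intro x hx
    have hx' : ∀ z, Sum.elim T₁ T₂ z x = 0 := fun z => congrFun (LinearMap.mem_ker.1 hx) z
    refine ⟨fun l hl => ?_, fun l hl => ?_⟩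
    · have := hx' (Sum.inl ⟨l, hl⟩)
      simpa [T₁] using this
    · have := hx' (Sum.inr ⟨l, hl⟩)
      simpa [T₂, frobPow_apply] using this
  have h1 := LinearMap.finrank_range_add_finrank_ker T
  have h2 : finrank K (LinearMap.range T) ≤ 3 * s * n := by
    refine (Submodule.finrank_le _).trans ?_
    rw [Module.finrank_pi_fintype]
    simp only [hn, Finset.sum_const, Finset.card_univ, Fintype.card_sum, Fintype.card_fin,
      smul_eq_mul]
    exact Nat.mul_le_mul_right n (by omega)
  have h3 := Submodule.finrank_mono hker
  have h4 : finrank K L = n * m := by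
    rw [← Module.finrank_mul_finrank K E L, hn, finrank_eq_card_basis e, Fintype.card_fin]
  omega

theorem pow_six_le (n : ℕ) : n ^ 6 ≤ 2048 * 2 ^ n := by
  rcases Nat.lt_or_ge n 10 with h | h
  · interval_cases n <;> norm_num
  · induction n, h using Nat.le_induction with
    | base => norm_num
    | succ n hn ih =>
      have h1 : (n + 1) ^ 6 ≤ 2 * n ^ 6 := by
        have h2 : (10 * (n + 1)) ^ 6 ≤ (11 * n) ^ 6 := Nat.pow_le_pow_left (by omega) 6
        rw [mul_pow, mul_pow] at h2
        norm_num at h2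
        omega
      rw [pow_succ 2 n]
      omega

theorem sq_le_of_two_pow_le {n m : ℕ} (hn : 1 ≤ n) (h : 2 ^ n ≤ (n * m) * (n * m)) :
    n * n ≤ 64 * m := by
  have h1 := pow_six_le n
  have h2 : (n * n) * (n ^ 4) ≤ (n * n) * (2048 * (m * m)) := by
    calc (n * n) * n ^ 4 = n ^ 6 := by ring
      _ ≤ 2048 * 2 ^ n := h1
      _ ≤ 2048 * ((n * m) * (n * m)) := Nat.mul_le_mul_left _ h
      _ = (n * n) * (2048 * (m * m)) := by ring
  have h3 := Nat.le_of_mul_le_mul_left h2 (Nat.mul_pos hn hn)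
  have h4 : (n * n) ^ 2 ≤ (64 * m) ^ 2 := by
    calc (n * n) ^ 2 = n ^ 4 := by ring
      _ ≤ 2048 * (m * m) := h3
      _ ≤ 4096 * (m * m) := Nat.mul_le_mul_right _ (by norm_num)
      _ = (64 * m) ^ 2 := by ring
  exact (Nat.pow_le_pow_iff_left (by norm_num)).1 h4

/-- The properties of the subspace design that is computed by the construction.  In the first case
`n` is so small, compared with `m`, that even the whole space forms a design. -/
theorem design_bounds {m n s k : ℕ} (hn : finrank K E = n) (hm : finrank E L = m) (hn1 : 1 ≤ n)
    (hk : k ≤ n) (hs : 1 ≤ s) (hsm : 2 * s ≤ m) (H : ℕ → Submodule K L)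
    (hH : ((∀ i, H i = ⊤) ∧ 2 ^ n ≤ (n * m) * (n * m)) ∨
      ∃ (e : Basis (Fin m) E L) (γ : E), γ ≠ 0 ∧ (∀ j, 1 ≤ j → j < n * m → γ ^ j ≠ 1) ∧
        ∀ i, H i = designSpace K e γ s i) :
    (∀ W : Submodule E L, finrank E W = s →
      ∑ i : Fin k, finrank K ↥(H i ⊓ W.restrictScalars K) ≤ 64 * (m * m)) ∧
    ∀ i, n * m ≤ finrank K (H i) + 3 * s * n := by
  rcases hH with ⟨hH, hsmall⟩ | ⟨e, γ, h0, hγ, hH⟩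
  · constructor
    · intro W hW
      have h1 : ∀ i : Fin k, finrank K ↥(H i ⊓ W.restrictScalars K) = n * s := fun i => by
        rw [hH, top_inf_eq, ← hn, ← hW]
        exact (Module.finrank_mul_finrank K E W).symm
      simp only [h1, Finset.sum_const, Finset.card_univ, Fintype.card_fin, smul_eq_mul]
      have h2 := sq_le_of_two_pow_le hn1 hsmall
      calc k * (n * s) ≤ n * (n * s) := Nat.mul_le_mul_right _ hk
        _ = (n * n) * s := by ring
        _ ≤ (64 * m) * m := Nat.mul_le_mul h2 (by omega)
        _ = _ := by ring
    · intro i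
      rw [hH, finrank_top, ← Module.finrank_mul_finrank K E L, hn, hm]
      omega
  · constructor
    · intro W hW
      have hsum : ∑ i : Fin k, finrank K ↥(H i ⊓ W.restrictScalars K) =
          ∑ i : Fin k, finrank K ↥(designSpace K e γ s i ⊓ W.restrictScalars K) :=
        Finset.sum_congr rfl fun i _ => by rw [hH]
      rw [hsum]
      have hk' : 2 * s * k ≤ n * m := by
        rw [mul_comm n m]
        exact Nat.mul_le_mul hsm hk
      exact (sum_finrank_designSpace_inf_le e h0 hγ (Nat.le_mul_of_pos_left m hn1) hk' hs W
        hW).trans (by omega)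
    · intro i
      rw [hH]
      exact finrank_designSpace hn e γ

end

/-! ### Interpolation decoding -/

section
variable {K E L : Type*} [Field K] [Field E] [Field L] [Finite K]
  [Finite E] [Finite L] [Algebra K E] [Algebra E L] [Algebra K L] [IsScalarTower K E L]

/-- `opPow` as a linear map. -/
noncomputable def opLin (K : Type*) {L : Type*} [Field K] [Field L] [Finite K] [Algebra K L]
    (j : ℕ) (a : L) : L →ₗ[K] L :=
  LinearMap.mulRight K (genPow K j a) ∘ₗ (frobPow K L j).toLinearMap

omit [Finite L] in
theorem opLin_apply (j : ℕ) (a z : L) : opLin K j a z = opPow K j a z := by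
  simp [opLin, opPow, frobPow_apply]

omit [Finite L] [Field K] [Finite K] [Algebra K L] in
theorem opPow_opPow (j l : ℕ) (a z : L) : opPow K j a (opPow K l a z) = opPow K (j + l) a z := by
  induction j with
  | zero => rw [opPow_zero, Nat.zero_add]
  | succ j ih => rw [opPow_succ', ih, ← opPow_succ', Nat.add_right_comm]

omit [Finite K] [Finite E] [Finite L] [IsScalarTower K E L] [Field K] [Algebra K E] [Algebra K L] in
theorem opPow_algebraMap (j : ℕ) (a z : E) :
    opPow K j (algebraMap E L a) (algebraMap E L z) = algebraMap E L (opPow K j a z) := by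
  simp [opPow, genPow]

omit [Finite L] [IsScalarTower K E L] [Finite K] [Algebra K L] in
theorem algebraMap_pow_card_mul {n : ℕ} (hn : finrank K E = n) (u : ℕ) (c : E) :
    algebraMap E L c ^ Nat.card K ^ (n * u) = algebraMap E L c := by
  rw [pow_mul, ← card_eq_card_pow (E := E) n hn, algebraMap_pow_card_pow]

/-- The interpolation condition `A₀(β)_a + ∑ u, A_u(τ ^ u (y))_a`, as a linear function of `(β, y)`,
where `τ z = z ^ (|K| ^ n)`. -/
noncomputable def interpLin (K : Type*) {L : Type*} [Field K] [Field L] [Finite K] [Algebra K L]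
    (A₀ : ℕ → L) (A : ℕ → ℕ → L) (d s D n : ℕ) (a : L) : L × L →ₗ[K] L :=
  (∑ q ∈ Finset.range d, LinearMap.mulLeft K (A₀ q) ∘ₗ opLin K q a) ∘ₗ LinearMap.fst K L L +
  (∑ u ∈ Finset.range s, ∑ j ∈ Finset.range D, LinearMap.mulLeft K (A u j) ∘ₗ opLin K j a ∘ₗ
    (frobPow K L (n * u)).toLinearMap) ∘ₗ LinearMap.snd K L L

omit [Finite L] in
theorem interpLin_apply (A₀ : ℕ → L) (A : ℕ → ℕ → L) (d s D n : ℕ) (a β y : L) :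
    interpLin K A₀ A d s D n a (β, y) = (∑ q ∈ Finset.range d, A₀ q * opPow K q a β) +
      ∑ u ∈ Finset.range s, ∑ j ∈ Finset.range D,
        A u j * opPow K j a (y ^ Nat.card K ^ (n * u)) := by
  simp [interpLin, opLin_apply, frobPow_apply]

/-- The coefficient of `x ^ i` in the skew polynomial `c A₀ + ∑ u, A_u g ^ (τ ^ u)`. -/
noncomputable def solveCoef (K : Type*) {L : Type*} [Field L] (A₀ : ℕ → L) (A : ℕ → ℕ → L)
    (s D n : ℕ) {k : ℕ} (c : L) (g : Fin k → L) (i : ℕ) : L :=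
  c * A₀ i + ∑ u ∈ Finset.range s, ∑ j ∈ Finset.range D, ∑ l : Fin k,
    if j + l = i then A u j * g l ^ Nat.card K ^ (j + n * u) else 0

theorem solveCoef_add {K L : Type*} [Field K] [Field L] [Finite K] [Algebra K L] (A₀ : ℕ → L)
    (A : ℕ → ℕ → L) (s D n : ℕ) {k : ℕ} (v w : Fin (k + 1) → L) (i : ℕ) :
    solveCoef K A₀ A s D n ((v + w) 0) (fun l : Fin k => (v + w) l.succ) i =
      solveCoef K A₀ A s D n (v 0) (fun l : Fin k => v l.succ) i +
        solveCoef K A₀ A s D n (w 0) (fun l : Fin k => w l.succ) i := by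
  simp only [solveCoef, Pi.add_apply, add_pow_card_pow, mul_add, add_mul, add_add_add_comm,
    ← Finset.sum_add_distrib]
  congr 1
  refine Finset.sum_congr rfl fun u _ => Finset.sum_congr rfl fun j _ =>
    Finset.sum_congr rfl fun l _ => ?_
  split_ifs <;> simp

omit [IsScalarTower K E L] [Finite L] in
/-- Substituting the values of `g` for the received word in the interpolation condition amounts to
the evaluation of the skew polynomial `A₀ + ∑ u, A_u g ^ (τ ^ u)`, because `τ` fixes the parameters
and the evaluation points, which lie in `E`. -/
theorem sum_solveCoef {n : ℕ} (hn : finrank K E = n) (A₀ : ℕ → L) (A : ℕ → ℕ → L) (d s D : ℕ)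
    {k : ℕ} (hd : D + k ≤ d + 1) (g : Fin k → L) (a z : E) :
    ∑ i ∈ Finset.range d, solveCoef K A₀ A s D n 1 g i *
        opPow K i (algebraMap E L a) (algebraMap E L z) =
      interpLin K A₀ A d s D n (algebraMap E L a)
        (algebraMap E L z, opEval K g (algebraMap E L a) (algebraMap E L z)) := by
  rw [interpLin_apply]
  simp only [solveCoef, add_mul, one_mul, Finset.sum_add_distrib]
  congr 1
  simp only [Finset.sum_mul]
  rw [Finset.sum_comm]
  refine Finset.sum_congr rfl fun u _ => ?_
  rw [Finset.sum_comm]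
  refine Finset.sum_congr rfl fun j hj => ?_
  rw [Finset.sum_comm]
  have h1 : opEval K g (algebraMap E L a) (algebraMap E L z) =
      ∑ l : Fin k, g l * algebraMap E L (opPow K l a z) := by
    rw [opEval]
    refine Finset.sum_congr rfl fun l _ => ?_
    rw [← opPow_algebraMap, mul_assoc]
    rfl
  rw [h1, sum_pow_card_pow, ← opLin_apply, map_sum, Finset.mul_sum]
  refine Finset.sum_congr rfl fun l _ => ?_
  rw [Finset.mem_range] at hj
  rw [Finset.sum_eq_single (j + l)]
  · rw [if_pos rfl, mul_pow, algebraMap_pow_card_mul hn, opLin_apply, opPow_mul,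
      ← opPow_algebraMap, opPow_opPow, ← pow_mul, ← pow_add, Nat.add_comm (n * u)]
    ring
  · intro i _ hi
    rw [if_neg (fun h => hi h.symm), zero_mul]
  · intro h
    refine absurd (Finset.mem_range.2 ?_) h
    have := l.2
    omega

omit [Finite K] [Finite L] in
theorem map_lincomb {V : Type*} [AddCommGroup V] [Module K V] {ν : ℕ} (T : L × L →ₗ[K] V)
    (c : Fin ν → K) (β y : Fin ν → L) (h : ∀ j, T (β j, y j) = 0) :
    T (∑ j, c j • β j, ∑ j, c j • y j) = 0 := by
  have : (∑ j, c j • β j, ∑ j, c j • y j) = ∑ j, c j • (β j, y j) := by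
    rw [Prod.ext_iff, Prod.fst_sum, Prod.snd_sum]
    exact ⟨rfl, rfl⟩
  rw [this, map_sum]
  exact Finset.sum_eq_zero fun j _ => by rw [map_smul, h, smul_zero]

omit [Finite K] [Finite L] in
/-- On a block, the evaluation points at which `x` and `y` agree form a large space. -/
theorem exists_agreement_space {ν : ℕ} {β : Fin ν → L} (hβ : LinearIndependent K β)
    (x y : Fin ν → L) :
    ∃ V : Submodule K L, ν ≤ finrank K V + finrank K (Submodule.span K (Set.range (x - y))) ∧
      ∀ z ∈ V, ∃ c : Fin ν → K, z = ∑ j, c j • β j ∧ ∑ j, c j • x j = ∑ j, c j • y j := by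
  let T := Fintype.linearCombination K (x - y)
  let B := Fintype.linearCombination K β
  have hB : Function.Injective B := hβ.fintypeLinearCombination_injective
  refine ⟨(LinearMap.ker T).map B, ?_, ?_⟩
  · have h1 := LinearMap.finrank_range_add_finrank_ker T
    rw [Module.finrank_fin_fun, Fintype.range_linearCombination] at h1
    rw [← (Submodule.equivMapOfInjective B hB (LinearMap.ker T)).finrank_eq]
    omega
  · rintro _ ⟨c, hc, rfl⟩
    refine ⟨c, rfl, ?_⟩
    have : ∑ j, c j • (x j - y j) = 0 := hc
    simpa [smul_sub, sub_eq_zero] using this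

section
variable {n k s D ℓ : ℕ} {ν : Fin ℓ → ℕ} {a : Fin ℓ → E} {β : BlockWord E ν}

omit [Finite L] in
theorem opEval_lincomb {ν : ℕ} (g : Fin k → L) (a : L) (c : Fin ν → K) (β : Fin ν → L) :
    opEval K g a (∑ j, c j • β j) = ∑ j, c j • opEval K g a (β j) := by
  have h1 : ∀ z, opEval K g a z = (∑ i : Fin k, LinearMap.mulLeft K (g i) ∘ₗ opLin K i a) z := by
    intro z
    simp [opEval, opLin_apply, opPow, mul_assoc]
  rw [h1, map_sum]
  exact Finset.sum_congr rfl fun j _ => by rw [map_smul, h1]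

/-- A codeword that is close to the received word satisfies the equation given by the
interpolation polynomials: the skew polynomial `A₀ + ∑ u, A_u g ^ (τ ^ u)` of degree less than `d`
vanishes on spaces of total dimension at least `d`. -/
theorem solveCoef_eq_zero (hn : finrank K E = n) (hab : IsEvaluationPair K L a β)
    (hν : ∑ i, ν i = n) (y : BlockWord L ν) (A₀ : ℕ → L) (A : ℕ → ℕ → L) {d : ℕ}
    (hd : D + k ≤ d + 1)
    (hA : ∀ i j, interpLin K A₀ A d s D n (algebraMap E L (a i))
      (algebraMap E L (β i j), y i j) = 0) (g : Fin k → L)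
    (hdist : sumRankDist K (lrsEval K L k a β g) y + d ≤ n) :
    ∀ i < d, solveCoef K A₀ A s D n 1 g i = 0 := by
  have hβ : ∀ i, LinearIndependent K fun j => algebraMap E L (β i j) := fun i =>
    (hab.linearIndependent i).map' (IsScalarTower.toAlgHom K E L).toLinearMap
      (LinearMap.ker_eq_bot.2 (algebraMap E L).injective)
  choose V hV1 hV2 using fun i => exists_agreement_space (hβ i) (lrsEval K L k a β g i) (y i)
  refine skew_root_count (K := K) (fun i => algebraMap E L (a i)) (fun i => ?_) hab.not_conj d _ V
    ?_ fun i z hz => ?_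
  · rw [Ne, FaithfulSMul.algebraMap_eq_zero_iff]
    exact hab.ne_zero i
  · have h1 : ∑ i, ν i ≤ ∑ i, finrank K (V i) + sumRankDist K (lrsEval K L k a β g) y := by
      rw [sumRankDist, sumRankWeight, ← Finset.sum_add_distrib]
      exact Finset.sum_le_sum fun i _ => hV1 i
    omega
  · obtain ⟨c, hc, hxy⟩ := hV2 i z hz
    have hz' : z = algebraMap E L (∑ j, c j • β i j) := by
      rw [hc, map_sum]
      refine Finset.sum_congr rfl fun j _ => ?_
      exact (map_smul (IsScalarTower.toAlgHom K E L) (c j) (β i j)).symm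
    have h1 := map_lincomb (interpLin K A₀ A d s D n (algebraMap E L (a i))) c
      (fun j => algebraMap E L (β i j)) (y i) (hA i)
    have h2 : ∑ j, c j • y i j = opEval K g (algebraMap E L (a i)) z := by
      rw [← hxy, hc, opEval_lincomb]
      rfl
    rw [← hc, h2] at h1
    rw [hz'] at h1 ⊢
    rw [sum_solveCoef hn A₀ A d s D hd]
    exact h1

omit [Finite E] in
/-- A message of degree less than `k ≤ n` is determined by its codeword. -/
theorem lrsEval_injective (hab : IsEvaluationPair K L a β) (hν : ∑ i, ν i = n) (hk : k ≤ n) :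
    Function.Injective (lrsEval K L k a β) := by
  rw [← LinearMap.ker_eq_bot, LinearMap.ker_eq_bot']
  intro f hf
  have hβ : ∀ i, LinearIndependent K fun j => algebraMap E L (β i j) := fun i =>
    (hab.linearIndependent i).map' (IsScalarTower.toAlgHom K E L).toLinearMap
      (LinearMap.ker_eq_bot.2 (algebraMap E L).injective)
  have key := skew_root_count (K := K) (fun i => algebraMap E L (a i)) (fun i => by
      rw [Ne, FaithfulSMul.algebraMap_eq_zero_iff]
      exact hab.ne_zero i) hab.not_conj k (fun i => if h : i < k then f ⟨i, h⟩ else 0)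
    (fun i => Submodule.span K (Set.range fun j => algebraMap E L (β i j))) (by
      simp only [finrank_span_eq_card (hβ _), Fintype.card_fin]
      omega) (by
      intro i z hz
      have h1 : ∀ z, ∑ j ∈ Finset.range k, (if h : j < k then f ⟨j, h⟩ else 0) *
          opPow K j (algebraMap E L (a i)) z = opEval K f (algebraMap E L (a i)) z := by
        intro z
        rw [Finset.sum_range, opEval]
        refine Finset.sum_congr rfl fun j _ => ?_
        rw [dif_pos j.2, mul_assoc]
        rfl
      rw [h1]
      obtain ⟨c, rfl⟩ := (Submodule.mem_span_range_iff_exists_fun K).1 hz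
      rw [opEval_lincomb]
      refine Finset.sum_eq_zero fun j _ => ?_
      have : opEval K f (algebraMap E L (a i)) (algebraMap E L (β i j)) = 0 :=
        congrFun (congrFun hf i) j
      rw [this, smul_zero])
  funext i
  have := key i i.2
  rwa [dif_pos i.2] at this

omit [Finite E] in
/-- A nonzero solution of the interpolation problem involves the received word: if all `A u` vanish,
then `A₀` vanishes at all evaluation points. -/
theorem exists_ne_zero_of_interp (hab : IsEvaluationPair K L a β) (hν : ∑ i, ν i = n)
    (y : BlockWord L ν) (A₀ : ℕ → L) (A : ℕ → ℕ → L) {d : ℕ} (hd : d ≤ n)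
    (hA : ∀ i j, interpLin K A₀ A d s D n (algebraMap E L (a i))
      (algebraMap E L (β i j), y i j) = 0) (hA0 : ∀ u < s, ∀ j < D, A u j = 0) :
    ∀ i < d, A₀ i = 0 := by
  have h1 : lrsEval K L d a β (fun i => A₀ i) = 0 := by
    funext i j
    have := hA i j
    rw [interpLin_apply, Finset.sum_eq_zero (s := Finset.range s), add_zero,
      Finset.sum_range] at this
    · change opEval K _ _ _ = 0
      rw [opEval, ← this]
      exact Finset.sum_congr rfl fun q _ => mul_assoc _ _ _
    · intro u hu
      refine Finset.sum_eq_zero fun j hj => ?_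
      rw [hA0 u (Finset.mem_range.1 hu) j (Finset.mem_range.1 hj), zero_mul]
  have h2 := lrsEval_injective hab hν hd (h1.trans (map_zero _).symm)
  exact fun i hi => congrFun h2 ⟨i, hi⟩

end

omit [Finite K] in
/-- The dimension of a space of vectors is bounded by the dimensions of spaces that contain the
leading entries. -/
theorem finrank_le_sum_of_leading {k : ℕ} (T : Submodule K (Fin k → L)) (X : Fin k → Submodule K L)
    (h : ∀ v ∈ T, ∀ i, (∀ j < i, v j = 0) → v i ∈ X i) :
    finrank K T ≤ ∑ i, finrank K (X i) := by
  induction k with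
  | zero =>
    refine (Submodule.finrank_le _).trans ?_
    rw [Module.finrank_zero_of_subsingleton]
    exact Nat.zero_le _
  | succ k ih =>
    let π : (Fin (k + 1) → L) →ₗ[K] L := LinearMap.proj 0
    let ι : (Fin k → L) →ₗ[K] (Fin (k + 1) → L) :=
      { toFun := fun v => Fin.cons 0 v
        map_add' := fun v w => by
          funext i
          refine Fin.cases ?_ (fun i => ?_) i <;> simp
        map_smul' := fun c v => by
          funext i
          refine Fin.cases ?_ (fun i => ?_) i <;> simp }
    have hι0 : ∀ v, ι v 0 = 0 := fun v => rfl
    have h1 := LinearMap.finrank_range_add_finrank_ker (π.domRestrict T)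
    have h2 : LinearMap.range (π.domRestrict T) ≤ X 0 := by
      rintro _ ⟨v, rfl⟩
      exact h v v.2 0 fun j hj => absurd hj (Fin.not_lt_zero j)
    have h3 : finrank K (LinearMap.ker (π.domRestrict T)) ≤ finrank K (T.comap ι) := by
      let ρ : LinearMap.ker (π.domRestrict T) →ₗ[K] T.comap ι :=
        { toFun := fun v => ⟨fun i => v.1.1 i.succ, by
            have h0 : v.1.1 0 = 0 := v.2
            have : ι (fun i => v.1.1 i.succ) = v.1.1 := by
              funext i
              refine Fin.cases ?_ (fun i => ?_) i
              · rw [h0, hι0]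
              · rfl
            change ι _ ∈ T
            rw [this]
            exact v.1.2⟩
          map_add' := fun v w => rfl
          map_smul' := fun c v => rfl }
      refine LinearMap.finrank_le_finrank_of_injective (f := ρ) fun v w hvw => ?_
      have hv0 : v.1.1 0 = 0 := v.2
      have hw0 : w.1.1 0 = 0 := w.2
      refine Subtype.ext (Subtype.ext (funext fun i => ?_))
      refine Fin.cases ?_ (fun i => ?_) i
      · rw [hv0, hw0]
      · exact congrFun (Subtype.ext_iff.1 hvw) i
    have h4 := ih (T.comap ι) (fun i => X i.succ) fun v hv i hi => by
      have := h (ι v) hv i.succ fun j => by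
        refine Fin.cases (fun _ => hι0 v) (fun j hj => ?_) j
        exact hi j (Fin.succ_lt_succ_iff.1 hj)
      exact this
    rw [Fin.sum_univ_succ]
    have := Submodule.finrank_mono h2
    omega

omit [Finite E] in
theorem exists_finrank_eq (W : Submodule E L) {s : ℕ} (h1 : finrank E W ≤ s)
    (h2 : s ≤ finrank E L) : ∃ W' : Submodule E L, W ≤ W' ∧ finrank E W' = s := by
  induction s, h1 using Nat.le_induction with
  | base => exact ⟨W, le_rfl, rfl⟩
  | succ s hs ih =>
    obtain ⟨W', h3, h4⟩ := ih (by omega)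
    have hne : W' ≠ ⊤ := by
      rintro rfl
      rw [finrank_top] at h4
      omega
    obtain ⟨x, -, hx⟩ := SetLike.exists_of_lt (lt_top_iff_ne_top.2 hne)
    refine ⟨W' ⊔ Submodule.span E {x}, h3.trans le_sup_left, ?_⟩
    have hlt : W' < W' ⊔ Submodule.span E {x} := lt_of_le_of_ne le_sup_left fun h => hx (by
      rw [h]
      exact Submodule.mem_sup_right (Submodule.mem_span_singleton_self x))
    have h5 := Submodule.finrank_lt_finrank_of_lt hlt
    have h6 := Submodule.finrank_add_le_finrank_add_finrank W' (Submodule.span E {x})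
    have h7 := finrank_span_singleton (K := E) (v := x) fun h0 => hx (h0 ▸ zero_mem _)
    omega

omit [IsScalarTower K E L] in
/-- The solution space of a nonzero linearized equation of degree less than `s` over `E` has
dimension less than `s`. -/
theorem exists_kernel_space {n s : ℕ} (hn : finrank K E = n) (hs : s ≤ finrank E L) (j : ℕ)
    (B : ℕ → L) (hB : ∃ u < s, B u ≠ 0) :
    ∃ W : Submodule E L, finrank E W = s ∧
      ∀ z, ∑ u ∈ Finset.range s, B u * z ^ Nat.card K ^ (j + n * u) = 0 → z ∈ W := by
  have hbij : Function.Bijective (frobPow K L j) :=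
    Finite.injective_iff_bijective.1 (frobPow K L j).toRingHom.injective
  choose R hR using fun u => hbij.2 (B u)
  let W : Submodule E L :=
    { carrier := {z | ∑ u ∈ Finset.range s, R u * opPow E u 1 z = 0}
      add_mem' := fun {x y} hx hy => by
        simp only [Set.mem_ofPred_eq] at hx hy ⊢
        simp only [opPow_add, mul_add, Finset.sum_add_distrib, hx, hy, add_zero]
      zero_mem' := by
        simp only [Set.mem_ofPred_eq]
        simp [← opLin_apply]
      smul_mem' := fun c x hx => by
        simp only [Set.mem_ofPred_eq] at hx ⊢
        simp only [opPow_smul, mul_smul_comm, ← Finset.smul_sum, hx, smul_zero] }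
  have hW : finrank E W ≤ s := by
    by_contra hcon
    obtain ⟨u, hu, hBu⟩ := hB
    have := skew_root_count (K := E) (ℓ := 1) (fun _ => (1 : L)) (fun _ => one_ne_zero)
      (fun i i' h => absurd (Subsingleton.elim i i') h) s R (fun _ => W) (by simp; omega)
      (fun _ z hz => hz) u hu
    rw [← hR, this, map_zero] at hBu
    exact hBu rfl
  obtain ⟨W', h1, h2⟩ := exists_finrank_eq W hW hs
  refine ⟨W', h2, fun z hz => h1 ?_⟩
  refine hbij.1 ?_
  rw [map_zero, map_sum, ← hz]
  refine Finset.sum_congr rfl fun u _ => ?_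
  rw [map_mul, hR, opPow, frobPow_apply, card_eq_card_pow (K := K) n hn]
  simp only [genPow, one_pow, Finset.prod_const_one, mul_one]
  rw [← pow_mul, ← pow_mul, ← pow_add, Nat.add_comm (n * u)]

/-- The messages that solve the equation given by the interpolation polynomials, together with a
scalar. -/
def solutionSpace (K : Type*) {L : Type*} [Field K] [Field L] [Finite K] [Algebra K L]
    (A₀ : ℕ → L) (A : ℕ → ℕ → L) (d s D n : ℕ) {k : ℕ} (H : Fin k → Submodule K L) :
    Submodule K (Fin (k + 1) → L) where
  carrier := {v | (∃ c : K, algebraMap K L c = v 0) ∧ (∀ l : Fin k, v l.succ ∈ H l) ∧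
    ∀ i < d, solveCoef K A₀ A s D n (v 0) (fun l : Fin k => v l.succ) i = 0}
  add_mem' := by
    rintro v w ⟨⟨c, hc⟩, h1, h2⟩ ⟨⟨c', hc'⟩, h3, h4⟩
    refine ⟨⟨c + c', by rw [map_add, hc, hc']; rfl⟩, fun l => add_mem (h1 l) (h3 l),
      fun i hi => ?_⟩
    rw [solveCoef_add, h2 i hi, h4 i hi, add_zero]
  zero_mem' := by
    refine ⟨⟨0, map_zero _⟩, fun l => zero_mem _, fun i _ => ?_⟩
    have : ∀ j, Nat.card K ^ j ≠ 0 := fun j => pow_ne_zero _ Nat.card_pos.ne'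
    simp only [solveCoef, Pi.zero_apply, zero_mul, zero_add, zero_pow (this _), mul_zero, ite_self,
      Finset.sum_const_zero]
  smul_mem' := by
    rintro e v ⟨⟨c, hc⟩, h1, h2⟩
    refine ⟨⟨e * c, by rw [map_mul, hc, Pi.smul_apply, Algebra.smul_def]⟩,
      fun l => Submodule.smul_mem _ _ (h1 l), fun i hi => ?_⟩
    have : solveCoef K A₀ A s D n ((e • v) 0) (fun l : Fin k => (e • v) l.succ) i =
        algebraMap K L e * solveCoef K A₀ A s D n (v 0) (fun l : Fin k => v l.succ) i := by
      simp only [solveCoef, Pi.smul_apply, Algebra.smul_def, mul_pow, algebraMap_pow_card_pow,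
        mul_add, Finset.mul_sum, mul_ite, mul_zero, mul_assoc, mul_left_comm (algebraMap K L e)]
    rw [this, h2 i hi, mul_zero]

/-- The bound on the dimension of the space of solutions, for messages from a subspace design.  If
`j₀` is the lowest degree that occurs in the polynomials `A u`, the coefficient of `x ^ (i + j₀)`
shows that the first nonzero entry of a solution lies in a space over `E` of dimension `s` which does
not depend on its position `i`. -/
theorem finrank_solutionSpace_le {n s D d k Δ : ℕ} (hn : finrank K E = n) (hs : s ≤ finrank E L)
    (hd : D + k ≤ d + 1) (A₀ : ℕ → L) (A : ℕ → ℕ → L) (hA : ∃ u < s, ∃ j < D, A u j ≠ 0)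
    (H : Fin k → Submodule K L)
    (hH : ∀ W : Submodule E L, finrank E W = s →
      ∑ i : Fin k, finrank K ↥(H i ⊓ W.restrictScalars K) ≤ Δ) :
    finrank K (solutionSpace K A₀ A d s D n H) ≤ 1 + Δ := by
  classical
  -- the lowest degree that occurs in one of the polynomials `A u`
  have hex : ∃ j, j < D ∧ ∃ u < s, A u j ≠ 0 := by
    obtain ⟨u, hu, j, hj, h⟩ := hA
    exact ⟨j, hj, u, hu, h⟩
  obtain ⟨hj, hu⟩ := Nat.find_spec hex
  have hmin : ∀ j < Nat.find hex, ∀ u < s, A u j = 0 := by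
    intro j hlt u hu'
    by_contra hcon
    exact Nat.find_min hex hlt ⟨hlt.trans hj, u, hu', hcon⟩
  generalize Nat.find hex = j₀ at hj hu hmin
  obtain ⟨W, hW, hker⟩ := exists_kernel_space hn hs j₀ (fun u => A u j₀) hu
  refine (finrank_le_sum_of_leading _ (Fin.cons (LinearMap.range (Algebra.linearMap K L))
    fun i => H i ⊓ W.restrictScalars K) ?_).trans ?_
  · rintro v ⟨⟨c, hc⟩, h1, h2⟩ i
    refine Fin.cases (fun _ => ⟨c, hc⟩) (fun i hi => ⟨h1 i, hker _ ?_⟩) i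
    have h3 := h2 (i + j₀) (by have := i.2; omega)
    rw [solveCoef, hi 0 (Fin.succ_pos i), zero_mul, zero_add] at h3
    rw [← h3]
    refine Finset.sum_congr rfl fun u hu => ?_
    rw [Finset.mem_range] at hu
    rw [Finset.sum_eq_single j₀, Finset.sum_eq_single i]
    · rw [if_pos (Nat.add_comm _ _)]
    · intro l _ hl
      rw [if_neg]
      intro h
      exact hl (Fin.ext (by omega))
    · simp
    · intro j _ hjj
      refine Finset.sum_eq_zero fun l _ => ?_
      split_ifs with h
      · rcases Nat.lt_or_ge j j₀ with hlt | hge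
        · rw [hmin j hlt u hu, zero_mul]
        · rw [hi l.succ (Fin.succ_lt_succ_iff.2 (Fin.lt_def.2 (by omega))),
            zero_pow (pow_ne_zero _ Nat.card_pos.ne'), mul_zero]
      · rfl
    · intro h
      exact absurd (Finset.mem_range.2 hj) h
  · rw [Fin.sum_univ_succ]
    refine Nat.add_le_add ?_ (hH W hW)
    exact (LinearMap.finrank_range_le _).trans (finrank_self K).le

end

/-! ### Correctness of the decoder -/

theorem flatMap_range_eq {α : Type*} (s D : ℕ) (F : ℕ → ℕ → α) (G : ℕ → α)
    (h : ∀ u, ∀ j < D, G (u * D + j) = F u j) :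
    ((List.range s).flatMap fun u => (List.range D).map fun j => F u j) =
      (List.range (s * D)).map G := by
  induction s with
  | zero => simp
  | succ s ih =>
    rw [List.range_succ, List.flatMap_append, ih, Nat.succ_mul, List.range_add, List.map_append,
      List.flatMap_singleton, List.map_map]
    congr 1
    exact List.map_congr_left fun j hj => (h s j (List.mem_range.1 hj)).symm

theorem sum_range_mul {M : Type*} [AddCommMonoid M] (s D : ℕ) (f : ℕ → M) :
    ∑ t ∈ Finset.range (s * D), f t =
      ∑ u ∈ Finset.range s, ∑ j ∈ Finset.range D, f (u * D + j) := by
  induction s with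
  | zero => simp
  | succ s ih => rw [Nat.succ_mul, Finset.sum_range_add, ih, Finset.sum_range_succ]

theorem sum_map_range {M : Type*} [AddCommMonoid M] (n : ℕ) (f : ℕ → M) :
    ((List.range n).map f).sum = ∑ i ∈ Finset.range n, f i := by
  induction n with
  | zero => simp
  | succ n ih => simp [List.range_succ, Finset.sum_range_succ, ih]

theorem sum_flatMap_range {M : Type*} [AddCommMonoid M] (n : ℕ) (f : ℕ → List M) :
    ((List.range n).flatMap f).sum = ∑ i ∈ Finset.range n, (f i).sum := by
  induction n with
  | zero => simp
  | succ n ih => simp [List.range_succ, Finset.sum_range_succ, ih]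

section
variable {F V : Type*} [Field F] [AddCommGroup V] [Module F V]

theorem LIList.append {l₁ l₂ : List V} (h₁ : LIList F l₁) (h₂ : LIList F l₂)
    (h : ∀ x, x ∈ spanL F l₁ → x ∈ spanL F l₂ → x = 0) : LIList F (l₁ ++ l₂) := by
  induction l₁ with
  | nil => exact h₂
  | cons x l₁ ih =>
    rw [List.cons_append, liList_cons]
    obtain ⟨h3, h4⟩ := liList_cons.1 h₁
    have hle : spanL F l₁ ≤ spanL F (x :: l₁) := by rw [spanL_cons]; exact le_sup_right
    refine ⟨fun hx => ?_, ih h4 fun y hy => h y (hle hy)⟩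
    rw [spanL_append] at hx
    obtain ⟨y, hy, z, hz, rfl⟩ := Submodule.mem_sup.1 hx
    have hz0 : z = 0 := by
      refine h z ?_ hz
      have := sub_mem (mem_spanL_of_mem (F := F) (List.mem_cons_self (a := y + z) (l := l₁)))
        (hle hy)
      rwa [add_sub_cancel_left] at this
    rw [hz0, add_zero] at h3
    exact h3 hy

/-- A basis of a product of subspaces. -/
theorem liList_flatMap_single {r : ℕ} (Ls : Fin r → List V) (hL : ∀ i, LIList F (Ls i)) :
    LIList F ((List.finRange r).flatMap fun i => (Ls i).map fun x => (Pi.single i x : Fin r → V)) ∧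
    ∀ v, v ∈ spanL F ((List.finRange r).flatMap fun i =>
      (Ls i).map fun x => (Pi.single i x : Fin r → V)) ↔ ∀ i, v i ∈ spanL F (Ls i) := by
  have key : ∀ is : List (Fin r), is.Nodup →
      LIList F (is.flatMap fun i => (Ls i).map fun x => (Pi.single i x : Fin r → V)) ∧
      ∀ v, v ∈ spanL F (is.flatMap fun i => (Ls i).map fun x => (Pi.single i x : Fin r → V)) ↔
        ∀ i, v i ∈ spanL F (Ls i) ∧ (i ∉ is → v i = 0) := by
    intro is his
    induction is with
    | nil =>
      refine ⟨liList_nil, fun v => ?_⟩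
      rw [List.flatMap_nil, spanL_nil, Submodule.mem_bot]
      constructor
      · rintro rfl i
        exact ⟨zero_mem _, fun _ => rfl⟩
      · exact fun h => funext fun i => (h i).2 List.not_mem_nil
    | cons i is ih =>
      obtain ⟨hi, his⟩ := List.nodup_cons.1 his
      obtain ⟨h1, h2⟩ := ih his
      have h3 : ∀ v, v ∈ spanL F ((Ls i).map fun x => (Pi.single i x : Fin r → V)) ↔
          ∃ x ∈ spanL F (Ls i), Pi.single i x = v := fun v => by
        have := spanL_map (LinearMap.single F (fun _ : Fin r => V) i) (Ls i)
        have h4 : ((Ls i).map fun x => (Pi.single i x : Fin r → V)) =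
            (Ls i).map (LinearMap.single F (fun _ : Fin r => V) i) := rfl
        rw [h4, this]
        rfl
      rw [List.flatMap_cons]
      refine ⟨LIList.append ?_ h1 ?_, fun v => ?_⟩
      · refine (hL i).map (T := LinearMap.single F (fun _ : Fin r => V) i) fun x _ hx => ?_
        have := congrFun hx i
        simpa using this
      · intro v hv hv'
        obtain ⟨x, -, rfl⟩ := (h3 v).1 hv
        have := ((h2 _).1 hv' i).2 hi
        rw [Pi.single_eq_same] at this
        rw [this, Pi.single_zero]
      · rw [spanL_append, Submodule.mem_sup]
        constructor
        · rintro ⟨y, hy, z, hz, rfl⟩ j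
          obtain ⟨x, hx, rfl⟩ := (h3 y).1 hy
          obtain ⟨h5, h6⟩ := (h2 z).1 hz j
          rw [Pi.add_apply]
          by_cases hj : j = i
          · subst hj
            rw [Pi.single_eq_same]
            exact ⟨add_mem hx h5, fun h => absurd List.mem_cons_self h⟩
          · rw [Pi.single_eq_of_ne hj, zero_add]
            exact ⟨h5, fun h => h6 fun h' => h (List.mem_cons_of_mem _ h')⟩
        · intro h
          refine ⟨Pi.single i (v i), (h3 _).2 ⟨v i, (h i).1, rfl⟩, v - Pi.single i (v i),
            (h2 _).2 fun j => ?_, add_sub_cancel _ _⟩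
          rw [Pi.sub_apply]
          by_cases hj : j = i
          · subst hj
            rw [Pi.single_eq_same, sub_self]
            exact ⟨zero_mem _, fun _ => rfl⟩
          · rw [Pi.single_eq_of_ne hj, sub_zero]
            refine ⟨(h j).1, fun h' => (h j).2 fun h'' => ?_⟩
            rcases List.mem_cons.1 h'' with h'' | h''
            · exact hj h''
            · exact h' h''
  obtain ⟨h1, h2⟩ := key (List.finRange r) (List.nodup_finRange r)
  refine ⟨h1, fun v => (h2 v).trans ?_⟩
  exact forall_congr' fun i =>
    ⟨fun h => h.1, fun h => ⟨h, fun h' => absurd (List.mem_finRange i) h'⟩⟩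

end

section
variable {p N : ℕ} [Fact p.Prime] {K E L : Type*} [Field K] [Field E] [Field L] [Finite K]
  [Finite E] [Finite L] [Algebra K E] [Algebra E L] [Algebra K L] [IsScalarTower K E L]
  [Algebra (ZMod p) L] (b : Basis (Fin N) (ZMod p) L) {n k m s : ℕ}

/-- The entries of a vector, continued by zero. -/
def entry {r : ℕ} (v : Fin r → L) (i : ℕ) : L := if h : i < r then v ⟨i, h⟩ else 0

omit [Finite L] in
theorem entry_fin {r : ℕ} (v : Fin r → L) (i : Fin r) : entry v i = v i := dif_pos i.2

omit [Finite L] in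
theorem nthV_rep {r : ℕ} (v : Fin r → L) (i : ℕ) :
    nthV (tbl b) (rep b v) i = crd b (entry v i) := by
  rw [nthV, entry, List.headD_eq_head?_getD, List.head?_drop, rep, List.getElem?_ofFn]
  split_ifs with h
  · rfl
  · exact zeroV_tbl b

omit [Finite L] [Algebra K L] in
theorem opPowV_spec {j : ℕ} (hj : j ≤ N) (a z : L) :
    opPowV (fieldCtx b K n k m s) (crd b a) j (crd b z) = crd b (opPow K j a z) := by
  rw [opPowV]
  change (rg (tbl b) j).foldl _ _ = _
  rw [rg_eq (by rwa [length_tbl])]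
  clear hj
  induction j with
  | zero => rw [opPow_zero]; rfl
  | succ j ih =>
    rw [List.range_succ, List.foldl_append, ih, List.foldl_cons, List.foldl_nil]
    change mulV p (tbl b) (crd b a) (powV p (tbl b) _ (Nat.card K)) = _
    rw [powV_crd b _ Nat.card_pos.ne', mulV_crd, opPow_succ', mul_comm]

/-- The sizes of the interpolation problem: there are more unknowns than the `n` equations, and all
lengths and exponents stay below the cut-off of the loops, which is at least `n * m`. -/
theorem interp_sizes (hk1 : 1 ≤ k) (hk : k ≤ n) (hs : 1 ≤ s) (hsm : 4 * s < m) {D : ℕ}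
    (hD : D = (n - k + 1) / (s + 1) + 1) :
    1 ≤ D ∧ D + k - 1 ≤ n ∧ D ≤ n ∧ n < D + k - 1 + s * D ∧ D + k - 1 + s * D ≤ n * m ∧
      n * s ≤ n * m ∧ k + 1 ≤ n * m ∧ s ≤ n * m := by
  have h1 := Nat.div_add_mod (n - k + 1) (s + 1)
  have h2 := Nat.mod_lt (n - k + 1) (Nat.succ_pos s)
  generalize (n - k + 1) / (s + 1) = q at *
  generalize (n - k + 1) % (s + 1) = r at *
  subst hD
  have h3 : q ≤ s * q := Nat.le_mul_of_pos_left q hs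
  have h4 : (s + 1) * q = s * q + q := by ring
  have h5 : s * (q + 1) = s * q + s := by ring
  have h6 : n * s ≤ n * m := Nat.mul_le_mul_left n (by omega)
  have h7 : n * (s + 4) ≤ n * m := Nat.mul_le_mul_left n (by omega)
  have h8 : s ≤ n * s := Nat.le_mul_of_pos_left s (by omega)
  have h9 : n * (s + 4) = n * s + 4 * n := by ring
  omega

/-- The entries of a row of the interpolation problem. -/
noncomputable def rowEntry (K : Type*) {L : Type*} [Field L] (d D n : ℕ) (a β y : L) (t : ℕ) : L :=
  if t < d then opPow K t a β
  else opPow K ((t - d) % D) a (y ^ Nat.card K ^ (n * ((t - d) / D)))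

omit [Finite L] in
theorem sum_entry_mul_rowEntry {r d D : ℕ} (hD : 1 ≤ D) (hr : r = d + s * D) (v : Fin r → L)
    (a β y : L) :
    ∑ t : Fin r, v t * rowEntry K d D n a β y t =
      interpLin K (entry v) (fun u j => entry v (d + (u * D + j))) d s D n a (β, y) := by
  subst hr
  have h1 : ∑ t : Fin (d + s * D), v t * rowEntry K d D n a β y t =
      ∑ t ∈ Finset.range (d + s * D), entry v t * rowEntry K d D n a β y t := by
    rw [Finset.sum_range]
    exact Finset.sum_congr rfl fun t _ => by rw [entry_fin]
  rw [h1, interpLin_apply, Finset.sum_range_add, sum_range_mul]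
  congr 1
  · refine Finset.sum_congr rfl fun t ht => ?_
    rw [rowEntry, if_pos (Finset.mem_range.1 ht)]
  · refine Finset.sum_congr rfl fun u _ => Finset.sum_congr rfl fun j hj => ?_
    rw [Finset.mem_range] at hj
    rw [rowEntry, if_neg (by omega), Nat.add_sub_cancel_left, Nat.mul_comm u D,
      Nat.mul_add_mod, Nat.mod_eq_of_lt hj, Nat.mul_add_div hD, Nat.div_eq_of_lt hj, Nat.add_zero]

omit [Finite L] [Algebra K L] in
theorem interpRow_spec (hk1 : 1 ≤ k) (hk : k ≤ n) (hs : 1 ≤ s) (hsm : 4 * s < m)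
    (hnm : n * m ≤ N) {D : ℕ} (hD : D = degN (fieldCtx b K n k m s)) (a β y : L) :
    interpRow (fieldCtx b K n k m s) (crd b a) (crd b β) (crd b y) =
      List.ofFn fun t : Fin (D + k - 1 + s * D) => crd b (rowEntry K (D + k - 1) D n a β y t) := by
  obtain ⟨h1, h2, h3, h4, h5, h6, h7, h8⟩ := interp_sizes hk1 hk hs hsm hD
  rw [interpRow, ← hD]
  change (rg (tbl b) (D + k - 1)).map _ ++
    (rg (tbl b) s).flatMap (fun u => (rg (tbl b) D).map _) = _
  have h9 : n ≤ n * m := by omega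
  have hrg : ∀ j ≤ N, rg (tbl b) j = List.range j := fun j hj => rg_eq (by rwa [length_tbl])
  rw [hrg (D + k - 1) (by omega), hrg s (by omega), hrg D (by omega)]
  rw [← map_range_eq_ofFn (D + k - 1 + s * D) fun t => crd b (rowEntry K (D + k - 1) D n a β y t),
    List.range_add, List.map_append, List.map_map]
  congr 1
  · refine List.map_congr_left fun q hq => ?_
    rw [List.mem_range] at hq
    rw [opPowV_spec b (by omega), rowEntry, if_pos hq]
  · rw [← flatMap_range_eq s D (fun u j => crd b (opPow K j a (y ^ Nat.card K ^ (n * u))))]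
    · refine List.flatMap_congr fun u hu => List.map_congr_left fun j hj => ?_
      rw [List.mem_range] at hu hj
      have h10 : n * u ≤ n * s := Nat.mul_le_mul_left n hu.le
      change opPowV _ _ j (frob (fieldCtx b K n k m s) (n * u) _) = _
      rw [frob_spec b (by omega), opPowV_spec b (by omega)]
    · intro u j hj
      simp only [Function.comp]
      rw [rowEntry, if_neg (by omega), Nat.add_sub_cancel_left, Nat.mul_comm u D,
        Nat.mul_add_mod, Nat.mod_eq_of_lt hj, Nat.mul_add_div h1, Nat.div_eq_of_lt hj, Nat.add_zero]

/-- A word, as a list of lists of coordinates. -/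
noncomputable def wordL {ℓ : ℕ} {ν : Fin ℓ → ℕ} (w : BlockWord L ν) : List (List (List ℕ)) :=
  List.ofFn fun i => List.ofFn fun j => crd b (w i j)

omit [Finite L] in
theorem interpRows_spec {ℓ : ℕ} {ν : Fin ℓ → ℕ} (a : Fin ℓ → L) (β y : BlockWord L ν) (c : Ctx) :
    interpRows c (List.ofFn fun i => crd b (a i)) (wordL b β) (wordL b y) =
      (List.ofFn fun i => List.ofFn fun j =>
        interpRow c (crd b (a i)) (crd b (β i j)) (crd b (y i j))).flatten := by
  rw [interpRows, wordL, wordL, zip_ofFn, zip_ofFn, List.flatMap_def, List.map_ofFn]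
  congr 2
  funext i
  simp only [Function.comp]
  rw [zip_ofFn, List.map_ofFn]
  rfl

omit [Finite L] in
/-- The interpolation computes a nonzero solution of the interpolation problem. -/
theorem interpV_spec (hk1 : 1 ≤ k) (hk : k ≤ n) (hs : 1 ≤ s) (hsm : 4 * s < m)
    (hnm : n * m ≤ N) {D : ℕ} (hD : D = degN (fieldCtx b K n k m s)) {ℓ : ℕ} {ν : Fin ℓ → ℕ}
    (hν : ∑ i, ν i = n) (a : Fin ℓ → L) (β y : BlockWord L ν) :
    ∃ v : Fin (D + k - 1 + s * D) → L,
      interpV (fieldCtx b K n k m s) (List.ofFn fun i => crd b (a i)) (wordL b β) (wordL b y) =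
        rep b v ∧ v ≠ 0 ∧
      ∀ i j, interpLin K (entry v) (fun u j => entry v (D + k - 1 + (u * D + j)))
        (D + k - 1) s D n (a i) (β i j, y i j) = 0 := by
  subst hD
  obtain ⟨h1, h2, h3, h4, h5, h6, h7, h8⟩ := interp_sizes hk1 hk hs hsm
    (D := degN (fieldCtx b K n k m s)) rfl
  have hrow := fun a β y => interpRow_spec (K := K) b hk1 hk hs hsm hnm rfl a β y
  have hr : numCoeff (fieldCtx b K n k m s) =
    degN (fieldCtx b K n k m s) + k - 1 + s * degN (fieldCtx b K n k m s) := rfl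
  rw [interpV, hr, interpRows_spec]
  change ∃ v, (kerBy p ((stdV (tbl b) _).map fun v =>
    ((List.map (fun r => dotL p (tbl b) v r) _).flatten, v))).headD [] = _ ∧ _
  generalize degN (fieldCtx b K n k m s) = D at *
  generalize hrr : D + k - 1 + s * D = r at *
  obtain ⟨std, hs1, hs2, hs3⟩ := stdV_tbl b (r := r) (by omega)
  let us : List ((Fin r → L) → L) := (List.ofFn fun i => List.ofFn fun j v =>
    ∑ t : Fin r, v t * rowEntry K (D + k - 1) D n (a i) (β i j) (y i j) t).flatten
  have hmem : ∀ u, u ∈ us ↔ ∃ i j, u = fun v =>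
      ∑ t : Fin r, v t * rowEntry K (D + k - 1) D n (a i) (β i j) (y i j) t := by
    intro u
    simp only [us, List.mem_flatten, List.mem_ofFn]
    constructor
    · rintro ⟨_, ⟨i, rfl⟩, h⟩
      obtain ⟨j, rfl⟩ := List.mem_ofFn.1 h
      exact ⟨i, j, rfl⟩
    · rintro ⟨i, j, rfl⟩
      exact ⟨_, ⟨i, rfl⟩, List.mem_ofFn.2 ⟨j, rfl⟩⟩
  obtain ⟨l', h9, h10, h11⟩ := kerBy_spec b us (by
      intro u hu x y
      obtain ⟨i, j, rfl⟩ := (hmem u).1 hu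
      simp only [Pi.add_apply, add_mul, Finset.sum_add_distrib]) hs2
    (fun v => ((List.ofFn fun i => List.ofFn fun j => interpRow (fieldCtx b K n k m s)
      (crd b (a i)) (crd b (β i j)) (crd b (y i j))).flatten).map fun r => dotL p (tbl b) v r) (by
      intro v _
      simp only [us, List.map_flatten, List.map_ofFn]
      congr 2
      funext i
      simp only [Function.comp, List.map_ofFn]
      congr 1
      funext j
      simp only [Function.comp, hrow]
      exact dotL_ofFn b _ _)
  rw [hs1, h9]
  -- there are more unknowns than equations
  let T : (Fin r → L) →ₗ[L] ((Σ i, Fin (ν i)) → L) := LinearMap.pi fun z =>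
    ∑ t : Fin r, LinearMap.mulRight L
      (rowEntry K (D + k - 1) D n (a z.1) (β z.1 z.2) (y z.1 z.2) t) ∘ₗ LinearMap.proj t
  have hker : LinearMap.ker T ≠ ⊥ := by
    refine LinearMap.ker_ne_bot_of_finrank_lt ?_
    rw [Module.finrank_fintype_fun_eq_card, Module.finrank_fintype_fun_eq_card, Fintype.card_sigma,
      Fintype.card_fin]
    simp only [Fintype.card_fin]
    omega
  obtain ⟨w, hw, hw0⟩ := Submodule.exists_mem_ne_zero_of_ne_bot hker
  have hw' : w ∈ spanL (ZMod p) l' := by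
    rw [h11, hs3]
    refine ⟨Submodule.mem_top, fun u hu => ?_⟩
    obtain ⟨i, j, rfl⟩ := (hmem u).1 hu
    have := congrFun (LinearMap.mem_ker.1 hw) ⟨i, j⟩
    simpa [T] using this
  cases l' with
  | nil =>
    rw [spanL_nil, Submodule.mem_bot] at hw'
    exact absurd hw' hw0
  | cons v l' =>
    refine ⟨v, rfl, ?_, fun i j => ?_⟩
    · rintro rfl
      exact (liList_cons.1 h10).1 (zero_mem _)
    · have h12 := ((h11 v).1 (mem_spanL_of_mem List.mem_cons_self)).2 _ ((hmem _).2 ⟨i, j, rfl⟩)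
      rw [← h12]
      exact (sum_entry_mul_rowEntry h1 hrr.symm v _ _ _).symm

omit [Finite L] [Algebra K L] in
theorem solveCoeff_spec (hk1 : 1 ≤ k) (hk : k ≤ n) (hs : 1 ≤ s) (hsm : 4 * s < m)
    (hnm : n * m ≤ N) {D r : ℕ} (hD : D = degN (fieldCtx b K n k m s))
    (A : Fin r → L) (w : Fin (k + 1) → L) (i : ℕ) :
    solveCoeff (fieldCtx b K n k m s) (rep b A) (rep b w) i = crd b (solveCoef K (entry A)
      (fun u j => entry A (D + k - 1 + (u * D + j))) s D n (w 0) (fun l => w l.succ) i) := by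
  obtain ⟨h1, h2, h3, h4, h5, h6, h7, h8⟩ := interp_sizes hk1 hk hs hsm hD
  have hrg : ∀ j ≤ N, rg (tbl b) j = List.range j := fun j hj => rg_eq (by rwa [length_tbl])
  rw [solveCoeff, ← hD]
  change vsum p (tbl b) (mulV p (tbl b) (nthV (tbl b) _ 0) (nthV (tbl b) _ i) ::
    (rg (tbl b) s).flatMap fun u => (rg (tbl b) D).flatMap fun j => (rg (tbl b) k).map fun l =>
      ifz (eqN (j + l) i) (zeroV (tbl b)) (mulV p (tbl b) (nthV (tbl b) _ (D + k - 1 + u * D + j))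
        (frob (fieldCtx b K n k m s) (j + n * u) (nthV (tbl b) _ (l + 1))))) = _
  rw [hrg s (by omega), hrg D (by omega), hrg k (by omega)]
  let l' : List L := (entry w 0 * entry A i) ::
    (List.range s).flatMap fun u => (List.range D).flatMap fun j => (List.range k).map fun l =>
      if j + l = i then entry A (D + k - 1 + (u * D + j)) *
        entry w (l + 1) ^ Nat.card K ^ (j + n * u) else 0
  have hsum : ∀ X, X = l'.map (crd b) → vsum p (tbl b) X = crd b (solveCoef K (entry A)
      (fun u j => entry A (D + k - 1 + (u * D + j))) s D n (w 0) (fun l => w l.succ) i) := by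
    rintro _ rfl
    rw [vsum_map]
    congr 1
    simp only [l', List.sum_cons, sum_flatMap_range, sum_map_range]
    rw [solveCoef]
    congr 1
    refine Finset.sum_congr rfl fun u _ => Finset.sum_congr rfl fun j _ => ?_
    rw [Finset.sum_range]
    refine Finset.sum_congr rfl fun l _ => ?_
    have h11 : entry w ((l : ℕ) + 1) = w l.succ := entry_fin w l.succ
    rw [h11]
  refine hsum _ ?_
  · simp only [l', List.map_cons, List.map_flatMap, List.map_map]
    refine congrArg₂ _ (by rw [nthV_rep, nthV_rep, mulV_crd]) ?_
    refine List.flatMap_congr fun u hu => List.flatMap_congr fun j hj =>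
      List.map_congr_left fun l hl => ?_
    rw [List.mem_range] at hu hj hl
    have h10 : n * (u + 1) ≤ n * s := Nat.mul_le_mul_left n hu
    rw [mul_add, mul_one] at h10
    simp only [Function.comp]
    rw [nthV_rep, nthV_rep, frob_spec b (by omega), mulV_crd, zeroV_tbl, eqN_eq, ifz,
      Nat.add_assoc]
    by_cases h11 : j + l = i
    · rw [if_pos h11, if_pos h11, if_neg one_ne_zero]
    · rw [if_neg h11, if_neg h11, if_pos rfl]

end

/-! ### The space of solutions and its basis -/

section
variable {p N : ℕ} [Fact p.Prime] {K E L : Type*} [Field K] [Field E] [Field L] [Finite K]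
  [Finite E] [Finite L] [Algebra K E] [Algebra E L] [Algebra K L] [IsScalarTower K E L]
  [Algebra (ZMod p) L] (b : Basis (Fin N) (ZMod p) L) {n k m s : ℕ}

omit [Finite L] in
theorem searchV_spec (hkN : k + 1 ≤ N) (H : ℕ → Submodule K L)
    (hH : ∀ i, ∃ l : List L, designV (fieldCtx b K n k m s) i = l.map (crd b) ∧
      LIList (ZMod p) l ∧ ∀ x, x ∈ spanL (ZMod p) l ↔ x ∈ H i) :
    ∃ l : List (Fin (k + 1) → L), searchV (fieldCtx b K n k m s) = l.map (rep b) ∧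
      LIList (ZMod p) l ∧ ∀ v, v ∈ spanL (ZMod p) l ↔
        (∃ c : K, algebraMap K L c = v 0) ∧ ∀ l : Fin k, v l.succ ∈ H l := by
  obtain ⟨F, hF1, hF2, hF3⟩ := botBasis_spec (K := K) (n := n) (k := k) (m := m) (s := s) b
  choose Ls hL1 hL2 hL3 using hH
  obtain ⟨h1, h2⟩ := liList_flatMap_single (F := ZMod p) (V := L)
    (Fin.cons F fun i : Fin k => Ls i : Fin (k + 1) → List L)
    (fun i => Fin.cases hF2 (fun i => hL2 i) i)
  refine ⟨_, ?_, h1, fun v => ?_⟩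
  · rw [searchV, List.finRange_succ, List.flatMap_cons, List.map_append, hF1]
    change List.map (fun x => emb (tbl b) (k + 1) 0 x) _ ++ (rg (tbl b) k).flatMap
      (fun i => (designV (fieldCtx b K n k m s) i).map fun x => emb (tbl b) (k + 1) (i + 1) x) = _
    rw [rg_eq (by rw [length_tbl]; omega), List.flatMap_def, map_range_eq_ofFn]
    refine congrArg₂ _ ?_ ?_
    · rw [List.map_map, List.map_map]
      exact List.map_congr_left fun x _ => emb_tbl b hkN 0 x
    · rw [List.flatMap_map, List.map_flatMap, List.flatMap_def, List.ofFn_eq_map]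
      congr 1
      refine List.map_congr_left fun i _ => ?_
      rw [hL1, List.map_map, List.map_map]
      exact List.map_congr_left fun x _ => emb_tbl b hkN i.succ x
  · rw [h2, Fin.forall_fin_succ]
    refine and_congr (hF3 _) (forall_congr' fun i => ?_)
    exact hL3 i _

/-- The projection that forgets the scalar. -/
def tailMap (K L : Type*) [Field K] [Field L] [Algebra K L] (k : ℕ) :
    (Fin (k + 1) → L) →ₗ[K] (Fin k → L) :=
  LinearMap.funLeft K L Fin.succ

omit [Finite L] in
/-- The messages that are computed by the decoder. -/
theorem messagesV_spec (hk1 : 1 ≤ k) (hk : k ≤ n) (hs : 1 ≤ s) (hsm : 4 * s < m)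
    (hnm : n * m ≤ N) {D r : ℕ} (hD : D = degN (fieldCtx b K n k m s)) (A : Fin r → L)
    (H : ℕ → Submodule K L)
    (hH : ∀ i, ∃ l : List L, designV (fieldCtx b K n k m s) i = l.map (crd b) ∧
      LIList (ZMod p) l ∧ ∀ x, x ∈ spanL (ZMod p) l ↔ x ∈ H i) :
    ∃ M : List (Fin k → L), messagesV (fieldCtx b K n k m s) (rep b A) = M.map (rep b) ∧
      LIList K M ∧ spanL K M = (solutionSpace K (entry A)
        (fun u j => entry A (D + k - 1 + (u * D + j))) (D + k - 1) s D n
          (fun i : Fin k => H i)).map (tailMap K L k) := by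
  obtain ⟨h1, h2, h3, h4, h5, h6, h7, h8⟩ := interp_sizes hk1 hk hs hsm hD
  obtain ⟨l, hl1, hl2, hl3⟩ := searchV_spec b (by omega) H hH
  obtain ⟨F, hF1, -, hF3⟩ := botBasis_spec (K := K) (n := n) (k := k) (m := m) (s := s) b
  set S := solutionSpace K (entry A) (fun u j => entry A (D + k - 1 + (u * D + j)))
    (D + k - 1) s D n (fun i : Fin k => H i) with hS
  obtain ⟨l', h9, h10, h11⟩ := kerBy_spec b
    ((List.range (D + k - 1)).map fun i (v : Fin (k + 1) → L) => solveCoef K (entry A)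
      (fun u j => entry A (D + k - 1 + (u * D + j))) s D n (v 0) (fun l => v l.succ) i)
    (by
      intro u hu x y
      obtain ⟨i, -, rfl⟩ := List.mem_map.1 hu
      exact solveCoef_add _ _ _ _ _ _ _ _) hl2
    (fun v => (List.range (D + k - 1)).map fun i =>
      solveCoeff (fieldCtx b K n k m s) (rep b A) v i)
    (by
      intro v _
      rw [List.map_map]
      exact List.map_congr_left fun i _ => solveCoeff_spec b hk1 hk hs hsm hnm hD A v i)
  have h12 : ∀ v, v ∈ spanL (ZMod p) l' ↔ v ∈ S := by
    intro v
    rw [h11, hl3]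
    simp only [List.mem_map, List.mem_range, forall_exists_index, and_imp,
      forall_apply_eq_imp_iff₂]
    exact and_assoc
  have h13 : spanL K l' = S := by
    refine le_antisymm (spanL_le.2 fun x hx => (h12 x).1 (mem_spanL_of_mem hx)) fun x hx => ?_
    let U : Submodule (ZMod p) (Fin (k + 1) → L) :=
      AddSubgroup.toZModSubmodule p (spanL K l').toAddSubgroup
    have : spanL (ZMod p) l' ≤ U := spanL_le.2 fun y hy => by
      change y ∈ spanL K l'
      exact mem_spanL_of_mem hy
    exact this ((h12 x).2 hx)
  obtain ⟨M, h14, h15, h16⟩ := greedy_spec b hF3 (r := k) (by omega) (l'.map (tailMap K L k))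
  refine ⟨M, ?_, h15, by rw [h16, spanL_map, h13]⟩
  rw [← h14, messagesV, hF1, hl1, ← hD]
  change greedy p (tbl b) _ k ((kerBy p (((l.map (rep b)).map fun v =>
    ((List.map (fun i => solveCoeff (fieldCtx b K n k m s) (rep b A) v i)
      (rg (tbl b) (D + k - 1))).flatten, v)))).map fun v => v.tail) = _
  rw [rg_eq (by rw [length_tbl]; omega), h9, List.map_map, List.map_map]
  congr 1
  refine List.map_congr_left fun v _ => ?_
  simp only [Function.comp]
  rw [rep, List.ofFn_succ, List.tail_cons]
  rfl

omit [Finite E] [IsScalarTower K E L] [Finite L] [Algebra K E] [Algebra K L] in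
theorem encodeV_spec (hkN : k ≤ N) {ℓ : ℕ} {ν : Fin ℓ → ℕ} (a : Fin ℓ → E) (β : BlockWord E ν)
    (f : Fin k → L) :
    encodeV (fieldCtx b K n k m s) (List.ofFn fun i => crd b (algebraMap E L (a i)))
      (wordL b fun i j => algebraMap E L (β i j)) (rep b f) = wordL b (lrsEval K L k a β f) := by
  rw [encodeV, wordL, zip_ofFn, List.map_ofFn, wordL]
  congr 1
  funext i
  simp only [Function.comp, List.map_ofFn]
  congr 1
  funext j
  simp only [Function.comp]
  change dotL p (tbl b) _ ((rg (tbl b) k).map _) = _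
  rw [rg_eq (by rwa [length_tbl]), map_range_eq_ofFn]
  have h1 : ∀ q : Fin k, opPowV (fieldCtx b K n k m s) (crd b (algebraMap E L (a i))) q
      (crd b (algebraMap E L (β i j))) =
      crd b (opPow K q (algebraMap E L (a i)) (algebraMap E L (β i j))) :=
    fun q => opPowV_spec b (q.2.le.trans hkN) _ _
  simp only [h1]
  refine (dotL_ofFn b _ _).trans (congrArg (crd b) ?_)
  change _ = opEval K f _ _
  rw [opEval]
  exact Finset.sum_congr rfl fun q _ => (mul_assoc _ _ _).symm

/-- A word whose distance from a codeword is at most `s / (s + 1) * (n - k)` agrees with it in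
enough evaluation points. -/
theorem dist_add_le (hk : k ≤ n) (hs : 1 ≤ s) {D : ℕ} (hD : D = (n - k + 1) / (s + 1) + 1)
    {e : ℕ} (he : (s + 1) * e ≤ s * (n - k)) : e + (D + k - 1) ≤ n := by
  have h1 := Nat.div_add_mod (n - k + 1) (s + 1)
  have h2 := Nat.mod_lt (n - k + 1) (Nat.succ_pos s)
  generalize (n - k + 1) / (s + 1) = q at *
  subst hD
  by_contra hcon
  -- otherwise `e + q` exceeds `n - k`
  have h3 : (s + 1) * (n - k + 1) ≤ (s + 1) * (e + q) := Nat.mul_le_mul_left _ (by omega)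
  have h4 : (s + 1) * (n - k + 1) = s * (n - k) + (n - k) + s + 1 := by ring
  have h5 : (s + 1) * (e + q) = (s + 1) * e + (s + 1) * q := by ring
  omega

/-- The space computed by the decoder. -/
theorem decodeV_spec (hn : finrank K E = n) (hm : finrank E L = m) (hk1 : 1 ≤ k) (hk : k ≤ n)
    (hs : 1 ≤ s) (hsm : 4 * s < m) (hnm : n * m ≤ N) (H : ℕ → Submodule K L)
    (hH : ∀ i, ∃ l : List L, designV (fieldCtx b K n k m s) i = l.map (crd b) ∧
      LIList (ZMod p) l ∧ ∀ x, x ∈ spanL (ZMod p) l ↔ x ∈ H i) {Δ : ℕ}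
    (hΔ : ∀ W : Submodule E L, finrank E W = s →
      ∑ i : Fin k, finrank K ↥(H i ⊓ W.restrictScalars K) ≤ Δ)
    {ℓ : ℕ} {ν : Fin ℓ → ℕ} {a : Fin ℓ → E} {β : BlockWord E ν} (hν : ∑ i, ν i = n)
    (hab : IsEvaluationPair K L a β) (y : BlockWord L ν) :
    ∃ V : Submodule K (BlockWord L ν), V ≤ lrsSubcode K (fun i : Fin k => H i) a β ∧
      finrank K V ≤ 1 + Δ ∧
      (∀ x ∈ lrsSubcode K (fun i : Fin k => H i) a β,
        (s + 1) * sumRankDist K x y ≤ s * (n - k) → x ∈ V) ∧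
      ∃ l : List (BlockWord L ν), IsBasisList K l V ∧
        decodeV (fieldCtx b K n k m s) (List.ofFn fun i => crd b (algebraMap E L (a i)))
          (wordL b fun i j => algebraMap E L (β i j)) (wordL b y) = l.map (wordL b) := by
  obtain ⟨D, hD⟩ : ∃ D, D = degN (fieldCtx b K n k m s) := ⟨_, rfl⟩
  obtain ⟨h1, h2, h3, h4, h5, h6, h7, h8⟩ := interp_sizes hk1 hk hs hsm hD
  obtain ⟨v, hv1, hv2, hv3⟩ := interpV_spec (K := K) b hk1 hk hs hsm hnm hD hν
    (fun i => algebraMap E L (a i)) (fun i j => algebraMap E L (β i j)) y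
  obtain ⟨M, hM1, hM2, hM3⟩ := messagesV_spec b hk1 hk hs hsm hnm hD v H hH
  set A : ℕ → ℕ → L := fun u j => entry v (D + k - 1 + (u * D + j)) with hA
  set S := solutionSpace K (entry v) A (D + k - 1) s D n (fun i : Fin k => H i) with hS
  have hinj := lrsEval_injective hab hν hk
  let T : (Fin k → L) →ₗ[K] BlockWord L ν := (lrsEval K L k a β).restrictScalars K
  have hT : Function.Injective T := hinj
  -- one of the polynomials `A u` is nonzero
  have hA0 : ∃ u < s, ∃ j < D, A u j ≠ 0 := by
    by_contra! hcon
    have h9 := exists_ne_zero_of_interp hab hν y (entry v) A h2 hv3 hcon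
    refine hv2 (funext fun t => ?_)
    rw [← entry_fin v t]
    rcases Nat.lt_or_ge (t : ℕ) (D + k - 1) with ht | ht
    · exact h9 t ht
    · have h10 : ((t : ℕ) - (D + k - 1)) / D < s := by
        rw [Nat.div_lt_iff_lt_mul h1]
        have := t.2
        omega
      have h11 := hcon _ h10 _ (Nat.mod_lt ((t : ℕ) - (D + k - 1)) h1)
      simp only [hA] at h11
      rwa [Nat.div_add_mod', Nat.add_sub_cancel' ht] at h11
  refine ⟨(S.map (tailMap K L k)).map T, ?_, ?_, ?_, M.map T, ?_, ?_⟩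
  · refine Submodule.map_mono ?_
    rintro _ ⟨w, hw, rfl⟩ i _
    exact hw.2.1 i
  · refine (Submodule.finrank_map_le _ _).trans ((Submodule.finrank_map_le _ _).trans ?_)
    exact finrank_solutionSpace_le hn (by omega) (by omega) _ _ hA0 _ hΔ
  · rintro _ ⟨g, hg, rfl⟩ hdist
    refine ⟨g, ⟨Fin.cons 1 g, ⟨⟨1, map_one _⟩, fun l => hg l trivial, ?_⟩, rfl⟩, rfl⟩
    exact solveCoef_eq_zero hn hab hν y (entry v) A (by omega) hv3 g (dist_add_le hk hs hD hdist)
  · refine isBasisList_iff.2 ⟨hM2.map fun x _ hx => hT (hx.trans (map_zero T).symm), ?_⟩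
    rw [spanL_map, hM3]
  · rw [decodeV, hv1, hM1, List.map_map, List.map_map]
    exact List.map_congr_left fun f _ => encodeV_spec b (by omega) a β f

end

open Enc

/-! ### The encodings, the rate and the constants -/

section
variable {p N : ℕ} [Fact p.Prime] {L : Type*} [Field L] [Algebra (ZMod p) L]
  (b : Basis (Fin N) (ZMod p) L)

theorem encElem_eq (x : L) : encElem b x = enc (crd b x) := by
  change _ = Data.ofList ((List.ofFn _).map enc)
  rw [List.map_ofFn]
  rfl

theorem enc_ofFn_crd {r : ℕ} (v : Fin r → L) :
    enc (List.ofFn fun i => crd b (v i)) = Data.ofList (List.ofFn fun i => encElem b (v i)) := by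
  change Data.ofList ((List.ofFn _).map enc) = _
  rw [List.map_ofFn]
  congr 2
  funext i
  exact (encElem_eq b _).symm

theorem encWord_eq {ℓ : ℕ} {ν : Fin ℓ → ℕ} (w : BlockWord L ν) :
    encWord b w = enc (wordL b w) := by
  change Data.ofList (List.map Data.ofList _) = Data.ofList ((List.ofFn _).map enc)
  rw [List.map_ofFn, List.map_ofFn]
  congr 2
  funext i
  exact (enc_ofFn_crd b _).symm

theorem encTable_eq : encTable b = enc (tbl b) := by
  change Data.ofList (List.map Data.ofList _) = Data.ofList ((List.ofFn _).map enc)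
  rw [List.map_ofFn, List.map_ofFn]
  congr 2
  funext i
  exact (enc_ofFn_crd b fun j => b i * b j).symm

/-- The parameters as an input of the algorithms. -/
noncomputable def paramsOf (h n k : ℕ) : ℕ × List (List (List ℕ)) × ℕ × ℕ × ℕ × ℕ :=
  (p, tbl b, h, n, k, 0)

theorem encParams_eq (h n k : ℕ) : encParams b h n k = enc (paramsOf b h n k) := by
  rw [encParams, encTable_eq]
  rfl

theorem encReceived_eq (h n k : ℕ) {E : Type*} [Field E] [Algebra E L] {ℓ : ℕ} {ν : Fin ℓ → ℕ}
    (a : Fin ℓ → E) (β : BlockWord E ν) (y : BlockWord L ν) :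
    encReceived b h n k a β y = enc (paramsOf b h n k,
      (List.ofFn fun i => crd b (algebraMap E L (a i))),
      wordL b (fun i j => algebraMap E L (β i j)), wordL b y, 0) := by
  rw [encReceived, encParams_eq, encWord_eq, encWord_eq, ← enc_ofFn_crd]
  rfl

/-- The parameters `m` and `s`, which are built into the programs, are no longer than the input,
because the table has length `N ≥ m`. -/
theorem sz_le_paramsOf {s m : ℕ} (hs : s ≤ m) (hm : m ≤ N) (h n k : ℕ) :
    sz (m, s) ≤ 2 * sz (paramsOf b h n k) := by
  have h1 := length_le_sz (tbl b)
  rw [length_tbl] at h1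
  have h2 : Nat.size m ≤ m := Nat.size_le.2 Nat.lt_two_pow_self
  have h3 : Nat.size s ≤ s := Nat.size_le.2 Nat.lt_two_pow_self
  rw [paramsOf, sz_prod, sz_prod, sz_prod, sz_prod, sz_prod, sz_prod, sz_nat, sz_nat]
  have h4 := one_le_sz p
  omega

end

section
variable {K E L : Type*} [Field K] [Field E] [Field L] [Finite K]
  [Finite E] [Finite L] [Algebra K E] [Algebra E L] [Algebra K L] [IsScalarTower K E L]

omit [Finite E] in
theorem sum_finrank_le_finrank_lrsSubcode {n k : ℕ} {ℓ : ℕ} {ν : Fin ℓ → ℕ} {a : Fin ℓ → E}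
    {β : BlockWord E ν} (hν : ∑ i, ν i = n) (hk : k ≤ n) (hab : IsEvaluationPair K L a β)
    (H : Fin k → Submodule K L) :
    ∑ i, finrank K (H i) ≤ finrank K (lrsSubcode K H a β) := by
  have hinj := lrsEval_injective hab hν hk
  rw [← Module.finrank_pi_fintype K]
  let f : ((i : Fin k) → H i) →ₗ[K] lrsSubcode K H a β :=
    { toFun := fun v => ⟨lrsEval K L k a β fun i => v i, (fun i => (v i : L)),
        fun i _ => (v i).2, rfl⟩
      map_add' := fun v w => Subtype.ext ((lrsEval K L k a β).map_add _ _)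
      map_smul' := fun c v =>
        Subtype.ext (((lrsEval K L k a β).restrictScalars K).map_smul c fun i => (v i : L)) }
  refine LinearMap.finrank_le_finrank_of_injective (f := f) fun v w h => ?_
  have h1 := hinj (Subtype.ext_iff.1 h)
  exact funext fun i => Subtype.ext (congrFun h1 i)

/-- The rate of the subcode is the average relative dimension of the spaces of the design, scaled by
`k / n`; here `3 s / m ≤ 3 ε / 4`. -/
theorem codeRate_ge {n m k s : ℕ} {ε : ℝ} (hn : finrank K E = n) (hm : finrank E L = m)
    (hk1 : 1 ≤ k) (hk : k ≤ n) (hε : 0 < ε) (hs1 : 1 ≤ s) (hs : 4 * (s : ℝ) ≤ ε * m)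
    {ℓ : ℕ} {ν : Fin ℓ → ℕ} {a : Fin ℓ → E} {β : BlockWord E ν} (hν : ∑ i, ν i = n)
    (hab : IsEvaluationPair K L a β) (H : Fin k → Submodule K L)
    (hH : ∀ i, n * m ≤ finrank K (H i) + 3 * s * n) :
    (1 - 2 * ε) * ((k : ℝ) / n) ≤ codeRate K (lrsSubcode K H a β) := by
  have h1 := sum_finrank_le_finrank_lrsSubcode hν hk hab H
  set r := finrank K (lrsSubcode K H a β) with hr
  have h2 : k * (n * m) ≤ r + k * (3 * s * n) := by
    have h3 : ∑ _i : Fin k, n * m ≤ ∑ i : Fin k, (finrank K (H i) + 3 * s * n) :=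
      Finset.sum_le_sum fun i _ => hH i
    rw [Finset.sum_add_distrib, Finset.sum_const, Finset.sum_const, Finset.card_univ,
      Fintype.card_fin, smul_eq_mul, smul_eq_mul] at h3
    omega
  have hq : (1 : ℝ) < Nat.card K := by exact_mod_cast Finite.one_lt_card (α := K)
  have hcL : Nat.card L = Nat.card K ^ (n * m) := by
    rw [Module.natCard_eq_pow_finrank (K := E) (V := L), card_eq_card_pow n hn, hm, pow_mul]
  have hcC : Nat.card (lrsSubcode K H a β) = Nat.card K ^ r :=
    Module.natCard_eq_pow_finrank (K := K)
  have hnpos : (0 : ℝ) < n := by exact_mod_cast (by omega : 0 < n)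
  have hspos : (1 : ℝ) ≤ s := by exact_mod_cast hs1
  have hmpos : (0 : ℝ) < m := by
    by_contra hcon
    have : ε * m ≤ 0 := mul_nonpos_of_nonneg_of_nonpos hε.le (not_lt.1 hcon)
    linarith
  have hlog : Real.log (Nat.card K) ≠ 0 := (Real.log_pos hq).ne'
  have hrate : codeRate K (lrsSubcode K H a β) = (r : ℝ) / (n * m) / n := by
    rw [codeRate, hν, hcL, hcC, Real.logb]
    push_cast
    rw [Real.log_pow, Real.log_pow]
    push_cast
    rw [mul_div_mul_right _ _ hlog]
  rw [hrate, ← mul_div_assoc]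
  refine div_le_div_of_nonneg_right ?_ hnpos.le
  rw [le_div_iff₀ (mul_pos hnpos hmpos)]
  have h4 : (k : ℝ) * (n * m) ≤ r + k * (3 * s * n) := by exact_mod_cast h2
  have h5 : (k : ℝ) * n * (3 * s) ≤ k * n * (2 * (ε * m)) := by
    refine mul_le_mul_of_nonneg_left ?_ (by positivity)
    linarith
  calc (1 - 2 * ε) * k * (n * m) = k * (n * m) - k * n * (2 * (ε * m)) := by ring
    _ ≤ k * (n * m) - k * n * (3 * s) := by linarith
    _ = k * (n * m) - k * (3 * s * n) := by ring
    _ ≤ r := by linarith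

end

/-- The bound `1 + 64 m ^ 2` in terms of `s` and `ε`. -/
theorem dimension_bound {κ ε : ℝ} {s m : ℕ} (hε : 0 < ε) (hm1 : 1 ≤ m) (hm : ε * m ≤ κ * s)
    {Δ : ℕ} (hΔ : Δ ≤ 1 + 64 * (m * m)) : (Δ : ℝ) ≤ 65 * κ ^ 2 * s ^ 2 / ε ^ 2 := by
  rw [le_div_iff₀ (by positivity)]
  have h1 : (Δ : ℝ) ≤ 65 * (m : ℝ) ^ 2 := by
    have h2 : Δ ≤ 65 * m ^ 2 := by
      have : 1 ≤ m * m := Nat.mul_pos hm1 hm1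
      rw [pow_two]
      omega
    exact_mod_cast h2
  have h3 : (ε * m) ^ 2 ≤ (κ * s) ^ 2 := pow_le_pow_left₀ (by positivity) hm 2
  calc (Δ : ℝ) * ε ^ 2 ≤ 65 * (m : ℝ) ^ 2 * ε ^ 2 := mul_le_mul_of_nonneg_right h1 (by positivity)
    _ = 65 * (ε * m) ^ 2 := by ring
    _ ≤ 65 * (κ * s) ^ 2 := by linarith
    _ = 65 * κ ^ 2 * s ^ 2 := by ring

theorem mainTheorem1 :
    ∃ c : ℕ, ∀ κ : ℝ, ∃ C : ℝ, ∀ (ε : ℝ) (s m : ℕ), 0 < ε → ε < 1 → 1 ≤ s →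
      4 * (s : ℝ) ≤ ε * m → ε * m ≤ κ * s →
    ∃ construct decode : Prog,
    ∀ (p N n k : ℕ) [Fact p.Prime] (K E L : Type*) [Field K] [Field E] [Field L] [Finite L]
      [Algebra K E] [Algebra E L] [Algebra K L] [IsScalarTower K E L] [Algebra (ZMod p) L]
      (b : Module.Basis (Fin N) (ZMod p) L),
      Module.finrank K E = n → Module.finrank E L = m → 1 ≤ k → k ≤ n →
    ∃ H : Fin k → Submodule K L,
      -- the `H i` form an explicit subspace design
      IsSubspaceDesign K E s (C * s ^ 2 / ε ^ 2) H ∧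
      (∃ B : Fin k → List L, (∀ i, IsBasisList K (B i) (H i)) ∧
        RunsInPolyTime c construct (encParams b (Nat.card K) n k)
          (Data.ofLists (List.ofFn fun i => (B i).map (encElem b)))) ∧
      ∀ (ℓ : ℕ) (ν : Fin ℓ → ℕ) (a : Fin ℓ → E) (β : BlockWord E ν),
        (∀ i, 0 < ν i) → ∑ i, ν i = n → IsEvaluationPair K L a β →
        -- the subcode and its rate
        lrsSubcode K H a β ≤ (lrsCode K L k a β).restrictScalars K ∧
        (1 - 2 * ε) * ((k : ℝ) / n) ≤ codeRate K (lrsSubcode K H a β) ∧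
        -- list decoding
        ∀ y : BlockWord L ν,
          ∃ V : Submodule K (BlockWord L ν),
            V ≤ lrsSubcode K H a β ∧
            (Module.finrank K V : ℝ) ≤ C * s ^ 2 / ε ^ 2 ∧
            {x | x ∈ lrsSubcode K H a β ∧
              (sumRankDist K x y : ℝ) ≤ (s : ℝ) / (s + 1) * ((n : ℝ) - k)} ⊆ (V : Set _) ∧
            (({x | x ∈ lrsSubcode K H a β ∧
              (sumRankDist K x y : ℝ) ≤ (s : ℝ) / (s + 1) * ((n : ℝ) - k)}.ncard : ℕ) : ℝ) ≤
                (Nat.card K : ℝ) ^ (C * (s : ℝ) ^ 2 / ε ^ 2) ∧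
            ∃ l : List (BlockWord L ν), IsBasisList K l V ∧
              RunsInPolyTime c decode (encReceived b (Nat.card K) n k a β y)
                (Data.ofList (l.map (encWord b))) := by
  obtain ⟨c₁, hc₁⟩ := pt_construct.exists_prog
  obtain ⟨c₂, hc₂⟩ := pt_decode.exists_prog
  refine ⟨max c₁ c₂, fun κ => ⟨65 * κ ^ 2, fun ε s m hε hε1 hs hsm hmκ => ?_⟩⟩
  obtain ⟨P₁, hP₁⟩ := hc₁ (m, s)
  obtain ⟨P₂, hP₂⟩ := hc₂ (m, s)
  refine ⟨P₁, P₂, ?_⟩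
  intro p N n k _ K E L _ _ _ _ _ _ _ _ _ b hn hm hk1 hk
  have : Finite E := Finite.of_injective _ (algebraMap E L).injective
  have : Finite K := Finite.of_injective _ (algebraMap K E).injective
  -- this is strict because `ε < 1`
  have hsm' : 4 * s < m := by
    have hs1 : (1 : ℝ) ≤ s := by exact_mod_cast hs
    have h1 : (0 : ℝ) < m := by
      by_contra hcon
      have : ε * m ≤ 0 := mul_nonpos_of_nonneg_of_nonpos hε.le (not_lt.1 hcon)
      linarith
    have h2 : (4 * s : ℝ) < m := by nlinarith
    exact_mod_cast h2
  have hnm : n * m ≤ N := mul_le_length (K := K) (E := E) b hn hm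
  have hmN : m ≤ N := (Nat.le_mul_of_pos_left m (by omega)).trans hnm
  have hnN : n ≤ N := (Nat.le_mul_of_pos_right n (by omega)).trans hnm
  obtain ⟨H, hH1, hH2⟩ := designV_spec (k := k) b (by omega) (by omega) hnm
    (show 2 * s ≤ m by omega) hn hm
  obtain ⟨hH3, hH4⟩ := design_bounds hn hm (by omega) hk hs (by omega) H hH2
  have hsz := sz_le_paramsOf b (s := s) (by omega) hmN (Nat.card K) n k
  refine ⟨fun i => H i, fun W hW => ?_, ?_, ?_⟩
  · exact dimension_bound hε (by omega) hmκ ((hH3 W hW).trans (by omega))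
  · obtain ⟨B, hB1, hB2⟩ := constructV_spec b (by omega) (hk.trans hnN) H hH1
    refine ⟨B, hB1, ?_⟩
    have h1 := hP₁ (max c₁ c₂) (le_max_left _ _) (paramsOf b (Nat.card K) n k) hsz
    rw [encParams_eq]
    convert h1 using 1
    change _ = enc (constructV (fieldCtx b K n k m s))
    rw [hB2]
    change Data.ofList (List.map Data.ofList _) = Data.ofList ((List.ofFn _).map enc)
    rw [List.map_ofFn, List.map_ofFn]
    congr 2
    funext i
    change Data.ofList ((B i).map (encElem b)) = Data.ofList (((B i).map (crd b)).map enc)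
    rw [List.map_map]
    congr 1
    exact List.map_congr_left fun x _ => encElem_eq b x
  · intro ℓ ν a β _ hν hab
    refine ⟨?_, codeRate_ge hn hm hk1 hk hε hs hsm hν hab _ fun i => hH4 i, fun y => ?_⟩
    · rintro _ ⟨f, _, rfl⟩
      exact ⟨f, rfl⟩
    · obtain ⟨V, hV1, hV2, hV3, l, hl1, hl2⟩ := decodeV_spec b hn hm hk1 hk hs hsm' hnm H hH1 hH3
        hν hab y
      have hdim := dimension_bound hε (by omega) hmκ hV2
      have hsub : {x | x ∈ lrsSubcode K (fun i : Fin k => H i) a β ∧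
          (sumRankDist K x y : ℝ) ≤ (s : ℝ) / (s + 1) * ((n : ℝ) - k)} ⊆ (V : Set _) := by
        rintro x ⟨hx, hd⟩
        refine hV3 x hx ?_
        rw [div_mul_eq_mul_div, le_div_iff₀ (by positivity), ← Nat.cast_sub hk] at hd
        have h1 : sumRankDist K x y * (s + 1) ≤ s * (n - k) := by exact_mod_cast hd
        rwa [mul_comm]
      refine ⟨V, hV1, hdim, hsub, ?_, l, hl1, ?_⟩
      · have h1 := Set.ncard_le_ncard hsub (Set.toFinite _)
        have h2 : (V : Set (BlockWord L ν)).ncard = Nat.card K ^ finrank K V := by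
          rw [← Module.natCard_eq_pow_finrank (K := K) (V := V)]
          rfl
        rw [h2] at h1
        have h3 : (1 : ℝ) ≤ Nat.card K := by exact_mod_cast Nat.card_pos (α := K)
        calc _ ≤ ((Nat.card K ^ finrank K V : ℕ) : ℝ) := by exact_mod_cast h1
          _ = (Nat.card K : ℝ) ^ (finrank K V : ℝ) := by rw [Nat.cast_pow, Real.rpow_natCast]
          _ ≤ _ := Real.rpow_le_rpow_of_exponent_le h3 hdim
      · have h1 := hP₂ (max c₁ c₂) (le_max_right _ _) (paramsOf b (Nat.card K) n k,
          (List.ofFn fun i => crd b (algebraMap E L (a i))),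
          wordL b (fun i j => algebraMap E L (β i j)), wordL b y, 0)
          (hsz.trans (Nat.mul_le_mul_left 2 (sz_fst_le (_, _))))
        rw [encReceived_eq]
        convert h1 using 1
        change _ = enc (decodeV (fieldCtx b K n k m s) _ _ _)
        rw [hl2]
        change _ = Data.ofList ((l.map (wordL b)).map enc)
        rw [List.map_map]
        exact congrArg Data.ofList (List.map_congr_left fun w _ => encWord_eq b w)
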